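/- There are absolute constants $C_1,C_2,C_3>0$ such that the following holds for all integers $d,r$ and $K\ge 2$ and all reals $\sigma,\epsilon>0$. **Model.** Let $G_1,\dots,G_K$ be probability distributions on $\mathbb R^r$ with means $\mu_k$ which are sub-Gaussian with common parameter $\sigma^2$: $\mathbb E_{\lambda\sim G_k}\,e^{\langle \lambda-\mu_k,a\rangle}\le e^{\sigma^2\|a\|_2^2/2}$ for all $a\in\mathbb R^r$. The loadings $\lambda_1,\dots,\lambda_d$ are drawn independently from the mixture $\sum_k p_kG_k$, and $z_i\in[K]$ is the component from which $\lambda_i$ is drawn. Everything below is conditional on the membership function $z$. Let $n_k=\#\{i:z_i=k\}$, $\alpha=\min_k n_k/d$, $\Delta=\min_{k\ne l}\|\mu_k-\mu_l\|_2$, $M=\max_{k\ne l}\|\mu_k-\mu_l\|_2$, $$\rho_\sigma=\frac{\Delta}{\sigma}\sqrt{\frac{\alpha}{1+Kr/d}},\qquad \rho_\epsilon=\frac{\sqrt\alpha\,\Delta}{\epsilon},\qquad \delta=\frac1d+2\exp\Big(-\frac{\Delta}{\sigma}\Big)+2\exp\Big(-\frac{\Delta^2}{8\epsilon\sigma}\Big).$$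 **Estimates.** Let $\widehat\lambda_1,\dots,\widehat\lambda_d\in\mathbb R^r$ be random vectors, with arbitrary dependence on everything else, estimating the loadings up to a (possibly random) orthogonal transformation $U$ of $\mathbb R^r$; the error is $\max_i\|\widehat\lambda_i-U\lambda_i\|_2$. This includes the PCA estimates in the factor model $X_t=\Lambda f_t+e_t$, where $\Lambda$ has rows $\lambda_i'$: the $\widehat\lambda_i'$ are the rows of $\widehat Q_r\widehat D_r^{1/2}$, with $\widehat D_r$ and $\widehat Q_r$ the $r$ largest eigenvalues and the corresponding orthonormal eigenvectors of $\frac1T\sum_{t=1}^TX_tX_t'$, and $U=Q'$ where $Q$ is orthogonal and $(\Lambda Q)'\Lambda Q$ is diagonal. **Algorithm.** Lloyd's algorithm is run on $\widehat\lambda_1,\dots,\widehat\lambda_d$ from initial labels $\widehat z^{(0)}:[d]\to[K]$ with all clusters nonempty: $\widehat\mu^{(s)}_k$ is the mean of the points with $\widehat z^{(s)}_i=k$, and $\widehat z^{(s+1)}_i\in\operatorname{argmin}_k\|\widehat\lambda_i-\widehat\mu_k^{(s)}\|_2$ (ties, and the center of a cluster that becomes empty, are resolved in any way). Let $A_s=\frac1d\#\{i:\widehat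 z_i^{(s)}\ne z_i\}$. With $\widehat n_k=\#\{i:\widehat z^{(0)}_i=k\}$, $\widehat n_{lk}=\#\{i:z_i=l,\ \widehat z^{(0)}_i=k\}$ and $$G_0=\max_k\max\Big\{\frac1{\widehat n_k}\sum_{l\ne k}\widehat n_{lk},\ \frac1{n_k}\sum_{l\ne k}\widehat n_{kl}\Big\},$$ the initialization is *good enough* if at least one of the following holds: $$G_0\le\Big(\frac12-\frac{\sqrt6+1}{\rho_\sigma}-\frac{2.1\sqrt\alpha+1}{\rho_\epsilon}-\frac1{\alpha^{1/4}}\sqrt{\frac\sigma\Delta}\Big)\frac\Delta M,$$ $$\max_k\frac{\|\widehat\mu_k^{(0)}-U\mu_k\|_2}{\Delta}\le\frac12-\frac1{\rho_\sigma}-\frac{1.1\sqrt\alpha+1}{\rho_\epsilon}-\frac1{\alpha^{1/4}}\sqrt{\frac\sigma\Delta}.$$ **Claim.** Suppose $d\alpha\ge C_1K\log d$, $\rho_\sigma\ge C_2\sqrt K$, $\rho_\epsilon\ge C_3\sqrt K$ and $\Delta^2/(\epsilon\sigma)\ge r\log 3$. Then, conditionally on $z$, with probability greater than $1-\delta$: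 either $\max_i\|\widehat\lambda_i-U\lambda_i\|_2>\epsilon$, or for every good enough (possibly data-dependent) initialization $$A_s\le\max\Big\{\exp\Big(-\frac{\Delta^2}{16\sigma^2}\Big),\ \exp\Big(-\frac{\Delta^2}{8\epsilon\sigma}\Big)\Big\}\qquad\text{for all }s\ge4\log d.$$ In particular, if $\max_i\|\widehat\lambda_i-U\lambda_i\|_2\le\epsilon$ almost surely, this bound holds with probability greater than $1-\delta$ given $z$. -/

import Mathlib

open MeasureTheory ProbabilityTheory

namespace CDFM

noncomputable section

/-! ### Sub-Gaussian mixtures -/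

/-- The mean of a distribution on `ℝ^r`. -/
def mean {r : ℕ} (G : Measure (EuclideanSpace ℝ (Fin r))) : EuclideanSpace ℝ (Fin r) :=
  ∫ x, x ∂G

/-- `G ∼ subG(σ²)`: `E exp ⟨x - mean, a⟩ ≤ exp (σ² ‖a‖² / 2)` for every `a`, the expectation
being finite. -/
def IsSubGaussian {r : ℕ} (G : Measure (EuclideanSpace ℝ (Fin r))) (σ : ℝ) : Prop :=
  ∀ a : EuclideanSpace ℝ (Fin r),
    Integrable (fun x => Real.exp (inner ℝ (x - mean G) a)) G ∧
      ∫ x, Real.exp (inner ℝ (x - mean G) a) ∂G ≤ Real.exp (σ ^ 2 * ‖a‖ ^ 2 / 2)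

/-- The loadings `lam 1, …, lam d` are drawn independently from the mixture `∑ k, p k • G k`, and
`z i` is the index of the component from which `lam i` is drawn. -/
structure IsMixtureSample {Ω : Type*} [MeasurableSpace Ω] (P : Measure Ω) {d K r : ℕ}
    (p : PMF (Fin K)) (G : Fin K → Measure (EuclideanSpace ℝ (Fin r)))
    (z : Fin d → Ω → Fin K) (lam : Fin d → Ω → EuclideanSpace ℝ (Fin r)) : Prop where
  measurable_z : ∀ i, Measurable (z i)
  measurable_lam : ∀ i, Measurable (lam i)
  indep : iIndepFun (fun i ω => (z i ω, lam i ω)) P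
  law : ∀ i k (B : Set (EuclideanSpace ℝ (Fin r))), MeasurableSet B →
    P {ω | z i ω = k ∧ lam i ω ∈ B} = p k * G k B

/-! ### Sizes, distances and signal-to-noise ratios -/

/-- The number of indices with label `k`. -/
def size {d K : ℕ} (z : Fin d → Fin K) (k : Fin K) : ℕ :=
  (Finset.univ.filter fun i => z i = k).card

/-- The number of indices with label `l` under `z` and label `k` under `z'`. -/
def sizeBoth {d K : ℕ} (z z' : Fin d → Fin K) (l k : Fin K) : ℕ :=
  (Finset.univ.filter fun i => z i = l ∧ z' i = k).card

/-- The minimal cluster proportion `α = min_k n_k / d`. -/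
def minProp {d K : ℕ} (z : Fin d → Fin K) : ℝ :=
  ⨅ k : Fin K, (size z k : ℝ) / d

/-- `Δ = min_{k ≠ l} ‖c k - c l‖`. -/
def minDist {K r : ℕ} (c : Fin K → EuclideanSpace ℝ (Fin r)) : ℝ :=
  ⨅ q : {q : Fin K × Fin K // q.1 ≠ q.2}, ‖c q.1.1 - c q.1.2‖

/-- `M = max_{k ≠ l} ‖c k - c l‖`. -/
def maxDist {K r : ℕ} (c : Fin K → EuclideanSpace ℝ (Fin r)) : ℝ :=
  ⨆ q : {q : Fin K × Fin K // q.1 ≠ q.2}, ‖c q.1.1 - c q.1.2‖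

/-- The sub-Gaussian signal-to-noise ratio `ρ_σ = (Δ / σ) √(α / (1 + K r / d))`. -/
def snrNoise (d K r : ℕ) (Δ σ α : ℝ) : ℝ :=
  Δ / σ * √(α / (1 + (K : ℝ) * r / d))

/-- The estimation error signal-to-noise ratio `ρ_ε = √α Δ / ε`. -/
def snrError (Δ ε α : ℝ) : ℝ :=
  √α * Δ / ε

/-- `δ(d, σ, Δ, ε) = 1 / d + 2 exp (- Δ / σ) + 2 exp (- Δ² / (8 ε σ))`. -/
def failProb (d : ℕ) (σ Δ ε : ℝ) : ℝ :=
  1 / (d : ℝ) + 2 * Real.exp (-(Δ / σ)) + 2 * Real.exp (-(Δ ^ 2 / (8 * ε * σ)))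

/-! ### Lloyd's algorithm -/

/-- The mean of the points with label `k`. -/
def clusterMean {d K r : ℕ} (x : Fin d → EuclideanSpace ℝ (Fin r)) (z : Fin d → Fin K)
    (k : Fin K) : EuclideanSpace ℝ (Fin r) :=
  ((size z k : ℝ)⁻¹) • ∑ i ∈ Finset.univ.filter (fun i => z i = k), x i

/-- `zs s`, `ms s` are the labels and the centers after `s` iterations of a run of Lloyd's algorithm
on the points `x`: the center of a nonempty cluster is its mean, and each point is then moved to a
nearest center. Ties, and the center of a cluster that becomes empty, may be resolved in any way. -/
structure IsLloydRun {d K r : ℕ} (x : Fin d → EuclideanSpace ℝ (Fin r))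
    (zs : ℕ → Fin d → Fin K) (ms : ℕ → Fin K → EuclideanSpace ℝ (Fin r)) : Prop where
  center : ∀ s k, (∃ i, zs s i = k) → ms s k = clusterMean x (zs s) k
  assign : ∀ s i k, ‖x i - ms s (zs (s + 1) i)‖ ≤ ‖x i - ms s k‖

/-- The misclustering rate of the labels `z'` with respect to the true labels `z`. -/
def misRate {d K : ℕ} (z z' : Fin d → Fin K) : ℝ :=
  (1 / (d : ℝ)) * ((Finset.univ.filter fun i => z' i ≠ z i).card : ℝ)

/-- The cluster-wise misclustering rate of the labels `z'` with respect to the true labels `z`. -/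
def clusterMisRate {d K : ℕ} (z z' : Fin d → Fin K) : ℝ :=
  ⨆ k : Fin K, max
    ((1 / (size z' k : ℝ)) * ∑ l ∈ Finset.univ.filter (fun l => l ≠ k), (sizeBoth z z' l k : ℝ))
    ((1 / (size z k : ℝ)) * ∑ l ∈ Finset.univ.filter (fun l => l ≠ k), (sizeBoth z z' k l : ℝ))

/-- The initial labels `z₀` (all clusters nonempty) with initial centers `m₀` are good enough, where
`z` are the true labels and `c` the true cluster means. -/
def GoodInit {d K r : ℕ} (z : Fin d → Fin K) (c : Fin K → EuclideanSpace ℝ (Fin r))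
    (σ ε : ℝ) (z₀ : Fin d → Fin K) (m₀ : Fin K → EuclideanSpace ℝ (Fin r)) : Prop :=
  let Δ := minDist c
  let α := minProp z
  let ρσ := snrNoise d K r Δ σ α
  let ρε := snrError Δ ε α
  (∀ k, ∃ i, z₀ i = k) ∧
    (clusterMisRate z z₀ ≤
        (1 / 2 - (√6 + 1) / ρσ - (2.1 * √α + 1) / ρε
          - 1 / α ^ (1 / 4 : ℝ) * √(σ / Δ)) * (Δ / maxDist c) ∨
      ∀ k, ‖m₀ k - c k‖ / Δ ≤
        1 / 2 - 1 / ρσ - (1.1 * √α + 1) / ρε - 1 / α ^ (1 / 4 : ℝ) * √(σ / Δ))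

/-- Every run of Lloyd's algorithm on the points `x` with a good enough initialization has
misclustering rate at most `max {exp (- Δ² / (16 σ²)), exp (- Δ² / (8 ε σ))}` at all iterations
`s ≥ 4 log d`. -/
def LloydSucceeds {d K r : ℕ} (z : Fin d → Fin K) (c : Fin K → EuclideanSpace ℝ (Fin r))
    (σ ε : ℝ) (x : Fin d → EuclideanSpace ℝ (Fin r)) : Prop :=
  ∀ (zs : ℕ → Fin d → Fin K) (ms : ℕ → Fin K → EuclideanSpace ℝ (Fin r)),
    IsLloydRun x zs ms → GoodInit z c σ ε (zs 0) (ms 0) →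
    ∀ s : ℕ, 4 * Real.log d ≤ s →
      misRate z (zs s) ≤
        max (Real.exp (-(minDist c ^ 2 / (16 * σ ^ 2))))
          (Real.exp (-(minDist c ^ 2 / (8 * ε * σ))))

/-! ### Estimation of the loadings in the factor model -/

/-- The factor model `X_t = Λ f_t + e_t`, where `Λ` has the rows `lam i`. -/
def IsFactorModel {Ω : Type*} {d r : ℕ} (lam : Fin d → Ω → EuclideanSpace ℝ (Fin r))
    (f : ℤ → Ω → EuclideanSpace ℝ (Fin r)) (e X : ℤ → Ω → EuclideanSpace ℝ (Fin d)) : Prop :=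
  ∀ t ω i, X t ω i = inner ℝ (lam i ω) (f t ω) + e t ω i

/-- The sample covariance matrix `(1 / T) ∑_{t = 1}^T X_t X_t'`. -/
def sampleCov {d : ℕ} (T : ℕ) (X : ℤ → EuclideanSpace ℝ (Fin d)) : Matrix (Fin d) (Fin d) ℝ :=
  Matrix.of fun i j => (1 / (T : ℝ)) * ∑ t ∈ Finset.Icc (1 : ℤ) T, X t i * X t j

/-- `L` (given by its rows) is a PCA loading matrix `Q_r D_r^{1/2}` of the symmetric matrix `S`: the
columns of `Q_r` are the first `r` eigenvectors of an eigendecomposition `S = Q D Q'` with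
eigenvalues in decreasing order. -/
def IsPCALoadings {d r : ℕ} (S : Matrix (Fin d) (Fin d) ℝ)
    (L : Fin d → EuclideanSpace ℝ (Fin r)) : Prop :=
  ∃ (h : r ≤ d) (Q : Matrix (Fin d) (Fin d) ℝ) (D : Fin d → ℝ),
    Q ∈ Matrix.orthogonalGroup (Fin d) ℝ ∧ Antitone D ∧
      S = Q * Matrix.diagonal D * Q.transpose ∧
      ∀ i j, L i j = Q i (Fin.castLE h j) * √(D (Fin.castLE h j))

/-- The rotation `U` of `ℝ^r` makes `Λ' Λ` diagonal: with `U = Q'` as a matrix, `Λ Q` (whose rows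
are the `U (lam i)`) satisfies `(Λ Q)' (Λ Q) = D` for a diagonal matrix `D`. -/
def DiagonalizesGram {d r : ℕ} (lam : Fin d → EuclideanSpace ℝ (Fin r))
    (U : EuclideanSpace ℝ (Fin r) ≃ₗᵢ[ℝ] EuclideanSpace ℝ (Fin r)) : Prop :=
  ∀ a b : Fin r, a ≠ b → ∑ i, U (lam i) a * U (lam i) b = 0

end

end CDFM

/-!
# Lloyd's algorithm on estimated loadings

Write the estimates as `U (c (ζ i) + w i)` up to an error `ε`, where `ζ` is the membership function,
`c k` is the mean of the component `k` and `w i` is the noise. Given `ζ`, the noise vectors are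
independent and sub-Gaussian (`IsMixtureSample.map_cond`), while the estimates, the rotation `U` and
the initial labels are arbitrary. The proof separates probability from dynamics by an event
`GoodNoise` which involves neither of these and is invariant under rotations, so that `U` may be
absorbed into the means and the noise (`GoodNoise.map`). On this event every run of the algorithm
from a good enough initialization succeeds (`lloydSucceeds_of_goodNoise`), and its complement has
probability less than `δ` (`measure_not_goodNoise_lt`). The estimates of principal component analysis
are a particular choice of arbitrary estimates.

**Dynamics.** A point of cluster `g` moves to cluster `h` only if its noise is aligned with the
difference of the estimated centers (`inner_ge_of_closer`). On the good event the norm of each subset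
sum of the noise is bounded, so few points can be aligned with any one vector, even if this vector
depends on the data (`GoodNoise.card_mul_sq_le`). Hence the labels become `Concentrated` after one
iteration from a good enough initialization (`concentrated_of_goodInit`) and remain so
(`Concentrated.step`). For `r ≥ d` this worst-case bound is too weak in the first iteration. There one
uses that the centers are averages of the same points, so that only the interaction of a point with
itself feels the dimension, whereas the interaction of different points is decoupled
(`card_mul_sq_le_of_clusterMean`).

Once the labels are concentrated, the centers are the true means plus the noise averages over the
true clusters, up to a remainder controlled by the number of misclassified points weighted by the
distance of the two means involved (`Concentrated.size_mul_norm_sq_le`). So a point moves for one of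
three reasons (`aligned_or_large_or_rest`): its noise is aligned with the line between two means, its
noise is of order `Δ² / ε`, or its noise is aligned with the remainder. The first two do not depend
on the labels, and the weighted numbers of such points are part of the good event. The third affects
at most a quarter of the previous weighted number (`sum_disp_rest_le`). The weighted number thus
contracts geometrically to the claimed rate (`sum_disp_le`). After `4 log d` iterations what is left
of its initial value is less than one point, hence does not count.

**Probability.** Averaging the exponential moments of a sub-Gaussian vector over a Gaussian
direction gives exponential moments of its squared norm (`lintegral_eexp_sq_norm_le`), hence the
bounds for subset sums. For the inner product of the noise of the points in `B` with a vector that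
depends only on the other points, Tonelli's theorem integrates out the points in `B`
(`lintegral_eexp_sum_le`). A union bound over all choices of the sets makes both uniform. The
weighted counts are bounded by Markov's inequality; the margin between the exponents of the tail
bounds for single points and the exponents in the claim pays for the factor lost there.
-/

namespace CDFM

/-! ### Exponential moments of sub-Gaussian vectors -/

section Moments

variable {E : Type*} [NormedAddCommGroup E] [InnerProductSpace ℝ E]

/-- `exp` of a real number as an extended nonnegative real, the form in which exponential moments
enter Tonelli's theorem. -/
noncomputable def eexp (x : ℝ) : ENNReal := ENNReal.ofReal (Real.exp x)

lemma eexp_add (x y : ℝ) : eexp (x + y) = eexp x * eexp y := by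
  unfold eexp
  rw [Real.exp_add, ENNReal.ofReal_mul (Real.exp_pos x).le]

lemma eexp_le_eexp {x y : ℝ} : eexp x ≤ eexp y ↔ x ≤ y := by
  unfold eexp
  rw [ENNReal.ofReal_le_ofReal_iff (Real.exp_pos y).le, Real.exp_le_exp]

lemma eexp_zero : eexp 0 = 1 := by simp [eexp]

lemma eexp_ne_top (x : ℝ) : eexp x ≠ ⊤ := ENNReal.ofReal_ne_top

lemma measurable_eexp : Measurable eexp := by
  unfold eexp
  fun_prop

lemma exp_neg_two_mul_le {θ : ℝ} (h0 : 0 ≤ θ) (h1 : θ ≤ 2 / 3) : Real.exp (-(2 * θ)) ≤ 1 - θ := by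
  -- convexity of `exp` between `0` and `-4/3`, where `exp (-4/3) ≤ 1/3`
  have h43 : Real.exp (-(4 / 3)) ≤ 1 / 3 := by
    rw [Real.exp_neg, inv_le_comm₀ (Real.exp_pos _) (by norm_num)]
    have := Real.quadratic_le_exp_of_nonneg (x := 4 / 3) (by norm_num)
    norm_num at this ⊢
    linarith
  have hc := convexOn_exp.2 (Set.mem_univ (0 : ℝ)) (Set.mem_univ (-(4 / 3) : ℝ))
    (show (0 : ℝ) ≤ 1 - 3 / 2 * θ by linarith) (show (0 : ℝ) ≤ 3 / 2 * θ by linarith) (by ring)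
  simp only [smul_eq_mul, Real.exp_zero] at hc
  have e : (1 - 3 / 2 * θ) * 0 + 3 / 2 * θ * -(4 / 3) = -(2 * θ) := by ring
  rw [e] at hc
  nlinarith

variable [FiniteDimensional ℝ E] [MeasurableSpace E] [BorelSpace E]

lemma lintegral_eexp_neg_mul_sq_norm {b : ℝ} (hb : 0 < b) :
    ∫⁻ v : E, eexp (-b * ‖v‖ ^ 2)
      = ENNReal.ofReal ((Real.pi / b) ^ (Module.finrank ℝ E / 2 : ℝ)) := by
  rw [← GaussianFourier.integral_rexp_neg_mul_sq_norm hb]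
  unfold eexp
  rw [ofReal_integral_eq_lintegral_ofReal]
  · have h := GaussianFourier.integrable_cexp_neg_mul_sq_norm_add (V := E) (b := (b : ℂ))
      (by simpa using hb) 0 0
    have h2 := h.norm
    refine h2.congr (Filter.Eventually.of_forall fun v => ?_)
    simp only [zero_mul, add_zero, Complex.norm_exp]
    congr 1
    rw [← Complex.ofReal_pow, ← Complex.ofReal_neg, ← Complex.ofReal_mul, Complex.ofReal_re]
  · exact Filter.Eventually.of_forall fun v => (Real.exp_pos _).le

/-- Completing the square in a Gaussian integral. -/
lemma lintegral_eexp_neg_mul_sq_norm_add_inner {b : ℝ} (hb : 0 < b) (x : E) :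
    ∫⁻ v : E, eexp (-b * ‖v‖ ^ 2 + inner ℝ x v)
      = eexp (‖x‖ ^ 2 / (4 * b)) * ∫⁻ v : E, eexp (-b * ‖v‖ ^ 2) := by
  rw [← lintegral_sub_right_eq_self (fun v : E => eexp (-b * ‖v‖ ^ 2)) ((2 * b)⁻¹ • x),
    ← lintegral_const_mul]
  · refine lintegral_congr fun v => ?_
    rw [← eexp_add]
    congr 1
    rw [norm_sub_sq_real, inner_smul_right, norm_smul, real_inner_comm, mul_pow, Real.norm_eq_abs,
      sq_abs]
    field_simp
    ring
  · exact measurable_eexp.comp (by fun_prop)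

/-- The norm of a sub-Gaussian vector has exponential square moments. Averaging the linear
moment bounds over a Gaussian direction turns them into a bound for the squared norm. -/
lemma lintegral_eexp_sq_norm_le {Ω : Type*} [MeasurableSpace Ω] {ν : Measure Ω} [SFinite ν]
    {X : Ω → E} (hX : Measurable X) {s θ : ℝ} (hs : 0 < s) (h0 : 0 < θ) (h1 : θ ≤ 2 / 3)
    (h : ∀ a : E, ∫⁻ ω, eexp (inner ℝ (X ω) a) ∂ν ≤ eexp (s ^ 2 * ‖a‖ ^ 2 / 2)) :
    ∫⁻ ω, eexp (θ * ‖X ω‖ ^ 2 / (2 * s ^ 2)) ∂ν ≤ eexp (θ * Module.finrank ℝ E) := by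
  -- The weight `exp (-b ‖v‖²)` has the constant `b` for which completing the square produces the
  -- required moment, and `b - s² / 2` is the constant left after the moment bound.
  set b : ℝ := s ^ 2 / (2 * θ) with hb_def
  set b' : ℝ := s ^ 2 * (1 - θ) / (2 * θ) with hb'_def
  have hb : 0 < b := by positivity
  have hb' : 0 < b' := by
    have : 0 < 1 - θ := by linarith
    positivity
  set I : ENNReal := ∫⁻ v : E, eexp (-b * ‖v‖ ^ 2) with hI
  have hIv := lintegral_eexp_neg_mul_sq_norm (E := E) hb
  have hI0 : I ≠ 0 := by
    rw [hI, hIv]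
    have : 0 < (Real.pi / b) ^ (Module.finrank ℝ E / 2 : ℝ) := by positivity
    simpa using this
  have hIt : I ≠ ⊤ := by rw [hI, hIv]; exact ENNReal.ofReal_ne_top
  have key : (∫⁻ ω, eexp (θ * ‖X ω‖ ^ 2 / (2 * s ^ 2)) ∂ν) * I
      ≤ eexp (θ * Module.finrank ℝ E) * I := by
    calc (∫⁻ ω, eexp (θ * ‖X ω‖ ^ 2 / (2 * s ^ 2)) ∂ν) * I
        = ∫⁻ ω, eexp (‖X ω‖ ^ 2 / (4 * b)) * I ∂ν := by
          rw [lintegral_mul_const']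
          · congr 1
            refine lintegral_congr fun ω => ?_
            congr 1
            rw [hb_def]
            field_simp
            ring
          · exact hIt
      _ = ∫⁻ ω, (∫⁻ v : E, eexp (-b * ‖v‖ ^ 2 + inner ℝ (X ω) v)) ∂ν := by
          refine lintegral_congr fun ω => ?_
          rw [lintegral_eexp_neg_mul_sq_norm_add_inner hb]
      _ = ∫⁻ v : E, ∫⁻ ω, eexp (-b * ‖v‖ ^ 2 + inner ℝ (X ω) v) ∂ν := by
          refine lintegral_lintegral_swap ?_
          refine Measurable.aemeasurable (measurable_eexp.comp ?_)
          fun_prop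
      _ = ∫⁻ v : E, eexp (-b * ‖v‖ ^ 2) * ∫⁻ ω, eexp (inner ℝ (X ω) v) ∂ν := by
          refine lintegral_congr fun v => ?_
          rw [← lintegral_const_mul' _ _ (eexp_ne_top _)]
          simp_rw [eexp_add]
      _ ≤ ∫⁻ v : E, eexp (-b' * ‖v‖ ^ 2) := by
          refine lintegral_mono fun v => ?_
          refine (mul_le_mul_right (h v) _).trans ?_
          rw [← eexp_add, eexp_le_eexp]
          refine le_of_eq ?_
          rw [hb_def, hb'_def]
          field_simp
          ring
      _ ≤ eexp (θ * Module.finrank ℝ E) * I := by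
          rw [lintegral_eexp_neg_mul_sq_norm hb', hI, hIv, eexp,
            ← ENNReal.ofReal_mul (Real.exp_pos _).le]
          refine ENNReal.ofReal_le_ofReal ?_
          have e1 : Real.exp (θ * Module.finrank ℝ E)
              = (Real.exp (2 * θ)) ^ (Module.finrank ℝ E / 2 : ℝ) := by
            rw [← Real.exp_mul]
            congr 1
            ring
          rw [e1, ← Real.mul_rpow (Real.exp_pos _).le (by positivity)]
          refine Real.rpow_le_rpow (by positivity) ?_ (by positivity)
          have h2 := exp_neg_two_mul_le h0.le h1
          have h3 : Real.exp (2 * θ) * Real.exp (-(2 * θ)) = 1 := by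
            rw [← Real.exp_add]; simp
          have h4 : 1 ≤ Real.exp (2 * θ) * (1 - θ) := by
            refine h3.symm.le.trans ?_
            exact mul_le_mul_of_nonneg_left h2 (Real.exp_pos _).le
          have e2 : Real.pi / b = Real.pi / b' * (1 - θ) := by
            rw [hb_def, hb'_def]
            have : 1 - θ ≠ 0 := by linarith
            field_simp
          rw [e2]
          have h5 : 0 < Real.pi / b' := by positivity
          nlinarith
  exact (ENNReal.mul_le_mul_iff_left hI0 hIt).1 key

end Moments

/-! ### Independent sub-Gaussian vectors on a product space -/

section Product

variable {ι E : Type*} [Fintype ι] [DecidableEq ι] [NormedAddCommGroup E] [InnerProductSpace ℝ E]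
  [FiniteDimensional ℝ E] [MeasurableSpace E] [BorelSpace E]

/-- `F` does not depend on the coordinates in `B`. -/
def OffSet {β : Type*} (B : Finset ι) (F : (ι → E) → β) : Prop :=
  ∀ x y : ι → E, (∀ i, i ∉ B → x i = y i) → F x = F y

/-- A coordinate `i` can be integrated out against a direction and a weight that do not depend on it. -/
lemma lintegral_eexp_coord_le {G : ι → Measure E} [∀ i, IsProbabilityMeasure (G i)] {m : ι → E}
    {σ : ℝ} (hG : ∀ i a, ∫⁻ y, eexp (inner ℝ (y - m i) a) ∂(G i) ≤ eexp (σ ^ 2 * ‖a‖ ^ 2 / 2))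
    (i : ι) {F : (ι → E) → E} (hF : Measurable F) (hFo : OffSet {i} F)
    {H : (ι → E) → ENNReal} (hH : Measurable H) (hHo : OffSet {i} H) :
    ∫⁻ x, eexp (inner ℝ (x i - m i) (F x)) * H x ∂(Measure.pi G)
      ≤ ∫⁻ x, eexp (σ ^ 2 * ‖F x‖ ^ 2 / 2) * H x ∂(Measure.pi G) := by
  refine lintegral_le_of_lmarginal_le {i} ?_ ?_ ?_
  · exact (measurable_eexp.comp (by fun_prop)).mul hH
  · exact (measurable_eexp.comp (by fun_prop)).mul hH
  · rw [lmarginal_singleton, lmarginal_singleton]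
    intro x
    simp only [Function.update_self]
    have e1 : ∀ y, H (Function.update x i y) = H x := fun y => by
      refine hHo _ _ fun j hj => ?_
      rw [Function.update_of_ne (by simpa using hj)]
    have e2 : ∀ y, F (Function.update x i y) = F x := fun y => by
      refine hFo _ _ fun j hj => ?_
      rw [Function.update_of_ne (by simpa using hj)]
    simp only [e1, e2]
    rw [lintegral_mul_const, lintegral_const, measure_univ, mul_one]
    · exact mul_le_mul_left (hG i _) _
    · exact measurable_eexp.comp (by fun_prop)

/-- Decoupling: in the exponential moment of `⟪∑ i ∈ B, (x i - m i), F x⟫`, where `F` depends only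
on the coordinates outside `B`, the coordinates in `B` can be integrated out. -/
lemma lintegral_eexp_sum_le {G : ι → Measure E} [∀ i, IsProbabilityMeasure (G i)] {m : ι → E}
    {σ : ℝ} (hG : ∀ i a, ∫⁻ y, eexp (inner ℝ (y - m i) a) ∂(G i) ≤ eexp (σ ^ 2 * ‖a‖ ^ 2 / 2))
    (B : Finset ι) {F : (ι → E) → E} (hF : Measurable F) (hFo : OffSet B F)
    {H : (ι → E) → ENNReal} (hH : Measurable H) (hHo : OffSet B H) :
    ∫⁻ x, eexp (inner ℝ (∑ i ∈ B, (x i - m i)) (F x)) * H x ∂(Measure.pi G)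
      ≤ ∫⁻ x, eexp (σ ^ 2 * B.card * ‖F x‖ ^ 2 / 2) * H x ∂(Measure.pi G) := by
  induction B using Finset.induction_on generalizing H with
  | empty => simp
  | insert i B hi ih =>
    have hFB : OffSet B F := fun x y h => hFo x y fun j hj => h j fun hjB =>
      hj (Finset.mem_insert_of_mem hjB)
    have hFi : OffSet {i} F := fun x y h => hFo x y fun j hj => h j fun hji =>
      hj (by rw [Finset.mem_singleton] at hji; simp [hji])
    have hHB : OffSet B H := fun x y h => hHo x y fun j hj => h j fun hjB =>
      hj (Finset.mem_insert_of_mem hjB)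
    have hHi : OffSet {i} H := fun x y h => hHo x y fun j hj => h j fun hji =>
      hj (by rw [Finset.mem_singleton] at hji; simp [hji])
    calc ∫⁻ x, eexp (inner ℝ (∑ j ∈ insert i B, (x j - m j)) (F x)) * H x ∂(Measure.pi G)
        = ∫⁻ x, eexp (inner ℝ (∑ j ∈ B, (x j - m j)) (F x)) *
            (eexp (inner ℝ (x i - m i) (F x)) * H x) ∂(Measure.pi G) := by
          refine lintegral_congr fun x => ?_
          rw [Finset.sum_insert hi, inner_add_left, add_comm, eexp_add, mul_assoc]
      _ ≤ ∫⁻ x, eexp (σ ^ 2 * B.card * ‖F x‖ ^ 2 / 2) *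
            (eexp (inner ℝ (x i - m i) (F x)) * H x) ∂(Measure.pi G) := by
          refine ih hFB ((measurable_eexp.comp (by fun_prop)).mul hH) fun x y h => ?_
          rw [hFB x y h, hHB x y h, h i hi]
      _ = ∫⁻ x, eexp (inner ℝ (x i - m i) (F x)) *
            (eexp (σ ^ 2 * B.card * ‖F x‖ ^ 2 / 2) * H x) ∂(Measure.pi G) := by
          refine lintegral_congr fun x => ?_
          ring
      _ ≤ ∫⁻ x, eexp (σ ^ 2 * ‖F x‖ ^ 2 / 2) *
            (eexp (σ ^ 2 * B.card * ‖F x‖ ^ 2 / 2) * H x) ∂(Measure.pi G) := by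
          refine lintegral_eexp_coord_le hG i hF hFi
            ((measurable_eexp.comp (by fun_prop)).mul hH) fun x y h => ?_
          rw [hFi x y h, hHi x y h]
      _ = _ := by
          refine lintegral_congr fun x => ?_
          rw [← mul_assoc, ← eexp_add, Finset.card_insert_of_notMem hi]
          congr 2
          push_cast
          ring

end Product

/-! ### Tail bounds for sums of the noise -/

section Tails

lemma measure_ge_le_eexp {Ω : Type*} [MeasurableSpace Ω] {ν : Measure Ω} {Z : Ω → ℝ}
    (hZ : Measurable Z) {a t : ℝ} (h : ∫⁻ ω, eexp (Z ω) ∂ν ≤ eexp a) :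
    ν {ω | t ≤ Z ω} ≤ eexp (a - t) := by
  have h1 := mul_meas_ge_le_lintegral (μ := ν) (measurable_eexp.comp hZ) (eexp t)
  simp only [Function.comp_apply, eexp_le_eexp] at h1
  have h2 : eexp (a - t) = eexp (-t) * eexp a := by rw [← eexp_add]; congr 1; ring
  have h3 : eexp (-t) * eexp t = 1 := by rw [← eexp_add]; simp [eexp_zero]
  rw [h2]
  calc ν {ω | t ≤ Z ω} = eexp (-t) * (eexp t * ν {ω | t ≤ Z ω}) := by
        rw [← mul_assoc, h3, one_mul]
    _ ≤ eexp (-t) * eexp a := mul_le_mul_right (h1.trans h) _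

variable {ι E : Type*} [Fintype ι] [DecidableEq ι] [NormedAddCommGroup E] [InnerProductSpace ℝ E]
  [FiniteDimensional ℝ E] [MeasurableSpace E] [BorelSpace E]
  {G : ι → Measure E} [∀ i, IsProbabilityMeasure (G i)] {m : ι → E} {σ : ℝ}

lemma lintegral_eexp_inner_sum_le
    (hG : ∀ i a, ∫⁻ y, eexp (inner ℝ (y - m i) a) ∂(G i) ≤ eexp (σ ^ 2 * ‖a‖ ^ 2 / 2))
    (B : Finset ι) (a : E) :
    ∫⁻ x, eexp (inner ℝ (∑ i ∈ B, (x i - m i)) a) ∂(Measure.pi G)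
      ≤ eexp (σ ^ 2 * B.card * ‖a‖ ^ 2 / 2) := by
  have h := lintegral_eexp_sum_le hG B (F := fun _ => a) measurable_const (fun _ _ _ => rfl)
    (H := fun _ => 1) measurable_const (fun _ _ _ => rfl)
  simpa using h

lemma measure_norm_sum_gt_le (hσ : 0 < σ)
    (hG : ∀ i a, ∫⁻ y, eexp (inner ℝ (y - m i) a) ∂(G i) ≤ eexp (σ ^ 2 * ‖a‖ ^ 2 / 2))
    (B : Finset ι) (n : ℕ) :
    Measure.pi G {x | σ * √(3 * (n + Module.finrank ℝ E) * B.card) < ‖∑ i ∈ B, (x i - m i)‖}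
      ≤ eexp (-n) := by
  rcases B.eq_empty_or_nonempty with rfl | hB
  · simp
  have hc : (0 : ℝ) < B.card := by exact_mod_cast hB.card_pos
  set s : ℝ := σ * √B.card with hs_def
  have hs : 0 < s := by positivity
  have hs2 : s ^ 2 = σ ^ 2 * B.card := by rw [hs_def, mul_pow, Real.sq_sqrt hc.le]
  have hX : Measurable fun x : ι → E => ∑ i ∈ B, (x i - m i) := by fun_prop
  have h1 := lintegral_eexp_sq_norm_le (ν := Measure.pi G) hX hs (θ := 2 / 3) (by norm_num) le_rfl
    (fun a => by rw [hs2]; exact lintegral_eexp_inner_sum_le hG B a)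
  have h2 := measure_ge_le_eexp (t := n + Module.finrank ℝ E) (by fun_prop) h1
  refine (measure_mono fun x hx => ?_).trans (h2.trans ?_)
  · simp only [Set.mem_ofPred_eq] at hx ⊢
    rw [le_div_iff₀ (by positivity), hs2]
    have h3 := pow_le_pow_left₀ (by positivity) hx.le 2
    rw [mul_pow, Real.sq_sqrt (by positivity)] at h3
    linarith
  · rw [eexp_le_eexp]
    have : (0 : ℝ) ≤ Module.finrank ℝ E := by positivity
    linarith

/-- A self-normalized tail bound: `Y` only depends on the coordinates outside `B`, so given these
coordinates it is a fixed direction for the sum over `B`. -/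
lemma measure_inner_sum_gt_le (hσ : 0 < σ)
    (hG : ∀ i a, ∫⁻ y, eexp (inner ℝ (y - m i) a) ∂(G i) ≤ eexp (σ ^ 2 * ‖a‖ ^ 2 / 2))
    (B : Finset ι) {Y : (ι → E) → E} (hY : Measurable Y) (hYo : OffSet B Y) {u : ℝ} (hu : 0 ≤ u) :
    Measure.pi G {x | σ * √(2 * u * B.card) * ‖Y x‖ < inner ℝ (∑ i ∈ B, (x i - m i)) (Y x)}
      ≤ eexp (-u) := by
  rcases B.eq_empty_or_nonempty with rfl | hB
  · simp
  have hc : (0 : ℝ) < B.card := by exact_mod_cast hB.card_pos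
  set c : ℝ := √(2 * u) / (σ * √B.card) with hc_def
  have hsc : 0 < √(B.card : ℝ) := Real.sqrt_pos.2 hc
  have hc0 : 0 ≤ c := by positivity
  have hc2 : σ ^ 2 * B.card * c ^ 2 = 2 * u := by
    rw [hc_def, div_pow, mul_pow, Real.sq_sqrt hc.le, Real.sq_sqrt (by positivity)]
    field_simp
  have hF : Measurable fun x => (c / ‖Y x‖) • Y x := by fun_prop
  have h1 := lintegral_eexp_sum_le hG B hF (fun x y h => by simp only [hYo x y h])
    (H := fun _ => 1) measurable_const (fun _ _ _ => rfl)
  simp only [mul_one] at h1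
  have h2 : ∫⁻ x, eexp (inner ℝ (∑ i ∈ B, (x i - m i)) ((c / ‖Y x‖) • Y x)) ∂(Measure.pi G)
      ≤ eexp u := by
    refine h1.trans ?_
    calc _ ≤ ∫⁻ _, eexp u ∂(Measure.pi G) := by
          refine lintegral_mono fun x => ?_
          rw [eexp_le_eexp]
          have h3 : ‖(c / ‖Y x‖) • Y x‖ ≤ c := by
            rw [norm_smul, Real.norm_eq_abs, abs_of_nonneg (by positivity)]
            rcases eq_or_ne (‖Y x‖) 0 with h0 | h0
            · rw [h0]; simpa using hc0
            · rw [div_mul_cancel₀ _ h0]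
          have h4 := pow_le_pow_left₀ (norm_nonneg _) h3 2
          have h5 : σ ^ 2 * B.card * ‖(c / ‖Y x‖) • Y x‖ ^ 2 ≤ σ ^ 2 * B.card * c ^ 2 :=
            mul_le_mul_of_nonneg_left h4 (by positivity)
          linarith
      _ = eexp u := by simp
  have h6 := measure_ge_le_eexp (t := 2 * u) (by fun_prop) h2
  refine (measure_mono fun x hx => ?_).trans (h6.trans ?_)
  · simp only [Set.mem_ofPred_eq] at hx ⊢
    have hYx : 0 < ‖Y x‖ := by
      rw [norm_pos_iff]
      intro h0
      simp [h0] at hx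
    rw [inner_smul_right]
    have h7 : c * (σ * √(2 * u * B.card)) = 2 * u := by
      have h8 : √(2 * u) ^ 2 = 2 * u := Real.sq_sqrt (by positivity)
      rw [hc_def, Real.sqrt_mul (by positivity : (0 : ℝ) ≤ 2 * u)]
      generalize √(2 * u) = v at h8 ⊢
      field_simp
      exact h8
    calc 2 * u = c * (σ * √(2 * u * B.card)) := h7.symm
      _ = c / ‖Y x‖ * (σ * √(2 * u * B.card) * ‖Y x‖) := by
          generalize √(2 * u * B.card) = v
          field_simp
      _ ≤ _ := mul_le_mul_of_nonneg_left hx.le (by positivity)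
  · rw [eexp_le_eexp]
    linarith

lemma measure_norm_ge_le (hσ : 0 < σ)
    (hG : ∀ i a, ∫⁻ y, eexp (inner ℝ (y - m i) a) ∂(G i) ≤ eexp (σ ^ 2 * ‖a‖ ^ 2 / 2))
    (i : ι) {u : ℝ} (hu : 0 ≤ u) :
    Measure.pi G {x | u ≤ ‖x i - m i‖}
      ≤ eexp (2 / 3 * Module.finrank ℝ E - u ^ 2 / (3 * σ ^ 2)) := by
  have hX : Measurable fun x : ι → E => x i - m i := by fun_prop
  have h1 := lintegral_eexp_sq_norm_le (ν := Measure.pi G) hX hσ (θ := 2 / 3) (by norm_num) le_rfl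
    (fun a => by simpa using lintegral_eexp_inner_sum_le hG {i} a)
  refine (measure_mono fun x hx => ?_).trans
    (measure_ge_le_eexp (t := u ^ 2 / (3 * σ ^ 2)) (by fun_prop) h1)
  simp only [Set.mem_ofPred_eq] at hx ⊢
  have h3 := pow_le_pow_left₀ hu hx 2
  rw [div_le_div_iff₀ (by positivity) (by positivity)]
  have : (0 : ℝ) < σ ^ 2 := by positivity
  nlinarith

/-- The probability that the noise of a single point is aligned with `D + V`, where `V` is a small
sub-Gaussian perturbation which does not depend on this point. The exponential moment is taken at
`0.4 / σ²`; the perturbation enters it only through its square norm. -/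
lemma measure_inner_add_ge_le (hσ : 0 < σ)
    (hG : ∀ i a, ∫⁻ y, eexp (inner ℝ (y - m i) a) ∂(G i) ≤ eexp (σ ^ 2 * ‖a‖ ^ 2 / 2))
    (i : ι) {V : (ι → E) → E} (hV : Measurable V) (hVo : OffSet {i} V) {s : ℝ} (hs : 0 < s)
    (hVs : ∀ a, ∫⁻ x, eexp (inner ℝ (V x) a) ∂(Measure.pi G) ≤ eexp (s ^ 2 * ‖a‖ ^ 2 / 2))
    (hsσ : 6 * s ^ 2 ≤ 5 * σ ^ 2) (D : E) :
    Measure.pi G {x | 0.45 * ‖D‖ ^ 2 ≤ inner ℝ (x i - m i) (D + V x)}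
      ≤ eexp (0.8 * s ^ 2 / σ ^ 2 * Module.finrank ℝ E - 0.08 * (‖D‖ ^ 2 / σ ^ 2)) := by
  set t : ℝ := 0.4 / σ ^ 2 with ht_def
  have ht : 0 < t := by positivity
  set θ : ℝ := 0.8 * s ^ 2 / σ ^ 2 with hθ_def
  have hθ : 0 < θ := by positivity
  have hθ1 : θ ≤ 2 / 3 := by
    rw [hθ_def, div_le_div_iff₀ (by positivity) (by norm_num)]
    linarith
  -- The exponent is at most `(t²σ²/2) ‖D + V‖² ≤ 0.1 ‖D‖²/σ² + θ ‖V‖²/(2s²)`, and the threshold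
  -- contributes `-0.45 t ‖D‖² = -0.18 ‖D‖²/σ²`.
  have hF : Measurable fun x => t • (D + V x) := by fun_prop
  have h1 := lintegral_eexp_coord_le hG i hF (fun x y h => by simp only [hVo x y h])
    (H := fun _ => 1) measurable_const (fun _ _ _ => rfl)
  simp only [mul_one] at h1
  have h2 : ∫⁻ x, eexp (inner ℝ (x i - m i) (t • (D + V x))) ∂(Measure.pi G)
      ≤ eexp (0.1 * (‖D‖ ^ 2 / σ ^ 2) + θ * Module.finrank ℝ E) := by
    refine h1.trans ?_
    calc _ ≤ ∫⁻ x, eexp (0.1 * (‖D‖ ^ 2 / σ ^ 2)) * eexp (θ * ‖V x‖ ^ 2 / (2 * s ^ 2))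
            ∂(Measure.pi G) := by
          refine lintegral_mono fun x => ?_
          rw [← eexp_add, eexp_le_eexp, norm_smul, Real.norm_eq_abs, abs_of_pos ht, mul_pow]
          have h3 : ‖D + V x‖ ^ 2 ≤ 5 / 4 * ‖D‖ ^ 2 + 5 * ‖V x‖ ^ 2 := by
            have h4 := norm_add_le D (V x)
            have h5 := pow_le_pow_left₀ (norm_nonneg _) h4 2
            nlinarith [sq_nonneg (‖D‖ - 4 * ‖V x‖)]
          have e1 : 0.1 * (‖D‖ ^ 2 / σ ^ 2) + θ * ‖V x‖ ^ 2 / (2 * s ^ 2)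
              = σ ^ 2 * t ^ 2 / 2 * (5 / 4 * ‖D‖ ^ 2 + 5 * ‖V x‖ ^ 2) := by
            rw [hθ_def, ht_def]
            field_simp
            ring
          rw [e1]
          calc σ ^ 2 * (t ^ 2 * ‖D + V x‖ ^ 2) / 2 = σ ^ 2 * t ^ 2 / 2 * ‖D + V x‖ ^ 2 := by ring
            _ ≤ _ := mul_le_mul_of_nonneg_left h3 (by positivity)
      _ = eexp (0.1 * (‖D‖ ^ 2 / σ ^ 2)) * ∫⁻ x, eexp (θ * ‖V x‖ ^ 2 / (2 * s ^ 2))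
            ∂(Measure.pi G) := by
          rw [lintegral_const_mul' _ _ (eexp_ne_top _)]
      _ ≤ _ := by
          rw [eexp_add]
          exact mul_le_mul_right (lintegral_eexp_sq_norm_le hV hs hθ hθ1 hVs) _
  refine (measure_mono fun x hx => ?_).trans
    ((measure_ge_le_eexp (t := t * (0.45 * ‖D‖ ^ 2)) (by fun_prop) h2).trans ?_)
  · simp only [Set.mem_ofPred_eq] at hx ⊢
    rw [inner_smul_right]
    exact mul_le_mul_of_nonneg_left hx ht.le
  · rw [eexp_le_eexp, ht_def]
    refine le_of_eq ?_
    field_simp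
    ring

/-- The difference of the noise averages over two disjoint sets of size at least `N`. -/
lemma lintegral_eexp_inner_sub_le {N : ℝ} (hN : 0 < N)
    (hG : ∀ i a, ∫⁻ y, eexp (inner ℝ (y - m i) a) ∂(G i) ≤ eexp (σ ^ 2 * ‖a‖ ^ 2 / 2))
    {A B : Finset ι} (hAB : Disjoint A B) {p q : ℝ} (hp : N ≤ p) (hq : N ≤ q)
    (hA : (A.card : ℝ) ≤ p) (hB : (B.card : ℝ) ≤ q) (a : E) :
    ∫⁻ x, eexp (inner ℝ (p⁻¹ • ∑ i ∈ A, (x i - m i) - q⁻¹ • ∑ i ∈ B, (x i - m i)) a)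
        ∂(Measure.pi G) ≤ eexp (2 * σ ^ 2 / N * ‖a‖ ^ 2 / 2) := by
  have hp0 : 0 < p := hN.trans_le hp
  have hq0 : 0 < q := hN.trans_le hq
  have h1 := lintegral_eexp_sum_le hG A (F := fun _ => p⁻¹ • a) measurable_const
    (fun _ _ _ => rfl) (H := fun x => eexp (inner ℝ (∑ i ∈ B, (x i - m i)) (-(q⁻¹ • a))))
    (measurable_eexp.comp (by fun_prop)) (fun x y h => by
      have : ∑ i ∈ B, (x i - m i) = ∑ i ∈ B, (y i - m i) :=
        Finset.sum_congr rfl fun i hi => by rw [h i fun hiA => Finset.disjoint_left.1 hAB hiA hi]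
      simp only [this])
  have h2 := lintegral_eexp_inner_sum_le hG B (-(q⁻¹ • a))
  have aux : ∀ {c k : ℝ}, N ≤ k → c ≤ k → 0 ≤ c → c * (k⁻¹) ^ 2 ≤ 1 / N := by
    intro c k hNk hck _
    have hk : 0 < k := hN.trans_le hNk
    calc c * (k⁻¹) ^ 2 ≤ k * (k⁻¹) ^ 2 := by gcongr
      _ = 1 / k := by field_simp
      _ ≤ 1 / N := one_div_le_one_div_of_le hN hNk
  calc _ = ∫⁻ x, eexp (inner ℝ (∑ i ∈ A, (x i - m i)) (p⁻¹ • a)) *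
        eexp (inner ℝ (∑ i ∈ B, (x i - m i)) (-(q⁻¹ • a))) ∂(Measure.pi G) := by
        refine lintegral_congr fun x => ?_
        rw [← eexp_add]
        congr 1
        rw [inner_sub_left, inner_smul_left, inner_smul_left, inner_neg_right, inner_smul_right,
          inner_smul_right]
        simp [sub_eq_add_neg]
    _ ≤ _ := h1
    _ ≤ eexp (σ ^ 2 * A.card * ‖p⁻¹ • a‖ ^ 2 / 2) * eexp (σ ^ 2 * B.card * ‖-(q⁻¹ • a)‖ ^ 2 / 2) := by
        rw [lintegral_const_mul' _ _ (eexp_ne_top _)]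
        exact mul_le_mul_right h2 _
    _ ≤ _ := by
        rw [← eexp_add, eexp_le_eexp, norm_neg, norm_smul, norm_smul, Real.norm_eq_abs,
          Real.norm_eq_abs, abs_of_pos (inv_pos.2 hp0), abs_of_pos (inv_pos.2 hq0)]
        have e1 := aux hp hA (by positivity)
        have e2 := aux hq hB (by positivity)
        have e3 : 0 ≤ σ ^ 2 * ‖a‖ ^ 2 / 2 := by positivity
        have e4 := mul_le_mul_of_nonneg_left (add_le_add e1 e2) e3
        have e5 : σ ^ 2 * ‖a‖ ^ 2 / 2 * (1 / N + 1 / N) = 2 * σ ^ 2 / N * ‖a‖ ^ 2 / 2 := by ring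
        rw [e5] at e4
        refine le_trans (le_of_eq ?_) e4
        ring

end Tails

/-! ### Consequences of the signal-to-noise conditions -/

/-- The signal-to-noise conditions in polynomial form, with numerical constants. -/
structure Regime (d K r : ℕ) (σ ε Δ α : ℝ) : Prop where
  two_le : 2 ≤ K
  card_le : K ≤ d
  sigma_pos : 0 < σ
  eps_pos : 0 < ε
  dist_pos : 0 < Δ
  prop_pos : 0 < α
  prop_le : K * α ≤ 1
  log_le : 10 * K * Real.log d ≤ d * α
  noise_le : 10 ^ 12 * K * σ ^ 2 * (d + K * r) ≤ α * d * Δ ^ 2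
  error_le : 10 ^ 12 * K * ε ^ 2 ≤ α * Δ ^ 2
  rank_le : r ≤ Δ ^ 2 / (ε * σ)

namespace Regime

variable {d K r : ℕ} {σ ε Δ α : ℝ} (H : Regime d K r σ ε Δ α)

include H

lemma two_le_d : 2 ≤ d := H.two_le.trans H.card_le

lemma d_pos : (0 : ℝ) < d := by
  have := H.two_le_d
  exact_mod_cast (by omega : 0 < d)

lemma two_le_K : (2 : ℝ) ≤ K := by exact_mod_cast H.two_le

lemma mul_sigma_le : 10 ^ 6 * K * σ ≤ Δ := by
  have hK := H.two_le_K
  have hd := H.d_pos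
  have h1 := H.noise_le
  have h2 : 10 ^ 12 * K * σ ^ 2 * d ≤ α * d * Δ ^ 2 := by
    refine le_trans ?_ h1
    have := H.sigma_pos
    gcongr
    have : (0 : ℝ) ≤ K * r := by positivity
    linarith
  have h3 : 10 ^ 12 * K * σ ^ 2 ≤ α * Δ ^ 2 := by
    have : 10 ^ 12 * K * σ ^ 2 * d ≤ (α * Δ ^ 2) * d := by linarith
    exact le_of_mul_le_mul_right this hd
  have h4 : (10 ^ 6 * K * σ) ^ 2 ≤ Δ ^ 2 := by
    calc (10 ^ 6 * K * σ) ^ 2 = K * (10 ^ 12 * K * σ ^ 2) := by ring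
      _ ≤ K * (α * Δ ^ 2) := by gcongr
      _ = (K * α) * Δ ^ 2 := by ring
      _ ≤ 1 * Δ ^ 2 := by gcongr; exact H.prop_le
      _ = Δ ^ 2 := one_mul _
  exact (pow_le_pow_iff_left₀ (by have := H.sigma_pos; positivity) H.dist_pos.le
    two_ne_zero).1 h4

lemma mul_eps_le : 10 ^ 6 * K * ε ≤ Δ := by
  have hK := H.two_le_K
  have h4 : (10 ^ 6 * K * ε) ^ 2 ≤ Δ ^ 2 := by
    calc (10 ^ 6 * K * ε) ^ 2 = K * (10 ^ 12 * K * ε ^ 2) := by ring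
      _ ≤ K * (α * Δ ^ 2) := mul_le_mul_of_nonneg_left H.error_le (by linarith)
      _ = (K * α) * Δ ^ 2 := by ring
      _ ≤ 1 * Δ ^ 2 := by gcongr; exact H.prop_le
      _ = Δ ^ 2 := one_mul _
  exact (pow_le_pow_iff_left₀ (by have := H.eps_pos; positivity) H.dist_pos.le
    two_ne_zero).1 h4

lemma thirteen_le : 13 ≤ α * d := by
  have h1 := H.log_le
  have hK := H.two_le_K
  have hd : (2 : ℝ) ≤ d := by exact_mod_cast H.two_le_d
  have h2 := Real.log_le_log (by norm_num) hd
  have h3 := Real.log_two_gt_d9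
  nlinarith

lemma rank_mul_le : 10 ^ 12 * K ^ 2 * σ ^ 2 * r ≤ α * d * Δ ^ 2 := by
  refine le_trans ?_ H.noise_le
  have : (0 : ℝ) ≤ 10 ^ 12 * K * σ ^ 2 * d := by positivity
  nlinarith

lemma le_dist_sq_div : 10 ^ 12 * (K : ℝ) ^ 2 ≤ Δ ^ 2 / (ε * σ) := by
  have h1 := H.mul_sigma_le
  have h2 := H.mul_eps_le
  have hs := H.sigma_pos
  have he := H.eps_pos
  rw [le_div_iff₀ (by positivity)]
  have h3 : (10 ^ 6 * K * ε) * (10 ^ 6 * K * σ) ≤ Δ * Δ :=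
    mul_le_mul h2 h1 (by positivity) H.dist_pos.le
  nlinarith

end Regime

/-! ### The event on which the noise is well behaved -/

section GoodNoise

variable {d K r : ℕ}

/-- The indices with label `k`. -/
def cls (z : Fin d → Fin K) (k : Fin K) : Finset (Fin d) := Finset.univ.filter fun i => z i = k

lemma card_cls (z : Fin d → Fin K) (k : Fin K) : (cls z k).card = size z k := rfl

lemma mem_cls {z : Fin d → Fin K} {k : Fin K} {i : Fin d} : i ∈ cls z k ↔ z i = k := by
  simp [cls]

/-- The mean of the points `c (ζ i) + w i` over `S`, with the noise `w i` of the points in `B`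
left out. -/
noncomputable def meanOff (ζ : Fin d → Fin K) (c : Fin K → EuclideanSpace ℝ (Fin r))
    (w : Fin d → EuclideanSpace ℝ (Fin r)) (B S : Finset (Fin d)) : EuclideanSpace ℝ (Fin r) :=
  ((S.card : ℝ)⁻¹) • (∑ i ∈ S, c (ζ i) + ∑ i ∈ S \ B, w i)

/-- The difference of the noise averages over the cluster `h` and over the cluster of `i`, the
noise of `i` itself being left out. -/
noncomputable def noiseGap (ζ : Fin d → Fin K) (w : Fin d → EuclideanSpace ℝ (Fin r))
    (i : Fin d) (h : Fin K) : EuclideanSpace ℝ (Fin r) :=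
  ((size ζ h : ℝ)⁻¹) • ∑ j ∈ cls ζ h, w j
    - ((size ζ (ζ i) : ℝ)⁻¹) • ∑ j ∈ (cls ζ (ζ i)).erase i, w j

/-- The properties of the noise `w` that make every run of Lloyd's algorithm succeed. All of them
are invariant under rotations. The first three control data-dependent sums. The last two bound the
weighted number of pairs `(i, h)` for which the noise of the `i`-th point alone is so large that it
may be moved to the cluster `h`. -/
structure GoodNoise (ζ : Fin d → Fin K) (c : Fin K → EuclideanSpace ℝ (Fin r)) (σ ε : ℝ)
    (w : Fin d → EuclideanSpace ℝ (Fin r)) : Prop where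
  norm_sum_le : ∀ S : Finset (Fin d), ‖∑ i ∈ S, w i‖ ≤ σ * √(3 * (d + r) * S.card)
  norm_sum_cls_le : ∀ g, ∀ S ⊆ cls ζ g, ‖∑ i ∈ S, w i‖ ≤ σ * √(3 * (size ζ g + r) * S.card)
  inner_le : ∀ B S₁ S₂ : Finset (Fin d),
    inner ℝ (∑ i ∈ B, w i) (meanOff ζ c w B S₁ - meanOff ζ c w B S₂)
      ≤ σ * √(8 * d * B.card) * ‖meanOff ζ c w B S₁ - meanOff ζ c w B S₂‖
  aligned_le : ∑ i, ∑ h, (if 0.45 * ‖c h - c (ζ i)‖ ^ 2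
      ≤ inner ℝ (w i) ((c h - c (ζ i)) + noiseGap ζ w i h)
      then ‖c h - c (ζ i)‖ / minDist c else 0)
    ≤ d / 8 * Real.exp (-(minDist c ^ 2 / (16 * σ ^ 2)))
  large_le : ∑ i, ∑ h, (if 0.005 * ‖c h - c (ζ i)‖ ^ 2 ≤ ε * ‖w i‖
      then ‖c h - c (ζ i)‖ / minDist c else 0)
    ≤ d / 8 * Real.exp (-(minDist c ^ 2 / (8 * ε * σ)))

lemma minDist_map (U : EuclideanSpace ℝ (Fin r) ≃ₗᵢ[ℝ] EuclideanSpace ℝ (Fin r))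
    (c : Fin K → EuclideanSpace ℝ (Fin r)) : minDist (fun k => U (c k)) = minDist c := by
  unfold minDist
  simp only [← map_sub, LinearIsometryEquiv.norm_map]

lemma GoodNoise.map {ζ : Fin d → Fin K} {c : Fin K → EuclideanSpace ℝ (Fin r)} {σ ε : ℝ}
    {w : Fin d → EuclideanSpace ℝ (Fin r)} (h : GoodNoise ζ c σ ε w)
    (U : EuclideanSpace ℝ (Fin r) ≃ₗᵢ[ℝ] EuclideanSpace ℝ (Fin r)) :
    GoodNoise ζ (fun k => U (c k)) σ ε (fun i => U (w i)) := by
  have e1 : ∀ B S, meanOff ζ (fun k => U (c k)) (fun i => U (w i)) B S = U (meanOff ζ c w B S) := by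
    intro B S
    simp [meanOff, map_sum]
  have e2 : ∀ i h, noiseGap ζ (fun i => U (w i)) i h = U (noiseGap ζ w i h) := by
    intro i h
    simp [noiseGap, map_sum]
  constructor
  · intro S
    rw [← map_sum, LinearIsometryEquiv.norm_map]
    exact h.norm_sum_le S
  · intro g S hS
    rw [← map_sum, LinearIsometryEquiv.norm_map]
    exact h.norm_sum_cls_le g S hS
  · intro B S₁ S₂
    rw [e1, e1, ← map_sum, ← map_sub, LinearIsometryEquiv.norm_map,
      LinearIsometryEquiv.inner_map_map]
    exact h.inner_le B S₁ S₂
  · simp only [minDist_map, e2, ← map_sub, ← map_add, LinearIsometryEquiv.norm_map,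
      LinearIsometryEquiv.inner_map_map]
    exact h.aligned_le
  · simp only [minDist_map, ← map_sub, LinearIsometryEquiv.norm_map]
    exact h.large_le

end GoodNoise

/-! ### The probability of the good event -/

section Probability

/-- Markov's inequality for a weighted count of events. -/
lemma measure_sum_ite_gt_le {Ω J : Type*} [Fintype J] [MeasurableSpace Ω] {ν : Measure Ω}
    {a : J → ℝ} (ha : ∀ j, 0 ≤ a j) {p : J → Ω → Prop} [∀ j x, Decidable (p j x)]
    (hp : ∀ j, MeasurableSet {x | p j x}) {q T : ℝ} (hT : 0 < T)
    (h : ∀ j, ENNReal.ofReal (a j) * ν {x | p j x} ≤ ENNReal.ofReal q) :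
    ν {x | ¬ (∑ j, if p j x then a j else 0) ≤ T}
      ≤ ENNReal.ofReal (Fintype.card J * q / T) := by
  set f : Ω → ENNReal := fun x => ∑ j, {x | p j x}.indicator (fun _ => ENNReal.ofReal (a j)) x
    with hf
  have hfm : Measurable f :=
    Finset.measurable_sum _ fun j _ => measurable_const.indicator (hp j)
  have hfe : ∀ x, f x = ENNReal.ofReal (∑ j, if p j x then a j else 0) := by
    intro x
    rw [ENNReal.ofReal_sum_of_nonneg fun j _ => by split_ifs <;> simp [ha]]
    refine Finset.sum_congr rfl fun j _ => ?_
    by_cases hj : p j x <;> simp [hj]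
  have h1 : ∫⁻ x, f x ∂ν ≤ Fintype.card J * ENNReal.ofReal q := by
    rw [hf, lintegral_finsetSum _ fun j _ => measurable_const.indicator (hp j)]
    calc _ ≤ ∑ _j : J, ENNReal.ofReal q := Finset.sum_le_sum fun j _ => by
          rw [lintegral_indicator_const (hp j)]
          exact h j
      _ = _ := by simp
  have hT' : ENNReal.ofReal T ≠ 0 := by simpa using hT
  calc _ ≤ ν {x | ENNReal.ofReal T ≤ f x} := by
        refine measure_mono fun x hx => ?_
        simp only [Set.mem_ofPred_eq, not_le] at hx ⊢
        rw [hfe]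
        exact ENNReal.ofReal_le_ofReal hx.le
    _ ≤ (∫⁻ x, f x ∂ν) / ENNReal.ofReal T :=
        meas_ge_le_lintegral_div hfm.aemeasurable hT' ENNReal.ofReal_ne_top
    _ ≤ (Fintype.card J * ENNReal.ofReal q) / ENNReal.ofReal T := by gcongr
    _ = _ := by
        rw [ENNReal.ofReal_div_of_pos hT, ENNReal.ofReal_mul (by positivity)]
        simp

lemma natCast_pow_mul_eexp_le {b : ℕ} {x y : ℝ} (hb : (b : ℝ) ≤ Real.exp x) (hxy : x + 0.3 ≤ y)
    (n : ℕ) : ((b ^ n : ℕ) : ENNReal) * eexp (-(y * n)) ≤ eexp (-(0.3 * n)) := by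
  have h1 : ((b ^ n : ℕ) : ENNReal) ≤ eexp (x * n) := by
    rw [eexp, ← ENNReal.ofReal_natCast]
    refine ENNReal.ofReal_le_ofReal ?_
    rw [mul_comm, Real.exp_nat_mul]
    push_cast
    gcongr
  calc _ ≤ eexp (x * n) * eexp (-(y * n)) := mul_le_mul_left h1 _
    _ ≤ _ := by
      rw [← eexp_add, eexp_le_eexp]
      have : (0 : ℝ) ≤ n := by positivity
      nlinarith

lemma two_le_exp : ((2 : ℕ) : ℝ) ≤ Real.exp 0.7 := by
  have := Real.log_two_lt_d9
  rw [← Real.log_le_iff_le_exp (by norm_num)]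
  push_cast
  linarith

lemma eight_le_exp : ((8 : ℕ) : ℝ) ≤ Real.exp 2.1 := by
  have e : Real.exp 2.1 = Real.exp 0.7 ^ 3 := by
    rw [← Real.exp_nat_mul]
    norm_num
  rw [e]
  have := pow_le_pow_left₀ (by norm_num) two_le_exp 3
  norm_num at this ⊢
  exact this

lemma mul_exp_neg_sq_le {u k : ℝ} (hu : 1 ≤ u) (hk : 1 ≤ k) :
    u * Real.exp (-(k * u ^ 2)) ≤ Real.exp (-k) := by
  have h1 := Real.add_one_le_exp (u - 1)
  have h2 : u ≤ Real.exp (u - 1) := by linarith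
  calc _ ≤ Real.exp (u - 1) * Real.exp (-(k * u ^ 2)) := by gcongr
    _ ≤ _ := by
      rw [← Real.exp_add, Real.exp_le_exp]
      nlinarith [mul_nonneg (sub_nonneg.2 hk) (by nlinarith : 0 ≤ u ^ 2 - 1)]

variable {d K r : ℕ}

lemma minDist_le (c : Fin K → EuclideanSpace ℝ (Fin r)) {g h : Fin K} (hgh : g ≠ h) :
    minDist c ≤ ‖c g - c h‖ :=
  ciInf_le (Set.finite_range _).bddBelow (⟨(g, h), hgh⟩ : {q : Fin K × Fin K // q.1 ≠ q.2})

lemma minProp_le (z : Fin d → Fin K) (k : Fin K) : minProp z ≤ (size z k : ℝ) / d :=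
  ciInf_le (Set.finite_range fun k : Fin K => (size z k : ℝ) / d).bddBelow k

lemma size_le (ζ : Fin d → Fin K) (k : Fin K) : size ζ k ≤ d := by
  have := Finset.card_filter_le (Finset.univ : Finset (Fin d)) (fun i => ζ i = k)
  simpa [size] using this

lemma offSet_meanOff (ζ : Fin d → Fin K) (c : Fin K → EuclideanSpace ℝ (Fin r))
    (B S : Finset (Fin d)) :
    OffSet B fun x : Fin d → EuclideanSpace ℝ (Fin r) =>
      meanOff ζ c (fun i => x i - c (ζ i)) B S := by
  intro x y h
  have : ∑ i ∈ S \ B, (x i - c (ζ i)) = ∑ i ∈ S \ B, (y i - c (ζ i)) :=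
    Finset.sum_congr rfl fun i hi => by rw [h i (Finset.mem_sdiff.1 hi).2]
  simp only [meanOff, this]

variable {σ ε : ℝ} {ζ : Fin d → Fin K} {c : Fin K → EuclideanSpace ℝ (Fin r)}
  (H : Regime d K r σ ε (minDist c) (minProp ζ))
  {G : Fin K → Measure (EuclideanSpace ℝ (Fin r))} [∀ k, IsProbabilityMeasure (G k)]
  (hG : ∀ k a, ∫⁻ y, eexp (inner ℝ (y - c k) a) ∂(G k) ≤ eexp (σ ^ 2 * ‖a‖ ^ 2 / 2))

include H

lemma Regime.mul_d_le_size (k : Fin K) : minProp ζ * d ≤ size ζ k :=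
  (le_div_iff₀ H.d_pos).1 (minProp_le ζ k)

lemma Regime.thirteen_le_size (k : Fin K) : (13 : ℝ) ≤ size ζ k :=
  H.thirteen_le.trans (H.mul_d_le_size k)

lemma Regime.six_log_le (k : Fin K) : 6 * Real.log d ≤ 0.3 * size ζ k := by
  have h1 := H.mul_d_le_size k
  have h2 := H.log_le
  have h3 := H.two_le_K
  have h4 : 0 ≤ Real.log d := Real.log_natCast_nonneg d
  nlinarith

include hG

lemma measure_not_norm_sum_le :
    Measure.pi (fun i => G (ζ i)) {x | ¬ ∀ S : Finset (Fin d),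
      ‖∑ i ∈ S, (x i - c (ζ i))‖ ≤ σ * √(3 * (d + r) * S.card)} ≤ eexp (-(0.3 * d)) := by
  calc _ ≤ Measure.pi (fun i => G (ζ i)) (⋃ S : Finset (Fin d),
        {x | σ * √(3 * (d + r) * S.card) < ‖∑ i ∈ S, (x i - c (ζ i))‖}) := by
        refine measure_mono fun x hx => ?_
        simpa using hx
    _ ≤ ∑ S : Finset (Fin d), eexp (-d) := by
        refine (measure_iUnion_fintype_le _ _).trans (Finset.sum_le_sum fun S _ => ?_)
        have := measure_norm_sum_gt_le (m := fun i => c (ζ i)) H.sigma_pos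
          (fun i a => hG (ζ i) a) S d
        simpa using this
    _ ≤ _ := by
        have := natCast_pow_mul_eexp_le two_le_exp (y := 1) (by norm_num) d
        simpa using this

lemma measure_not_norm_sum_cls_le :
    Measure.pi (fun i => G (ζ i)) {x | ¬ ∀ g, ∀ S ⊆ cls ζ g,
      ‖∑ i ∈ S, (x i - c (ζ i))‖ ≤ σ * √(3 * (size ζ g + r) * S.card)}
      ≤ K * eexp (-(6 * Real.log d)) := by
  calc _ ≤ Measure.pi (fun i => G (ζ i)) (⋃ g : Fin K, ⋃ S ∈ (cls ζ g).powerset,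
        {x | σ * √(3 * (size ζ g + r) * S.card) < ‖∑ i ∈ S, (x i - c (ζ i))‖}) := by
        refine measure_mono fun x hx => ?_
        simpa using hx
    _ ≤ ∑ g : Fin K, eexp (-(6 * Real.log d)) := by
        refine (measure_iUnion_fintype_le _ _).trans (Finset.sum_le_sum fun g _ => ?_)
        calc _ ≤ ∑ S ∈ (cls ζ g).powerset, eexp (-(size ζ g)) := by
              refine (measure_biUnion_finset_le _ _).trans (Finset.sum_le_sum fun S _ => ?_)
              have := measure_norm_sum_gt_le (m := fun i => c (ζ i)) H.sigma_pos
                (fun i a => hG (ζ i) a) S (size ζ g)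
              simpa using this
          _ ≤ eexp (-(0.3 * size ζ g)) := by
              have := natCast_pow_mul_eexp_le two_le_exp (y := 1) (by norm_num) (size ζ g)
              simpa [card_cls] using this
          _ ≤ _ := by
              rw [eexp_le_eexp]
              have := H.six_log_le g
              linarith
    _ = _ := by simp

/-- The union bound runs over all `8 ^ d` triples of sets, which `exp (-4 d)` absorbs. This makes
the bound apply to sets of points that depend on the data. -/
lemma measure_not_inner_le :
    Measure.pi (fun i => G (ζ i)) {x | ¬ ∀ B S₁ S₂ : Finset (Fin d),
      inner ℝ (∑ i ∈ B, (x i - c (ζ i)))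
        (meanOff ζ c (fun i => x i - c (ζ i)) B S₁ - meanOff ζ c (fun i => x i - c (ζ i)) B S₂)
      ≤ σ * √(8 * d * B.card) * ‖meanOff ζ c (fun i => x i - c (ζ i)) B S₁
          - meanOff ζ c (fun i => x i - c (ζ i)) B S₂‖} ≤ eexp (-(0.3 * d)) := by
  set Y : (Finset (Fin d) × Finset (Fin d) × Finset (Fin d)) →
      (Fin d → EuclideanSpace ℝ (Fin r)) → EuclideanSpace ℝ (Fin r) := fun q x =>
    meanOff ζ c (fun i => x i - c (ζ i)) q.1 q.2.1 - meanOff ζ c (fun i => x i - c (ζ i)) q.1 q.2.2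
    with hY
  calc _ ≤ Measure.pi (fun i => G (ζ i))
        (⋃ q : Finset (Fin d) × Finset (Fin d) × Finset (Fin d),
        {x | σ * √(2 * (4 * d) * q.1.card) * ‖Y q x‖
          < inner ℝ (∑ i ∈ q.1, (x i - c (ζ i))) (Y q x)}) := by
        refine measure_mono fun x hx => ?_
        simp only [Set.mem_ofPred_eq, not_forall, not_le] at hx
        obtain ⟨B, S₁, S₂, h⟩ := hx
        refine Set.mem_iUnion.2 ⟨(B, S₁, S₂), ?_⟩
        have e : (2 : ℝ) * (4 * d) = 8 * d := by ring
        simpa only [Set.mem_ofPred_eq, hY, e] using h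
    _ ≤ ∑ q : Finset (Fin d) × Finset (Fin d) × Finset (Fin d), eexp (-(4 * d)) := by
        refine (measure_iUnion_fintype_le _ _).trans (Finset.sum_le_sum fun q _ => ?_)
        refine measure_inner_sum_gt_le (m := fun i => c (ζ i)) H.sigma_pos
          (fun i a => hG (ζ i) a) q.1 (Y := Y q) ?_ ?_ (by positivity)
        · simp only [hY, meanOff]
          fun_prop
        · intro x y h
          have e1 := offSet_meanOff ζ c q.1 q.2.1 x y h
          have e2 := offSet_meanOff ζ c q.1 q.2.2 x y h
          simp only at e1 e2
          simp only [hY, e1, e2]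
    _ ≤ _ := by
        have := natCast_pow_mul_eexp_le eight_le_exp (y := 4) (by norm_num) d
        refine le_trans (le_of_eq ?_) this
        rw [Finset.sum_const, nsmul_eq_mul]
        congr 2
        simp only [Finset.card_univ, Fintype.card_prod, Fintype.card_finset, Fintype.card_fin]
        rw [← mul_pow, ← mul_pow]
        norm_num

lemma measure_not_aligned_le :
    Measure.pi (fun i => G (ζ i)) {x | ¬ ∑ i, ∑ h, (if 0.45 * ‖c h - c (ζ i)‖ ^ 2
      ≤ inner ℝ (x i - c (ζ i)) ((c h - c (ζ i)) + noiseGap ζ (fun i => x i - c (ζ i)) i h)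
      then ‖c h - c (ζ i)‖ / minDist c else 0)
    ≤ d / 8 * Real.exp (-(minDist c ^ 2 / (16 * σ ^ 2)))}
      ≤ ENNReal.ofReal (Real.exp (-(minDist c / σ))) := by
  have hσ := H.sigma_pos
  have hΔ := H.dist_pos
  have hd := H.d_pos
  have hα := H.prop_pos
  have hu : 10 ^ 6 * K ≤ minDist c / σ := by
    rw [le_div_iff₀ hσ]
    exact H.mul_sigma_le
  have hK := H.two_le_K
  set Δ := minDist c with hΔ_def
  set α := minProp ζ with hα_def
  have hN : 0 < α * d := by positivity
  have hp : ∀ (j : Fin d × Fin K), Measurable fun x : Fin d → EuclideanSpace ℝ (Fin r) =>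
      noiseGap ζ (fun i => x i - c (ζ i)) j.1 j.2 := by
    intro j
    unfold noiseGap
    fun_prop
  have h := measure_sum_ite_gt_le (ν := Measure.pi (fun i => G (ζ i))) (J := Fin d × Fin K)
    (a := fun j => ‖c j.2 - c (ζ j.1)‖ / Δ) (fun j => by positivity)
    (p := fun j x => 0.45 * ‖c j.2 - c (ζ j.1)‖ ^ 2 ≤ inner ℝ (x j.1 - c (ζ j.1))
      ((c j.2 - c (ζ j.1)) + noiseGap ζ (fun i => x i - c (ζ i)) j.1 j.2))
    (fun j => measurableSet_le measurable_const
      (by have := hp j; fun_prop))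
    -- the tail exponent `0.08` less what the dimension costs; its excess over `1 / 16` pays for the
    -- number of clusters and for Markov's inequality
    (q := Real.exp (-(0.079 * (Δ / σ) ^ 2)))
    (T := d / 8 * Real.exp (-(Δ ^ 2 / (16 * σ ^ 2)))) (by positivity) ?_
  · simp only [Fintype.sum_prod_type] at h
    refine h.trans (ENNReal.ofReal_le_ofReal ?_)
    simp only [Fintype.card_prod, Fintype.card_fin]
    have e1 : ((d * K : ℕ) : ℝ) * Real.exp (-(0.079 * (Δ / σ) ^ 2))
        / (d / 8 * Real.exp (-(Δ ^ 2 / (16 * σ ^ 2))))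
        = 8 * K * Real.exp (-(0.0165 * (Δ / σ) ^ 2)) := by
      rw [div_eq_iff (by positivity)]
      have : Real.exp (-(0.079 * (Δ / σ) ^ 2)) = Real.exp (-(0.0165 * (Δ / σ) ^ 2))
          * Real.exp (-(Δ ^ 2 / (16 * σ ^ 2))) := by
        rw [← Real.exp_add]
        congr 1
        field_simp
        ring
      rw [this]
      push_cast
      ring
    rw [e1]
    set u := Δ / σ with hu_def
    have h8 : (8 * K : ℝ) ≤ Real.exp u := by
      have := Real.add_one_le_exp u
      linarith
    calc _ ≤ Real.exp u * Real.exp (-(0.0165 * u ^ 2)) := by gcongr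
      _ ≤ _ := by
        rw [← Real.exp_add, Real.exp_le_exp]
        nlinarith
  · rintro ⟨i, h⟩
    simp only
    rcases eq_or_ne (ζ i) h with hh | hh
    · simp [hh]
    set D := c h - c (ζ i) with hD
    have hDΔ : Δ ≤ ‖D‖ := minDist_le c hh.symm
    have hs2 : √(2 * σ ^ 2 / (α * d)) ^ 2 = 2 * σ ^ 2 / (α * d) := Real.sq_sqrt (by positivity)
    have htail := measure_inner_add_ge_le (G := fun i => G (ζ i)) (m := fun i => c (ζ i))
      hσ (fun i a => hG (ζ i) a) i (hp (i, h)) ?_ (s := √(2 * σ ^ 2 / (α * d))) (by positivity)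
      ?_ ?_ D
    · calc _ ≤ ENNReal.ofReal (‖D‖ / Δ) * eexp (-(0.079 * (Δ / σ) ^ 2 * (‖D‖ / Δ) ^ 2)) := by
            refine mul_le_mul_right (htail.trans ?_) _
            rw [eexp_le_eexp, hs2, finrank_euclideanSpace, Fintype.card_fin]
            have h1 := H.rank_mul_le
            have e1 : 0.079 * (Δ / σ) ^ 2 * (‖D‖ / Δ) ^ 2 = 0.079 * (‖D‖ ^ 2 / σ ^ 2) := by
              field_simp
            have e2 : 0.8 * (2 * σ ^ 2 / (α * d)) / σ ^ 2 * (r : ℝ) = 1.6 * (r / (α * d)) := by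
              field_simp
              norm_num
              ring
            have e3 : (r : ℝ) / (α * d) ≤ 10⁻¹ ^ 12 * (‖D‖ ^ 2 / σ ^ 2) := by
              rw [← mul_div_assoc, div_le_div_iff₀ hN (by positivity)]
              have e4 : Δ ^ 2 ≤ ‖D‖ ^ 2 := pow_le_pow_left₀ hΔ.le hDΔ 2
              have e5 : (1 : ℝ) ≤ K ^ 2 := by nlinarith
              have e6 : 10 ^ 12 * 1 * σ ^ 2 * r ≤ 10 ^ 12 * K ^ 2 * σ ^ 2 * r := by gcongr
              have e7 : α * d * Δ ^ 2 ≤ α * d * ‖D‖ ^ 2 := by gcongr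
              norm_num at *
              linarith
            rw [e1, e2]
            have e8 : 0 ≤ ‖D‖ ^ 2 / σ ^ 2 := by positivity
            norm_num at *
            linarith
        _ = ENNReal.ofReal (‖D‖ / Δ * Real.exp (-(0.079 * (Δ / σ) ^ 2 * (‖D‖ / Δ) ^ 2))) := by
            rw [ENNReal.ofReal_mul (by positivity)]
            rfl
        _ ≤ _ := by
            refine ENNReal.ofReal_le_ofReal (mul_exp_neg_sq_le ?_ ?_)
            · rwa [one_le_div hΔ]
            · nlinarith
    · intro x y hxy
      unfold noiseGap
      have e1 : ∑ j ∈ cls ζ h, (x j - c (ζ j)) = ∑ j ∈ cls ζ h, (y j - c (ζ j)) :=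
        Finset.sum_congr rfl fun j hj => by
          rw [hxy j]
          rw [Finset.mem_singleton]
          rintro rfl
          exact hh (mem_cls.1 hj)
      have e2 : ∑ j ∈ (cls ζ (ζ i)).erase i, (x j - c (ζ j))
          = ∑ j ∈ (cls ζ (ζ i)).erase i, (y j - c (ζ j)) :=
        Finset.sum_congr rfl fun j hj => by
          rw [hxy j]
          rw [Finset.mem_singleton]
          exact Finset.ne_of_mem_erase hj
      simp only [e1, e2]
    · intro a
      rw [hs2]
      unfold noiseGap
      refine lintegral_eexp_inner_sub_le (m := fun i => c (ζ i)) hN (fun i a => hG (ζ i) a) ?_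
        (H.mul_d_le_size h) (H.mul_d_le_size (ζ i)) (by rw [card_cls]) ?_ a
      · rw [Finset.disjoint_left]
        intro j hj hj'
        exact hh ((mem_cls.1 (Finset.mem_of_mem_erase hj')).symm.trans (mem_cls.1 hj))
      · rw [← card_cls]
        exact_mod_cast Finset.card_erase_le
    · rw [hs2]
      have := H.thirteen_le
      rw [← mul_div_assoc, div_le_iff₀ hN]
      have : (0 : ℝ) < σ ^ 2 := by positivity
      nlinarith

lemma measure_not_large_le :
    Measure.pi (fun i => G (ζ i)) {x | ¬ ∑ i, ∑ h, (if 0.005 * ‖c h - c (ζ i)‖ ^ 2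
      ≤ ε * ‖x i - c (ζ i)‖ then ‖c h - c (ζ i)‖ / minDist c else 0)
    ≤ d / 8 * Real.exp (-(minDist c ^ 2 / (8 * ε * σ)))}
      ≤ ENNReal.ofReal (Real.exp (-(minDist c ^ 2 / (8 * ε * σ)))) := by
  have hσ := H.sigma_pos
  have hε := H.eps_pos
  have hΔ := H.dist_pos
  have hd := H.d_pos
  have hL := H.le_dist_sq_div
  have hr := H.rank_le
  have hK := H.two_le_K
  set Δ := minDist c with hΔ_def
  have e0 : Δ ^ 2 / (8 * ε * σ) = Δ ^ 2 / (ε * σ) / 8 := by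
    field_simp
  rw [e0]
  set L := Δ ^ 2 / (ε * σ) with hL_def
  have h := measure_sum_ite_gt_le (ν := Measure.pi (fun i => G (ζ i))) (J := Fin d × Fin K)
    (a := fun j => ‖c j.2 - c (ζ j.1)‖ / Δ) (fun j => by positivity)
    (p := fun j x => 0.005 * ‖c j.2 - c (ζ j.1)‖ ^ 2 ≤ ε * ‖x j.1 - c (ζ j.1)‖)
    (fun j => measurableSet_le measurable_const (by fun_prop))
    -- the tail is Gaussian in `Δ² / (ε σ)`, so any multiple of `L` is available; `8` is ample
    (q := Real.exp (-(8 * L)))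
    (T := d / 8 * Real.exp (-(L / 8))) (by positivity) ?_
  · simp only [Fintype.sum_prod_type] at h
    refine h.trans (ENNReal.ofReal_le_ofReal ?_)
    simp only [Fintype.card_prod, Fintype.card_fin]
    rw [div_le_iff₀ (by positivity)]
    have h8 : (8 * K : ℝ) ≤ Real.exp L := by
      have := Real.add_one_le_exp L
      nlinarith
    have e1 : Real.exp (-(8 * L)) ≤ Real.exp (-(L / 8)) * Real.exp (-(L / 8)) * Real.exp (-L) := by
      rw [← Real.exp_add, ← Real.exp_add, Real.exp_le_exp]
      nlinarith
    have e2 : Real.exp (-L) * Real.exp L = 1 := by rw [← Real.exp_add]; simp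
    push_cast
    calc (d * K : ℝ) * Real.exp (-(8 * L))
        ≤ (d * (Real.exp L / 8)) * (Real.exp (-(L / 8)) * Real.exp (-(L / 8)) * Real.exp (-L)) := by
          gcongr
          linarith
      _ = d / 8 * (Real.exp (-(L / 8)) * Real.exp (-(L / 8))) * (Real.exp (-L) * Real.exp L) := by
          ring
      _ = _ := by rw [e2]; ring
  · rintro ⟨i, h⟩
    simp only
    rcases eq_or_ne (ζ i) h with hh | hh
    · simp [hh]
    set D := c h - c (ζ i) with hD
    have hDΔ : Δ ≤ ‖D‖ := minDist_le c hh.symm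
    have htail := measure_norm_ge_le (G := fun i => G (ζ i)) (m := fun i => c (ζ i))
      hσ (fun i a => hG (ζ i) a) i (u := 0.005 * ‖D‖ ^ 2 / ε) (by positivity)
    have hv : 1 ≤ ‖D‖ / Δ := by rwa [one_le_div hΔ]
    calc _ ≤ ENNReal.ofReal (‖D‖ / Δ) * eexp (-(8 * L * (‖D‖ / Δ) ^ 2)) := by
          refine mul_le_mul_right ((measure_mono ?_).trans (htail.trans ?_)) _
          · intro x hx
            simp only [Set.mem_ofPred_eq] at hx ⊢
            rw [div_le_iff₀ hε]
            linarith
          · rw [eexp_le_eexp, finrank_euclideanSpace, Fintype.card_fin]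
            have e1 : (0.005 * ‖D‖ ^ 2 / ε) ^ 2 / (3 * σ ^ 2)
                = 0.005 ^ 2 / 3 * L ^ 2 * ((‖D‖ / Δ) ^ 2) ^ 2 := by
              rw [hL_def]
              field_simp
            rw [e1]
            set v := (‖D‖ / Δ) ^ 2 with hv_def
            have hv1 : 1 ≤ v := one_le_pow₀ hv
            have hL1 : 10 ^ 12 ≤ L := by nlinarith
            have e2 : 10 * L ≤ 0.005 ^ 2 / 3 * L ^ 2 := by nlinarith
            have e3 : v ≤ v ^ 2 := by nlinarith
            have e4 : 10 * L * v ≤ 0.005 ^ 2 / 3 * L ^ 2 * v ^ 2 := by gcongr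
            nlinarith
      _ = ENNReal.ofReal (‖D‖ / Δ * Real.exp (-(8 * L * (‖D‖ / Δ) ^ 2))) := by
          rw [ENNReal.ofReal_mul (by positivity)]
          rfl
      _ ≤ _ := ENNReal.ofReal_le_ofReal (mul_exp_neg_sq_le hv (by nlinarith))

/-- The noise is well behaved, except with probability less than `δ`. -/
theorem measure_not_goodNoise_lt :
    Measure.pi (fun i => G (ζ i)) {x | ¬ GoodNoise ζ c σ ε (fun i => x i - c (ζ i))}
      < ENNReal.ofReal (failProb d σ (minDist c) ε) := by
  have h1 := measure_not_norm_sum_le H hG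
  have h2 := measure_not_norm_sum_cls_le H hG
  have h3 := measure_not_inner_le H hG
  have h4 := measure_not_aligned_le H hG
  have h5 := measure_not_large_le H hG
  have hd := H.d_pos
  have hd2 : (2 : ℝ) ≤ d := by exact_mod_cast H.two_le_d
  have hKd : (K : ℝ) ≤ d := by exact_mod_cast H.card_le
  have hlog : eexp (-(0.3 * d)) ≤ eexp (-(6 * Real.log d)) := by
    rw [eexp_le_eexp]
    have k : Fin K := ⟨0, by have := H.two_le; omega⟩
    have := H.six_log_le k
    have : (size ζ k : ℝ) ≤ d := by exact_mod_cast size_le ζ k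
    linarith
  have hpow : Real.exp (-(6 * Real.log d)) = ((d : ℝ) ^ 6)⁻¹ := by
    rw [Real.exp_neg, show (6 : ℝ) * Real.log d = ((6 : ℕ) : ℝ) * Real.log d by norm_num,
      Real.exp_nat_mul, Real.exp_log hd]
  calc _ ≤ eexp (-(6 * Real.log d)) + K * eexp (-(6 * Real.log d)) + eexp (-(6 * Real.log d))
        + ENNReal.ofReal (Real.exp (-(minDist c / σ)))
        + ENNReal.ofReal (Real.exp (-(minDist c ^ 2 / (8 * ε * σ)))) := by
        refine le_trans (measure_mono ?_) ((measure_union_le _ _).trans (add_le_add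
          ((measure_union_le _ _).trans (add_le_add ((measure_union_le _ _).trans
          (add_le_add ((measure_union_le _ _).trans (add_le_add (h1.trans hlog) h2))
          (h3.trans hlog))) h4)) h5))
        intro x hx
        by_contra hcon
        simp only [Set.mem_union, Set.mem_ofPred_eq, not_or, not_not] at hcon
        obtain ⟨⟨⟨⟨a1, a2⟩, a3⟩, a4⟩, a5⟩ := hcon
        exact hx ⟨a1, a2, a3, a4, a5⟩
    _ = ENNReal.ofReal (((d : ℝ) ^ 6)⁻¹ + K * ((d : ℝ) ^ 6)⁻¹ + ((d : ℝ) ^ 6)⁻¹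
        + Real.exp (-(minDist c / σ)) + Real.exp (-(minDist c ^ 2 / (8 * ε * σ)))) := by
        rw [ENNReal.ofReal_add (by positivity) (by positivity),
          ENNReal.ofReal_add (by positivity) (by positivity),
          ENNReal.ofReal_add (by positivity) (by positivity),
          ENNReal.ofReal_add (by positivity) (by positivity),
          ENNReal.ofReal_mul (by positivity), ENNReal.ofReal_natCast, eexp, hpow]
    _ < _ := by
        unfold failProb
        rw [ENNReal.ofReal_lt_ofReal_iff (by positivity)]
        have e1 := Real.exp_pos (-(minDist c / σ))
        have e2 := Real.exp_pos (-(minDist c ^ 2 / (8 * ε * σ)))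
        have e3 : ((d : ℝ) ^ 6)⁻¹ + K * ((d : ℝ) ^ 6)⁻¹ + ((d : ℝ) ^ 6)⁻¹ ≤ 1 / d := by
          rw [show ((d : ℝ) ^ 6)⁻¹ + K * ((d : ℝ) ^ 6)⁻¹ + ((d : ℝ) ^ 6)⁻¹
            = (K + 2) / (d : ℝ) ^ 6 by field_simp; ring]
          rw [div_le_div_iff₀ (by positivity) hd]
          have e4 : (2 : ℝ) ^ 4 ≤ (d : ℝ) ^ 4 := pow_le_pow_left₀ (by norm_num) hd2 4
          nlinarith [mul_pos hd hd]
        linarith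

end Probability

/-! ### Misclassified points and the noise -/

section Geometry

variable {E : Type*} [NormedAddCommGroup E] {cg ch mg mh y w : E}
  {Δ Λ ε : ℝ}

lemma norm_center_sub_le (hD : Δ ≤ ‖ch - cg‖) (hΔ : 0 < Δ) (hΛ : Λ ≤ 1 / 2)
    (hg : ‖mg - cg‖ ≤ Λ * Δ) (hh : ‖mh - ch‖ ≤ Λ * Δ) : ‖mh - mg‖ ≤ 2 * ‖ch - cg‖ := by
  have e : mh - mg = (ch - cg) + (mh - ch) - (mg - cg) := by abel
  have h1 := norm_sub_le ((ch - cg) + (mh - ch)) (mg - cg)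
  have h2 := norm_add_le (ch - cg) (mh - ch)
  rw [e]
  nlinarith

variable [InnerProductSpace ℝ E]

/-- A point of the cluster with mean `cg` that is at least as close to the center `mh` as to `mg`
has a noise `w` aligned with `mh - mg`. -/
lemma inner_ge_of_closer (hD : Δ ≤ ‖ch - cg‖) (hΔ : 0 < Δ) (hΛ0 : 0 ≤ Λ) (hΛ : Λ ≤ 1 / 2)
    (hg : ‖mg - cg‖ ≤ Λ * Δ) (hh : ‖mh - ch‖ ≤ Λ * Δ) (hy : ‖y - (cg + w)‖ ≤ ε)
    (hle : ‖y - mh‖ ≤ ‖y - mg‖) :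
    (1 / 2 - Λ - 2 * (ε / Δ)) * ‖ch - cg‖ ^ 2 ≤ inner ℝ w (mh - mg) := by
  have hn := norm_center_sub_le hD hΔ hΛ hg hh
  have hε : 0 ≤ ε := (norm_nonneg _).trans hy
  set D := ‖ch - cg‖ with hD_def
  set η := y - (cg + w) with hη
  have e1 : y - mh = (w + η) + (cg - mh) := by rw [hη]; abel
  have e2 : y - mg = (w + η) + (cg - mg) := by rw [hη]; abel
  have h1 := pow_le_pow_left₀ (norm_nonneg _) hle 2
  rw [e1, e2, norm_add_sq_real _ (cg - mh), norm_add_sq_real _ (cg - mg)] at h1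
  have e3 : inner ℝ (w + η) (cg - mg) - inner ℝ (w + η) (cg - mh)
      = inner ℝ w (mh - mg) + inner ℝ η (mh - mg) := by
    rw [← inner_sub_right, ← inner_add_left]
    congr 1
    abel
  have h2 : inner ℝ η (mh - mg) ≤ ε * (2 * D) :=
    (real_inner_le_norm _ _).trans (mul_le_mul hy hn (norm_nonneg _) hε)
  have h3 : D - Λ * Δ ≤ ‖cg - mh‖ := by
    have : ch - cg = -(cg - mh) - (mh - ch) := by abel
    have h4 := norm_sub_le (-(cg - mh)) (mh - ch)
    rw [← this, norm_neg] at h4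
    linarith
  have h4 : 0 ≤ D - Λ * Δ := by nlinarith
  have h5 := pow_le_pow_left₀ h4 h3 2
  have h6 : ‖cg - mg‖ ^ 2 ≤ (Λ * Δ) ^ 2 := by
    rw [norm_sub_rev]
    exact pow_le_pow_left₀ (norm_nonneg _) hg 2
  have hD0 : 0 < D := hΔ.trans_le hD
  have h7 : Λ * Δ * D ≤ Λ * D ^ 2 := by
    have := mul_le_mul_of_nonneg_left hD (mul_nonneg hΛ0 hD0.le)
    nlinarith
  have h8 : ε * D ≤ ε / Δ * D ^ 2 := by
    calc ε * D = ε / Δ * (Δ * D) := by field_simp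
      _ ≤ ε / Δ * (D * D) := by gcongr
      _ = _ := by ring
  nlinarith

end Geometry

section Counting

variable {d K r : ℕ} {σ ε : ℝ} {ζ : Fin d → Fin K} {c : Fin K → EuclideanSpace ℝ (Fin r)}
  {w : Fin d → EuclideanSpace ℝ (Fin r)}

lemma card_mul_sq_le_of_inner {S : Finset (Fin d)} {v : EuclideanSpace ℝ (Fin r)} {t A : ℝ}
    (hA : 0 ≤ A) (hS : ‖∑ i ∈ S, w i‖ ≤ σ * √(A * S.card)) (ht : 0 ≤ t)
    (h : ∀ i ∈ S, t ≤ inner ℝ (w i) v) :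
    S.card * t ^ 2 ≤ A * σ ^ 2 * ‖v‖ ^ 2 := by
  have h1 : S.card * t ≤ σ * √(A * S.card) * ‖v‖ := by
    calc (S.card : ℝ) * t = ∑ _i ∈ S, t := by simp
      _ ≤ ∑ i ∈ S, inner ℝ (w i) v := Finset.sum_le_sum h
      _ = inner ℝ (∑ i ∈ S, w i) v := by rw [sum_inner]
      _ ≤ ‖∑ i ∈ S, w i‖ * ‖v‖ := real_inner_le_norm _ _
      _ ≤ _ := by gcongr
  rcases Nat.eq_zero_or_pos S.card with h0 | h0
  · rw [h0]; simp; positivity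
  have hc : (0 : ℝ) < S.card := by exact_mod_cast h0
  have h2 := pow_le_pow_left₀ (by positivity) h1 2
  rw [mul_pow, mul_pow, mul_pow, Real.sq_sqrt (by positivity)] at h2
  refine le_of_mul_le_mul_left ?_ hc
  calc _ = (S.card : ℝ) ^ 2 * t ^ 2 := by ring
    _ ≤ _ := h2
    _ = _ := by ring

/-- Few points of a cluster have a noise aligned with a given vector, however it was chosen. -/
lemma GoodNoise.card_mul_sq_le (N : GoodNoise ζ c σ ε w) {g : Fin K}
    {S : Finset (Fin d)} (hS : S ⊆ cls ζ g) {v : EuclideanSpace ℝ (Fin r)} {t : ℝ} (ht : 0 ≤ t)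
    (h : ∀ i ∈ S, t ≤ inner ℝ (w i) v) :
    S.card * t ^ 2 ≤ 3 * (size ζ g + r) * σ ^ 2 * ‖v‖ ^ 2 :=
  card_mul_sq_le_of_inner (by positivity) (N.norm_sum_cls_le g S hS) ht h

end Counting

section Concentrated

variable {d K r : ℕ} {σ ε : ℝ} {ζ : Fin d → Fin K} {c : Fin K → EuclideanSpace ℝ (Fin r)}

/-- The distance between the true means of the cluster of `i` and of the cluster to which the labels
`z` assign it. Misclassified points are counted with this weight, since their effect on the centers
is proportional to it. -/
noncomputable def disp (ζ : Fin d → Fin K) (c : Fin K → EuclideanSpace ℝ (Fin r))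
    (z : Fin d → Fin K) (i : Fin d) : ℝ :=
  ‖c (z i) - c (ζ i)‖

/-- The weighted number of misclassified points in each estimated and in each true cluster is a
small fraction of the size of the true cluster. -/
def Concentrated (ζ : Fin d → Fin K) (c : Fin K → EuclideanSpace ℝ (Fin r))
    (z : Fin d → Fin K) : Prop :=
  ∀ k, ∑ i ∈ cls z k, disp ζ c z i ≤ minDist c / 400 * size ζ k ∧
    ∑ i ∈ cls ζ k, disp ζ c z i ≤ minDist c / 400 * size ζ k

lemma disp_nonneg (z : Fin d → Fin K) (i : Fin d) : 0 ≤ disp ζ c z i := norm_nonneg _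

lemma minDist_le_disp {z : Fin d → Fin K} {i : Fin d} (h : z i ≠ ζ i) :
    minDist c ≤ disp ζ c z i := minDist_le c h

lemma card_filter_ne_mul_le (z : Fin d → Fin K) (S : Finset (Fin d)) :
    ((S.filter fun i => z i ≠ ζ i).card : ℝ) * minDist c ≤ ∑ i ∈ S, disp ζ c z i := by
  calc _ = ∑ i ∈ S.filter (fun i => z i ≠ ζ i), minDist c := by simp
    _ ≤ ∑ i ∈ S.filter (fun i => z i ≠ ζ i), disp ζ c z i :=
        Finset.sum_le_sum fun i hi => minDist_le_disp (Finset.mem_filter.1 hi).2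
    _ ≤ _ := Finset.sum_le_sum_of_subset_of_nonneg (Finset.filter_subset _ _)
        fun i _ _ => disp_nonneg z i

lemma sum_cls {β : Type*} [AddCommMonoid β] (z : Fin d → Fin K) (f : Fin d → β) :
    ∑ k, ∑ i ∈ cls z k, f i = ∑ i, f i :=
  Finset.sum_fiberwise _ _ _

lemma sum_size (z : Fin d → Fin K) : ∑ k, (size z k : ℝ) = d := by
  have h := sum_cls z fun _ => (1 : ℝ)
  simpa [card_cls] using h

/-- If the number of points moved from `g` to `h` is at most `X g` times the inverse of the squared
relative distance of the means, then summing over the pairs of clusters gives concentration. -/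
lemma concentrated_of_card_le (H : Regime d K r σ ε (minDist c) (minProp ζ)) {z : Fin d → Fin K}
    {X : Fin K → ℝ} (hX0 : ∀ g, 0 ≤ X g)
    (hX : ∀ g h, g ≠ h → ((cls ζ g ∩ cls z h).card : ℝ) * ‖c h - c g‖ ^ 2 ≤ X g * minDist c ^ 2)
    (h1 : ∑ g, X g ≤ minProp ζ * d / 400) (h2 : ∀ g, K * X g ≤ size ζ g / 400) :
    Concentrated ζ c z := by
  have hΔ := H.dist_pos
  have key : ∀ g h, ∑ i ∈ cls ζ g ∩ cls z h, disp ζ c z i ≤ X g * minDist c := by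
    intro g h
    have e : ∑ i ∈ cls ζ g ∩ cls z h, disp ζ c z i
        = (cls ζ g ∩ cls z h).card * ‖c h - c g‖ := by
      rw [← nsmul_eq_mul, ← Finset.sum_const]
      refine Finset.sum_congr rfl fun i hi => ?_
      rw [Finset.mem_inter, mem_cls, mem_cls] at hi
      rw [disp, hi.1, hi.2]
    rw [e]
    rcases eq_or_ne g h with rfl | hgh
    · simpa using mul_nonneg (hX0 g) hΔ.le
    have hD : minDist c ≤ ‖c h - c g‖ := minDist_le c hgh.symm
    refine le_of_mul_le_mul_right ?_ hΔ
    calc _ ≤ (cls ζ g ∩ cls z h).card * ‖c h - c g‖ * ‖c h - c g‖ := by gcongr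
      _ = (cls ζ g ∩ cls z h).card * ‖c h - c g‖ ^ 2 := by ring
      _ ≤ _ := hX g h hgh
      _ = _ := by ring
  intro k
  constructor
  · have e : ∑ i ∈ cls z k, disp ζ c z i = ∑ g, ∑ i ∈ cls ζ g ∩ cls z k, disp ζ c z i := by
      rw [← Finset.sum_fiberwise (cls z k) ζ]
      refine Finset.sum_congr rfl fun g _ => Finset.sum_congr ?_ fun _ _ => rfl
      ext i
      simp [mem_cls, and_comm]
    rw [e]
    calc _ ≤ ∑ g, X g * minDist c := Finset.sum_le_sum fun g _ => key g k
      _ = (∑ g, X g) * minDist c := by rw [Finset.sum_mul]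
      _ ≤ (size ζ k / 400) * minDist c := by
          have := H.mul_d_le_size k
          gcongr
          linarith
      _ = _ := by ring
  · have e : ∑ i ∈ cls ζ k, disp ζ c z i = ∑ h, ∑ i ∈ cls ζ k ∩ cls z h, disp ζ c z i := by
      rw [← Finset.sum_fiberwise (cls ζ k) z]
      refine Finset.sum_congr rfl fun g _ => Finset.sum_congr ?_ fun _ _ => rfl
      ext i
      simp [mem_cls]
    rw [e]
    calc _ ≤ ∑ _h : Fin K, X k * minDist c := Finset.sum_le_sum fun h _ => key k h
      _ = K * X k * minDist c := by simp [mul_assoc]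
      _ ≤ (size ζ k / 400) * minDist c := by
          have := h2 k
          gcongr
      _ = _ := by ring

lemma Regime.mul_size_add_le (H : Regime d K r σ ε (minDist c) (minProp ζ)) (g : Fin K) :
    K * (size ζ g + r) * (minProp ζ * d) ≤ size ζ g * (d + K * r) := by
  have h1 := H.mul_d_le_size g
  have h2 := H.prop_le
  have hd := H.d_pos
  have h3 : (K * minProp ζ) * (size ζ g * d) ≤ 1 * (size ζ g * d) := by gcongr
  have h4 : (K * r : ℝ) * (minProp ζ * d) ≤ K * r * size ζ g := by gcongr
  linarith

variable {w x : Fin d → EuclideanSpace ℝ (Fin r)} {m : Fin K → EuclideanSpace ℝ (Fin r)}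
  {z : Fin d → Fin K} {τ : ℝ}

/-- Moving all points for which `⟪w i, m h - m g⟫` is large gives concentrated labels, if the
threshold `τ` is large compared with the worst-case noise level. -/
lemma concentrated_of_inner_ge (H : Regime d K r σ ε (minDist c) (minProp ζ))
    (N : GoodNoise ζ c σ ε w) (hτ : 0 < τ)
    (hm : ∀ g h, g ≠ h → ‖m h - m g‖ ≤ 2 * ‖c h - c g‖)
    (hz : ∀ i, z i ≠ ζ i → τ * ‖c (z i) - c (ζ i)‖ ^ 2 ≤ inner ℝ (w i) (m (z i) - m (ζ i)))
    (hστ : 4800 * σ ^ 2 * (d + K * r) ≤ τ ^ 2 * (minProp ζ * d * minDist c ^ 2)) :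
    Concentrated ζ c z := by
  have hΔ := H.dist_pos
  have hd := H.d_pos
  have hα := H.prop_pos
  have hαd : 0 < minProp ζ * d := by positivity
  refine concentrated_of_card_le H
    (X := fun g => 12 * σ ^ 2 * (size ζ g + r) / (τ ^ 2 * minDist c ^ 2))
    (fun g => by positivity) (fun g h hgh => ?_) ?_ fun g => ?_
  · have hD : 0 < ‖c h - c g‖ := hΔ.trans_le (minDist_le c hgh.symm)
    have h1 := N.card_mul_sq_le (g := g) (S := cls ζ g ∩ cls z h)
      Finset.inter_subset_left (v := m h - m g) (t := τ * ‖c h - c g‖ ^ 2) (by positivity) ?_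
    · have h2 := pow_le_pow_left₀ (norm_nonneg _) (hm g h hgh) 2
      have h3 : ((cls ζ g ∩ cls z h).card : ℝ) * (τ * ‖c h - c g‖ ^ 2) ^ 2
          ≤ 3 * (size ζ g + r) * σ ^ 2 * (2 * ‖c h - c g‖) ^ 2 := h1.trans (by gcongr)
      have h4 : ((cls ζ g ∩ cls z h).card : ℝ) * ‖c h - c g‖ ^ 2 * τ ^ 2
          ≤ 12 * σ ^ 2 * (size ζ g + r) := by
        refine le_of_mul_le_mul_right ?_ (pow_pos hD 2)
        calc _ = ((cls ζ g ∩ cls z h).card : ℝ) * (τ * ‖c h - c g‖ ^ 2) ^ 2 := by ring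
          _ ≤ _ := h3
          _ = _ := by ring
      calc _ ≤ 12 * σ ^ 2 * (size ζ g + r) / τ ^ 2 := by rwa [le_div_iff₀ (by positivity)]
        _ = _ := by field_simp
    · intro i hi
      rw [Finset.mem_inter, mem_cls, mem_cls] at hi
      have := hz i (by rw [hi.1, hi.2]; exact hgh.symm)
      rwa [hi.1, hi.2] at this
  · rw [← Finset.sum_div, ← Finset.mul_sum, Finset.sum_add_distrib, sum_size, Finset.sum_const,
      Finset.card_univ, Fintype.card_fin, nsmul_eq_mul, div_le_div_iff₀ (by positivity)
      (by norm_num)]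
    linarith
  · rw [← mul_div_assoc, div_le_div_iff₀ (by positivity) (by norm_num)]
    have h1 := H.mul_size_add_le g
    refine le_of_mul_le_mul_right ?_ hαd
    calc _ = 4800 * σ ^ 2 * (K * (size ζ g + r) * (minProp ζ * d)) := by ring
      _ ≤ 4800 * σ ^ 2 * (size ζ g * (d + K * r)) := by gcongr
      _ = size ζ g * (4800 * σ ^ 2 * (d + K * r)) := by ring
      _ ≤ size ζ g * (τ ^ 2 * (minProp ζ * d * minDist c ^ 2)) := by gcongr
      _ = _ := by ring

end Concentrated

/-! ### One iteration in high dimension -/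

section HighDimension

variable {d K r : ℕ} {σ ε : ℝ} {ζ : Fin d → Fin K} {c : Fin K → EuclideanSpace ℝ (Fin r)}
  {w x : Fin d → EuclideanSpace ℝ (Fin r)} {z₀ z : Fin d → Fin K} {τ : ℝ}

lemma norm_inv_card_smul_sum_le {E : Type*} [NormedAddCommGroup E] [NormedSpace ℝ E]
    {ι : Type*} {S : Finset ι} {f : ι → E} {b : ℝ} (hb : 0 ≤ b) (h : ∀ i ∈ S, ‖f i‖ ≤ b) :
    ‖(S.card : ℝ)⁻¹ • ∑ i ∈ S, f i‖ ≤ b := by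
  rw [norm_smul, norm_inv, RCLike.norm_natCast]
  rcases S.eq_empty_or_nonempty with rfl | hS
  · simpa using hb
  have hc : (0 : ℝ) < S.card := by exact_mod_cast hS.card_pos
  rw [inv_mul_le_iff₀ hc]
  calc _ ≤ ∑ i ∈ S, ‖f i‖ := norm_sum_le _ _
    _ ≤ ∑ _i ∈ S, b := Finset.sum_le_sum h
    _ = _ := by simp

lemma norm_clusterMean_sub_meanOff_le (hε : 0 ≤ ε) (hx : ∀ i, ‖x i - (c (ζ i) + w i)‖ ≤ ε)
    (z₀ : Fin d → Fin K) (k : Fin K) :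
    ‖clusterMean x z₀ k - meanOff ζ c w ∅ (cls z₀ k)‖ ≤ ε := by
  have e : clusterMean x z₀ k - meanOff ζ c w ∅ (cls z₀ k)
      = ((cls z₀ k).card : ℝ)⁻¹ • ∑ i ∈ cls z₀ k, (x i - (c (ζ i) + w i)) := by
    rw [Finset.sum_sub_distrib, Finset.sum_add_distrib, smul_sub, meanOff, Finset.sdiff_empty]
    rfl
  rw [e]
  exact norm_inv_card_smul_sum_le hε fun i _ => hx i

lemma meanOff_empty_sub (B S : Finset (Fin d)) :
    meanOff ζ c w ∅ S - meanOff ζ c w B S = (S.card : ℝ)⁻¹ • ∑ i ∈ S ∩ B, w i := by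
  rw [meanOff, meanOff, ← smul_sub, Finset.sdiff_empty]
  congr 1
  have h := Finset.sum_sdiff (f := w) (Finset.inter_subset_left : S ∩ B ⊆ S)
  rw [Finset.sdiff_inter_self_left] at h
  rw [← h]
  abel

/-- Removing the noise of the points in `B` changes the mean over `S` only slightly, if `S` has at
least `q` elements or is disjoint from `B`. -/
lemma GoodNoise.norm_meanOff_sub_le (N : GoodNoise ζ c σ ε w) (hσ : 0 ≤ σ) {q : ℝ} (hq : 0 < q)
    {B S : Finset (Fin d)} (hBS : ∀ i ∈ B, i ∉ S ∨ q ≤ S.card) :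
    ‖meanOff ζ c w ∅ S - meanOff ζ c w B S‖ ≤ q⁻¹ * (σ * √(3 * (d + r) * B.card)) := by
  rw [meanOff_empty_sub]
  rcases (S ∩ B).eq_empty_or_nonempty with h0 | ⟨i, hi⟩
  · rw [h0]; simp; positivity
  rw [Finset.mem_inter] at hi
  have hqS : q ≤ S.card := (hBS i hi.2).resolve_left (not_not.2 hi.1)
  have h1 : (S ∩ B).card ≤ B.card := Finset.card_le_card Finset.inter_subset_right
  rw [norm_smul, norm_inv, RCLike.norm_natCast]
  refine mul_le_mul (inv_anti₀ hq hqS) ((N.norm_sum_le _).trans ?_) (norm_nonneg _) (by positivity)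
  gcongr

lemma card_le_card_filter_add {ι : Type*} [DecidableEq ι] {q : ℝ} (hq : 0 < q) (B Sh Sg : Finset ι) :
    (B.card : ℝ)
      ≤ (B.filter fun i => (i ∉ Sh ∨ q ≤ Sh.card) ∧ (i ∉ Sg ∨ q ≤ Sg.card)).card + 2 * q := by
  have hsmall : ∀ S : Finset ι,
      (((B.filter fun i => ¬ (i ∉ S ∨ q ≤ S.card)).card : ℕ) : ℝ) ≤ q := by
    intro S
    by_cases hS : q ≤ S.card
    · simp [hS, hq.le]
    · have h1 : (B.filter fun i => ¬ (i ∉ S ∨ q ≤ S.card)) ⊆ S := by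
        intro i hi
        have := (Finset.mem_filter.1 hi).2
        rw [not_or, not_not] at this
        exact this.1
      have h2 : (((B.filter fun i => ¬ (i ∉ S ∨ q ≤ S.card)).card : ℕ) : ℝ) ≤ S.card := by
        exact_mod_cast Finset.card_le_card h1
      linarith
  have hsub : B ⊆ ((B.filter fun i => (i ∉ Sh ∨ q ≤ Sh.card) ∧ (i ∉ Sg ∨ q ≤ Sg.card))
      ∪ B.filter fun i => ¬ (i ∉ Sh ∨ q ≤ Sh.card))
      ∪ B.filter fun i => ¬ (i ∉ Sg ∨ q ≤ Sg.card) := by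
    intro i hi
    simp only [Finset.mem_union, Finset.mem_filter, hi, true_and]
    tauto
  have h1 := (Finset.card_le_card hsub).trans ((Finset.card_union_le _ _).trans
    (add_le_add_left (Finset.card_union_le _ _) _))
  have h2 : (B.card : ℝ) ≤ (B.filter fun i => (i ∉ Sh ∨ q ≤ Sh.card) ∧ (i ∉ Sg ∨ q ≤ Sg.card)).card
      + (B.filter fun i => ¬ (i ∉ Sh ∨ q ≤ Sh.card)).card
      + (B.filter fun i => ¬ (i ∉ Sg ∨ q ≤ Sg.card)).card := by exact_mod_cast h1
  have h3 := hsmall Sh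
  have h4 := hsmall Sg
  linarith

/-- The algebra that extracts a bound for the number `b` of moved points from the inequality between
their thresholds and their noise. -/
lemma mul_sq_le_of_noise_le {σ ε Δ τ d r D b s A q : ℝ} (hσ : 0 < σ) (hε : 0 < ε) (hΔ : 0 < Δ)
    (hτ : 0 < τ) (hd : 0 < d) (hr : 0 ≤ r) (hΔD : Δ ≤ D) (hb0 : 0 ≤ b)
    (hs2 : s ^ 2 = 8 * σ ^ 2 * d * b) (hA2 : A ^ 2 = 3 * σ ^ 2 * (d + r) * b)
    (hq_def : q = 48 * σ ^ 2 * (d + r) / (τ * D ^ 2))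
    (hmain : b * (τ * D ^ 2)
      ≤ s * (3 * D + 2 * (q⁻¹ * A)) + A * (2 * (q⁻¹ * A)) + A * (2 * ε)) :
    b * D ^ 2 ≤ 324 * σ ^ 2 * d / τ ^ 2 + 54 * ε ^ 2 * σ ^ 2 * (d + r) / (τ ^ 2 * Δ ^ 2) := by
  have hD : 0 < D := hΔ.trans_le hΔD
  have hq : 0 < q := by rw [hq_def]; positivity
  have hsA : s * A ≤ 5 * σ ^ 2 * (d + r) * b := by
    refine abs_le_of_sq_le_sq' ?_ (by positivity) |>.2
    rw [mul_pow, hs2, hA2]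
    have h1 : d ≤ d + r := by linarith
    calc 8 * σ ^ 2 * d * b * (3 * σ ^ 2 * (d + r) * b) ≤
        8 * σ ^ 2 * (d + r) * b * (3 * σ ^ 2 * (d + r) * b) := by gcongr
      _ = 24 * (σ ^ 2 * (d + r) * b) ^ 2 := by ring
      _ ≤ 25 * (σ ^ 2 * (d + r) * b) ^ 2 := by gcongr; norm_num
      _ = _ := by ring
  have habs : q⁻¹ * (16 * σ ^ 2 * (d + r) * b) = b * (τ * D ^ 2) / 3 := by
    rw [hq_def]
    field_simp
    ring
  have h23 : 2 / 3 * (b * (τ * D ^ 2)) ≤ 3 * D * s + 2 * ε * A := by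
    have h1 : q⁻¹ * (2 * (s * A) + 2 * A ^ 2) ≤ q⁻¹ * (16 * σ ^ 2 * (d + r) * b) := by
      rw [hA2]
      refine mul_le_mul_of_nonneg_left ?_ (by positivity)
      linarith
    rw [habs] at h1
    linarith
  have h1 := pow_le_pow_left₀ (by positivity) h23 2
  have h2 : (3 * D * s + 2 * ε * A) ^ 2
      ≤ 2 * ((3 * D) ^ 2 * s ^ 2 + (2 * ε) ^ 2 * A ^ 2) := by
    nlinarith [sq_nonneg (3 * D * s - 2 * ε * A)]
  rw [hs2, hA2] at h2
  rcases hb0.eq_or_lt with h0 | h0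
  · rw [← h0]; simp; positivity
  have h3 : b * (τ ^ 2 * D ^ 2) * D ^ 2
      ≤ 324 * σ ^ 2 * d * D ^ 2 + 54 * ε ^ 2 * σ ^ 2 * (d + r) := by
    refine le_of_mul_le_mul_left ?_ h0
    nlinarith
  have h4 : b * D ^ 2 ≤ 324 * σ ^ 2 * d / τ ^ 2
      + 54 * ε ^ 2 * σ ^ 2 * (d + r) / (τ ^ 2 * D ^ 2) := by
    refine le_of_mul_le_mul_right ?_ (by positivity : 0 < τ ^ 2 * D ^ 2)
    refine le_trans (le_of_eq ?_) (h3.trans (le_of_eq ?_))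
    · ring
    · field_simp
  refine h4.trans ?_
  gcongr

/-- The number of points moved from the cluster `g` to the cluster `h`, when the centers are cluster
means. Here the dimension enters only through the self-interaction of the points that are used for
these two centers, which is harmless unless there are less than `q` such points. -/
lemma card_mul_sq_le_of_clusterMean (H : Regime d K r σ ε (minDist c) (minProp ζ))
    (N : GoodNoise ζ c σ ε w) (hx : ∀ i, ‖x i - (c (ζ i) + w i)‖ ≤ ε) (hτ : 0 < τ) {g h : Fin K}
    (hgh : g ≠ h)
    (hm : ‖clusterMean x z₀ h - clusterMean x z₀ g‖ ≤ 2 * ‖c h - c g‖)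
    (hz : ∀ i ∈ cls ζ g ∩ cls z h, τ * ‖c h - c g‖ ^ 2
      ≤ inner ℝ (w i) (clusterMean x z₀ h - clusterMean x z₀ g)) :
    ((cls ζ g ∩ cls z h).card : ℝ) * ‖c h - c g‖ ^ 2 ≤ 324 * σ ^ 2 * d / τ ^ 2
      + 54 * ε ^ 2 * σ ^ 2 * (d + r) / (τ ^ 2 * minDist c ^ 2) + 96 * σ ^ 2 * (d + r) / τ := by
  have hσ := H.sigma_pos
  have hε := H.eps_pos
  have hΔ := H.dist_pos
  have hd := H.d_pos
  have hΔD : minDist c ≤ ‖c h - c g‖ := minDist_le c hgh.symm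
  have hεΔ := H.mul_eps_le
  have hK := H.two_le_K
  set Δ := minDist c with hΔ_def
  set D := ‖c h - c g‖ with hD_def
  have hD : 0 < D := hΔ.trans_le hΔD
  set B := cls ζ g ∩ cls z h with hB
  set Sh := cls z₀ h with hSh
  set Sg := cls z₀ g with hSg
  set q : ℝ := 48 * σ ^ 2 * (d + r) / (τ * D ^ 2) with hq_def
  have hq : 0 < q := by positivity
  -- A moved point is discarded if it belongs to a group of less than `q` points whose mean is one of
  -- the two centers. At most `2 * q` points are discarded.
  set B' := B.filter fun i => (i ∉ Sh ∨ q ≤ Sh.card) ∧ (i ∉ Sg ∨ q ≤ Sg.card) with hB'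
  have hcard : (B.card : ℝ) ≤ B'.card + 2 * q := card_le_card_filter_add hq B Sh Sg
  set b : ℝ := (B'.card : ℝ) with hb_def
  have hb0 : 0 ≤ b := by positivity
  set A : ℝ := σ * √(3 * (d + r) * b) with hA_def
  set s : ℝ := σ * √(8 * d * b) with hs_def
  have hA0 : 0 ≤ A := by positivity
  have hs0 : 0 ≤ s := by positivity
  have hA2 : A ^ 2 = 3 * σ ^ 2 * (d + r) * b := by
    rw [hA_def, mul_pow, Real.sq_sqrt (by positivity)]; ring
  have hs2 : s ^ 2 = 8 * σ ^ 2 * d * b := by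
    rw [hs_def, mul_pow, Real.sq_sqrt (by positivity)]; ring
  set W := ∑ i ∈ B', w i with hW_def
  have hWA : ‖W‖ ≤ A := N.norm_sum_le B'
  -- The difference of the two centers is the sum of `Y`, which does not involve the noise of the
  -- points in `B'`, of the contribution `Zh - Zg` of this noise, and of averaged estimation errors.
  set Y := meanOff ζ c w B' Sh - meanOff ζ c w B' Sg with hY_def
  set Zh := meanOff ζ c w ∅ Sh - meanOff ζ c w B' Sh with hZh_def
  set Zg := meanOff ζ c w ∅ Sg - meanOff ζ c w B' Sg with hZg_def
  set ηh := clusterMean x z₀ h - meanOff ζ c w ∅ Sh with hηh_def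
  set ηg := clusterMean x z₀ g - meanOff ζ c w ∅ Sg with hηg_def
  have hZh : ‖Zh‖ ≤ q⁻¹ * A := N.norm_meanOff_sub_le hσ.le hq fun i hi =>
    (Finset.mem_filter.1 hi).2.1
  have hZg : ‖Zg‖ ≤ q⁻¹ * A := N.norm_meanOff_sub_le hσ.le hq fun i hi =>
    (Finset.mem_filter.1 hi).2.2
  have hηh : ‖ηh‖ ≤ ε := norm_clusterMean_sub_meanOff_le hε.le hx z₀ h
  have hηg : ‖ηg‖ ≤ ε := norm_clusterMean_sub_meanOff_le hε.le hx z₀ g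
  have hdec : clusterMean x z₀ h - clusterMean x z₀ g = Y + (Zh - Zg) + (ηh - ηg) := by
    rw [hY_def, hZh_def, hZg_def, hηh_def, hηg_def]; abel
  have hZ : ‖Zh - Zg‖ ≤ 2 * (q⁻¹ * A) := (norm_sub_le _ _).trans (by linarith)
  have hη : ‖ηh - ηg‖ ≤ 2 * ε := (norm_sub_le _ _).trans (by linarith)
  have hYn : ‖Y‖ ≤ 3 * D + 2 * (q⁻¹ * A) := by
    have e : Y = (clusterMean x z₀ h - clusterMean x z₀ g) - ((Zh - Zg) + (ηh - ηg)) := by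
      rw [hdec]; abel
    have h1 := norm_sub_le (clusterMean x z₀ h - clusterMean x z₀ g) ((Zh - Zg) + (ηh - ηg))
    have h2 := norm_add_le (Zh - Zg) (ηh - ηg)
    rw [e]
    nlinarith
  have hmain : b * (τ * D ^ 2) ≤ s * (3 * D + 2 * (q⁻¹ * A)) + A * (2 * (q⁻¹ * A)) + A * (2 * ε) := by
    calc b * (τ * D ^ 2) = ∑ _i ∈ B', τ * D ^ 2 := by simp [hb_def]
      _ ≤ ∑ i ∈ B', inner ℝ (w i) (clusterMean x z₀ h - clusterMean x z₀ g) :=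
          Finset.sum_le_sum fun i hi => hz i (Finset.mem_of_mem_filter i hi)
      _ = inner ℝ W Y + inner ℝ W (Zh - Zg) + inner ℝ W (ηh - ηg) := by
          rw [← sum_inner, hdec, inner_add_right, inner_add_right]
      _ ≤ s * ‖Y‖ + ‖W‖ * ‖Zh - Zg‖ + ‖W‖ * ‖ηh - ηg‖ :=
          add_le_add (add_le_add (N.inner_le B' Sh Sg) (real_inner_le_norm _ _))
            (real_inner_le_norm _ _)
      _ ≤ _ := by gcongr
  have hfin : b * D ^ 2 ≤ 324 * σ ^ 2 * d / τ ^ 2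
      + 54 * ε ^ 2 * σ ^ 2 * (d + r) / (τ ^ 2 * Δ ^ 2) :=
    mul_sq_le_of_noise_le hσ hε hΔ hτ hd r.cast_nonneg hΔD hb0 hs2 hA2 hq_def hmain
  have h2q : 2 * q * D ^ 2 = 96 * σ ^ 2 * (d + r) / τ := by
    rw [hq_def]
    field_simp
    norm_num
  calc (B.card : ℝ) * D ^ 2 ≤ (b + 2 * q) * D ^ 2 := by gcongr
    _ = b * D ^ 2 + 2 * q * D ^ 2 := by ring
    _ ≤ _ := by rw [h2q]; linarith

/-- The high-dimensional counterpart of `concentrated_of_inner_ge`, for centers that are cluster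
means. The dimension does not enter the main condition `hσα` on the threshold. -/
lemma concentrated_of_clusterMean (H : Regime d K r σ ε (minDist c) (minProp ζ))
    (N : GoodNoise ζ c σ ε w) (hx : ∀ i, ‖x i - (c (ζ i) + w i)‖ ≤ ε) (hτ : 0 < τ)
    (hm : ∀ g h, g ≠ h →
      ‖clusterMean x z₀ h - clusterMean x z₀ g‖ ≤ 2 * ‖c h - c g‖)
    (hz : ∀ i, z i ≠ ζ i → τ * ‖c (z i) - c (ζ i)‖ ^ 2
      ≤ inner ℝ (w i) (clusterMean x z₀ (z i) - clusterMean x z₀ (ζ i)))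
    (hdr : d ≤ r) (hσα : σ ≤ √(minProp ζ) * minDist c * τ ^ 2)
    (hστ : σ ^ 2 * (d + K * r) ≤ τ ^ 2 * (minProp ζ * d * minDist c ^ 2)) :
    Concentrated ζ c z := by
  have hσ := H.sigma_pos
  have hε := H.eps_pos
  have hΔ := H.dist_pos
  have hd := H.d_pos
  have hα := H.prop_pos
  have hK := H.two_le_K
  have hdr' : (d : ℝ) ≤ r := by exact_mod_cast hdr
  have hnoise := H.noise_le
  have hεΔ := H.mul_eps_le
  have hsα : √(minProp ζ) ^ 2 = minProp ζ := Real.sq_sqrt hα.le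
  set α := minProp ζ with hα_def
  set Δ := minDist c with hΔ_def
  have hsα0 : 0 < √α := Real.sqrt_pos.2 hα
  set P : ℝ := α * d * Δ ^ 2 with hP_def
  have hP : 0 < P := by positivity
  have hKσ : 10 ^ 6 * K * σ ≤ √α * Δ := by
    refine abs_le_of_sq_le_sq' ?_ (by positivity) |>.2
    refine le_of_mul_le_mul_right ?_ hd
    calc (10 ^ 6 * K * σ) ^ 2 * d = 10 ^ 12 * K * σ ^ 2 * (K * d) := by ring
      _ ≤ 10 ^ 12 * K * σ ^ 2 * (d + K * r) := by
          gcongr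
          nlinarith
      _ ≤ _ := hnoise
      _ = (√α * Δ) ^ 2 * d := by rw [mul_pow, hsα, hP_def]; ring
  set Q : ℝ := σ ^ 2 * (d + K * r) with hQ_def
  have hQ : 0 < Q := by positivity
  have hQP : 10 ^ 12 * Q ≤ P := by
    have : 10 ^ 12 * 1 * Q ≤ 10 ^ 12 * K * Q := by gcongr; linarith
    calc 10 ^ 12 * Q = 10 ^ 12 * 1 * Q := by ring
      _ ≤ 10 ^ 12 * K * Q := this
      _ = 10 ^ 12 * K * σ ^ 2 * (d + K * r) := by rw [hQ_def]; ring
      _ ≤ P := hnoise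
  have hKr : K * σ ^ 2 * (d + r) ≤ 2 * Q := by
    have : (K : ℝ) * (d + r) ≤ 2 * (d + K * r) := by nlinarith
    calc _ = σ ^ 2 * (K * (d + r)) := by ring
      _ ≤ σ ^ 2 * (2 * (d + K * r)) := by gcongr
      _ = _ := by ring
  set X : ℝ := 324 * σ ^ 2 * d / τ ^ 2
      + 54 * ε ^ 2 * σ ^ 2 * (d + r) / (τ ^ 2 * Δ ^ 2) + 96 * σ ^ 2 * (d + r) / τ with hX_def
  have hX : K * X ≤ P / 400 := by
    have h1 : K * (324 * σ ^ 2 * d / τ ^ 2) ≤ 324 * 10⁻¹ ^ 6 * P := by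
      rw [← mul_div_assoc, div_le_iff₀ (by positivity)]
      calc K * (324 * σ ^ 2 * d) = 324 * d * 10⁻¹ ^ 6 * ((10 ^ 6 * K * σ) * σ) := by ring
        _ ≤ 324 * d * 10⁻¹ ^ 6 * ((√α * Δ) * (√α * Δ * τ ^ 2)) := by gcongr
        _ = 324 * 10⁻¹ ^ 6 * (√α ^ 2 * d * Δ ^ 2) * τ ^ 2 := by ring
        _ = _ := by rw [hsα]
    have h2 : K * (54 * ε ^ 2 * σ ^ 2 * (d + r) / (τ ^ 2 * Δ ^ 2)) ≤ 10⁻¹ ^ 6 * P := by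
      rw [← mul_div_assoc, div_le_iff₀ (by positivity)]
      have h3 : (10 ^ 6 * ε) ^ 2 ≤ Δ ^ 2 := by
        refine pow_le_pow_left₀ (by positivity) (le_trans ?_ hεΔ) 2
        nlinarith
      calc K * (54 * ε ^ 2 * σ ^ 2 * (d + r)) = 54 * ε ^ 2 * (K * σ ^ 2 * (d + r)) := by ring
        _ ≤ 54 * ε ^ 2 * (2 * (τ ^ 2 * P)) :=
            mul_le_mul_of_nonneg_left (by linarith) (by positivity)
        _ = 108 * 10⁻¹ ^ 12 * ((10 ^ 6 * ε) ^ 2) * (τ ^ 2 * P) := by ring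
        _ ≤ 108 * 10⁻¹ ^ 12 * Δ ^ 2 * (τ ^ 2 * P) := by gcongr
        _ = (108 * 10⁻¹ ^ 12) * (Δ ^ 2 * (τ ^ 2 * P)) := by ring
        _ ≤ 10⁻¹ ^ 6 * (Δ ^ 2 * (τ ^ 2 * P)) := by
            gcongr
            norm_num
        _ = _ := by ring
    have h4 : K * (96 * σ ^ 2 * (d + r) / τ) ≤ 192 * 10⁻¹ ^ 6 * P := by
      rw [← mul_div_assoc, div_le_iff₀ hτ]
      have h5 : 10 ^ 6 * Q ≤ τ * P := by
        refine abs_le_of_sq_le_sq' ?_ (by positivity) |>.2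
        calc (10 ^ 6 * Q) ^ 2 = (10 ^ 12 * Q) * Q := by ring
          _ ≤ P * (τ ^ 2 * P) := by gcongr
          _ = _ := by ring
      calc K * (96 * σ ^ 2 * (d + r)) = 96 * (K * σ ^ 2 * (d + r)) := by ring
        _ ≤ 96 * (2 * Q) := by gcongr
        _ = 192 * 10⁻¹ ^ 6 * (10 ^ 6 * Q) := by ring
        _ ≤ 192 * 10⁻¹ ^ 6 * (τ * P) := by gcongr
        _ = _ := by ring
    rw [hX_def, mul_add, mul_add]
    refine (add_le_add (add_le_add h1 h2) h4).trans ?_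
    have : (324 * 10⁻¹ ^ 6 + 10⁻¹ ^ 6 + 192 * 10⁻¹ ^ 6 : ℝ) ≤ 1 / 400 := by norm_num
    nlinarith
  have hKX : K * (X / Δ ^ 2) ≤ α * d / 400 := by
    rw [← mul_div_assoc, div_le_iff₀ (by positivity)]
    rw [hP_def] at hX
    linarith
  refine concentrated_of_card_le H (X := fun _ => X / Δ ^ 2)
    (fun g => by positivity) (fun g h hgh => ?_) ?_ fun g => ?_
  · rw [div_mul_cancel₀ _ (by positivity)]
    refine card_mul_sq_le_of_clusterMean H N hx hτ hgh (hm g h hgh) fun i hi => ?_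
    rw [Finset.mem_inter, mem_cls, mem_cls] at hi
    have := hz i (by rw [hi.1, hi.2]; exact hgh.symm)
    rwa [hi.1, hi.2] at this
  · simpa using hKX
  · refine hKX.trans ?_
    have := H.mul_d_le_size g
    gcongr

end HighDimension

/-! ### The centers of concentrated labels -/

section Centers

variable {d K r : ℕ} {σ ε : ℝ} {ζ : Fin d → Fin K} {c : Fin K → EuclideanSpace ℝ (Fin r)}
  {w x : Fin d → EuclideanSpace ℝ (Fin r)} {z : Fin d → Fin K}

lemma Regime.sigma_sq_mul_le (H : Regime d K r σ ε (minDist c) (minProp ζ)) (k : Fin K) :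
    10 ^ 12 * (σ ^ 2 * (d + r)) ≤ size ζ k * minDist c ^ 2 := by
  have hK := H.two_le_K
  have h1 := H.noise_le
  have h2 := H.mul_d_le_size k
  have h3 : (d + r : ℝ) ≤ K * (d + K * r) := by
    have hd : (0 : ℝ) ≤ d := by positivity
    have hr : (0 : ℝ) ≤ r := by positivity
    have h4 : (d : ℝ) ≤ K * d := by nlinarith
    have h5 : (r : ℝ) ≤ K * r := by nlinarith
    have h6 : (K * r : ℝ) ≤ K * (K * r) := by nlinarith
    linarith
  calc _ ≤ 10 ^ 12 * (σ ^ 2 * (K * (d + K * r))) := by gcongr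
    _ = 10 ^ 12 * K * σ ^ 2 * (d + K * r) := by ring
    _ ≤ _ := h1
    _ ≤ _ := by gcongr

lemma norm_sum_mean_sub_le (z : Fin d → Fin K) (k : Fin K) :
    ‖∑ i ∈ cls z k, (c (ζ i) - c k)‖ ≤ ∑ i ∈ cls z k, disp ζ c z i := by
  refine (norm_sum_le _ _).trans (Finset.sum_le_sum fun i hi => ?_)
  rw [disp, mem_cls.1 hi, norm_sub_rev]

lemma meanOff_empty_sub_mean {k : Fin K} (hz : (size z k : ℝ) ≠ 0) :
    meanOff ζ c w ∅ (cls z k) - c k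
      = (size z k : ℝ)⁻¹ • (∑ i ∈ cls z k, (c (ζ i) - c k) + ∑ i ∈ cls z k, w i) := by
  have h : c k = (size z k : ℝ)⁻¹ • ∑ _i ∈ cls z k, c k := by
    rw [Finset.sum_const, card_cls, ← Nat.cast_smul_eq_nsmul ℝ, smul_smul, inv_mul_cancel₀ hz,
      one_smul]
  conv_lhs => rw [h]
  rw [meanOff, card_cls, Finset.sdiff_empty, ← smul_sub, Finset.sum_sub_distrib]
  congr 1
  abel

lemma GoodNoise.norm_clusterMean_sub_le (N : GoodNoise ζ c σ ε w) (hε : 0 ≤ ε)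
    (hx : ∀ i, ‖x i - (c (ζ i) + w i)‖ ≤ ε) {k : Fin K} (hz : 0 < (size z k : ℝ)) :
    ‖clusterMean x z k - c k‖
      ≤ (size z k : ℝ)⁻¹ * (∑ i ∈ cls z k, disp ζ c z i + σ * √(3 * (d + r) * size z k)) + ε := by
  have e : clusterMean x z k - c k = (meanOff ζ c w ∅ (cls z k) - c k)
      + (clusterMean x z k - meanOff ζ c w ∅ (cls z k)) := by abel
  rw [e]
  refine (norm_add_le _ _).trans (add_le_add ?_ (norm_clusterMean_sub_meanOff_le hε hx z k))
  rw [meanOff_empty_sub_mean hz.ne', norm_smul, norm_inv, RCLike.norm_natCast]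
  refine mul_le_mul_of_nonneg_left ((norm_add_le _ _).trans (add_le_add
    (norm_sum_mean_sub_le z k) ?_)) (by positivity)
  have := N.norm_sum_le (cls z k)
  rwa [card_cls] at this

lemma card_sdiff_mul_le (z : Fin d → Fin K) (k : Fin K) :
    ((cls z k \ cls ζ k).card : ℝ) * minDist c ≤ ∑ i ∈ cls z k, disp ζ c z i := by
  refine le_trans (le_of_eq ?_) (card_filter_ne_mul_le z (cls z k))
  congr 3
  ext i
  simp only [Finset.mem_sdiff, mem_cls, Finset.mem_filter]
  constructor
  · rintro ⟨rfl, h⟩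
    exact ⟨rfl, fun h' => h h'.symm⟩
  · rintro ⟨rfl, h⟩
    exact ⟨rfl, fun h' => h h'.symm⟩

lemma card_sdiff_mul_le' (z : Fin d → Fin K) (k : Fin K) :
    ((cls ζ k \ cls z k).card : ℝ) * minDist c ≤ ∑ i ∈ cls ζ k, disp ζ c z i := by
  refine le_trans (le_of_eq ?_) (card_filter_ne_mul_le z (cls ζ k))
  congr 3
  ext i
  simp only [Finset.mem_sdiff, mem_cls, Finset.mem_filter]
  constructor
  · rintro ⟨rfl, h⟩
    exact ⟨rfl, h⟩
  · rintro ⟨rfl, h⟩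
    exact ⟨rfl, h⟩

lemma size_add_card_sdiff (z : Fin d → Fin K) (k : Fin K) :
    (size z k : ℝ) + (cls ζ k \ cls z k).card = size ζ k + (cls z k \ cls ζ k).card := by
  have h1 := Finset.card_sdiff_add_card_inter (cls ζ k) (cls z k)
  have h2 := Finset.card_sdiff_add_card_inter (cls z k) (cls ζ k)
  rw [Finset.inter_comm] at h2
  rw [card_cls] at h1 h2
  have h3 : size z k + (cls ζ k \ cls z k).card = size ζ k + (cls z k \ cls ζ k).card := by omega
  exact_mod_cast h3

lemma Concentrated.half_size_le (hc : Concentrated ζ c z) (hΔ : 0 < minDist c) (k : Fin K) :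
    (size ζ k : ℝ) / 2 ≤ size z k := by
  have h1 : ((cls ζ k \ cls z k).card : ℝ) ≤ size ζ k / 400 := by
    refine le_of_mul_le_mul_right ?_ hΔ
    refine (card_sdiff_mul_le' z k).trans ((hc k).2.trans (le_of_eq ?_))
    ring
  have h2 := size_add_card_sdiff (ζ := ζ) z k
  have h3 : (0 : ℝ) ≤ (cls z k \ cls ζ k).card := by positivity
  have h4 : (0 : ℝ) ≤ size ζ k := by positivity
  linarith

lemma Concentrated.size_pos (hc : Concentrated ζ c z)
    (H : Regime d K r σ ε (minDist c) (minProp ζ)) (k : Fin K) : 0 < (size z k : ℝ) := by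
  have h1 := hc.half_size_le H.dist_pos k
  have h2 := H.thirteen_le_size k
  linarith

lemma Concentrated.norm_clusterMean_sub_le (hc : Concentrated ζ c z)
    (H : Regime d K r σ ε (minDist c) (minProp ζ)) (N : GoodNoise ζ c σ ε w)
    (hx : ∀ i, ‖x i - (c (ζ i) + w i)‖ ≤ ε) (k : Fin K) :
    ‖clusterMean x z k - c k‖ ≤ 1 / 100 * minDist c := by
  have hz := hc.size_pos H k
  have hΔ := H.dist_pos
  have hσ := H.sigma_pos
  have hε := H.eps_pos
  refine (N.norm_clusterMean_sub_le hε.le hx hz).trans ?_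
  have h1 := hc.half_size_le hΔ k
  have h2 := H.sigma_sq_mul_le k
  have h3 := (hc k).1
  have h4 := H.mul_eps_le
  have hK := H.two_le_K
  set n := (size z k : ℝ)
  have h5 : σ * √(3 * (d + r) * n) ≤ 1 / 1000 * (n * minDist c) := by
    refine abs_le_of_sq_le_sq' ?_ (by positivity) |>.2
    rw [mul_pow, Real.sq_sqrt (by positivity)]
    have h6 : σ ^ 2 * (d + r) ≤ 10⁻¹ ^ 12 * (2 * n * minDist c ^ 2) := by
      have : (size ζ k : ℝ) * minDist c ^ 2 ≤ 2 * n * minDist c ^ 2 := by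
        gcongr
        linarith
      norm_num at *
      linarith
    calc σ ^ 2 * (3 * (d + r) * n) = 3 * n * (σ ^ 2 * (d + r)) := by ring
      _ ≤ 3 * n * (10⁻¹ ^ 12 * (2 * n * minDist c ^ 2)) := by gcongr
      _ = 6 * 10⁻¹ ^ 12 * (n * minDist c) ^ 2 := by ring
      _ ≤ (1 / 1000) ^ 2 * (n * minDist c) ^ 2 := by gcongr; norm_num
      _ = _ := by ring
  have h7 : n⁻¹ * (∑ i ∈ cls z k, disp ζ c z i + σ * √(3 * (d + r) * n)) ≤ 6 / 1000 * minDist c := by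
    rw [inv_mul_le_iff₀ hz]
    nlinarith
  nlinarith

lemma sum_sub_smul_sum_eq {ι E : Type*} [DecidableEq ι] [AddCommGroup E] [Module ℝ E] (w : ι → E)
    (S T : Finset ι) (t : ℝ) :
    ∑ i ∈ S, w i - t • ∑ i ∈ T, w i
      = ∑ i ∈ S \ T, w i - ∑ i ∈ T \ S, w i + (1 - t) • ∑ i ∈ T, w i := by
  have e1 := Finset.sum_sdiff (f := w) (Finset.inter_subset_left : S ∩ T ⊆ S)
  have e2 := Finset.sum_sdiff (f := w) (Finset.inter_subset_left : T ∩ S ⊆ T)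
  rw [Finset.sdiff_inter_self_left] at e1 e2
  rw [Finset.inter_comm T S] at e2
  rw [sub_smul, one_smul]
  generalize t • ∑ i ∈ T, w i = u
  rw [← e1, ← e2]
  abel

lemma mul_sq_le_of_le {n Δ M M' A R : ℝ} (hn : 0 < n) (hΔ : 0 ≤ Δ) (hM0 : 0 ≤ M) (hM'0 : 0 ≤ M')
    (hR0 : 0 ≤ R) (hR : R ≤ 2 / n * (M + 3 * A))
    (hA2 : A ^ 2 ≤ 3 * 10⁻¹ ^ 12 * n * Δ * (M + M')) (hM2 : M ^ 2 ≤ n * Δ * (M + M') / 400) :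
    n * R ^ 2 ≤ Δ * (M + M') := by
  calc _ ≤ n * (2 / n * (M + 3 * A)) ^ 2 := by gcongr
    _ = 4 / n * (M + 3 * A) ^ 2 := by field_simp; ring
    _ ≤ 4 / n * (2 * (M ^ 2 + 9 * A ^ 2)) := by
        gcongr
        nlinarith [sq_nonneg (M - 3 * A)]
    _ ≤ 4 / n * (2 * (n * Δ * (M + M') / 400 + 9 * (3 * 10⁻¹ ^ 12 * n * Δ * (M + M')))) := by gcongr
    _ = (8 / 400 + 216 * 10⁻¹ ^ 12) * (Δ * (M + M')) := by field_simp; ring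
    _ ≤ 1 * (Δ * (M + M')) := by
        gcongr
        norm_num
    _ = _ := one_mul _

/-- The part of a center of concentrated labels that is neither the true mean, nor the average of
the noise over the true cluster, nor an average of the estimation errors, is controlled by the
weighted number of misclassified points. -/
lemma Concentrated.size_mul_norm_sq_le (hc : Concentrated ζ c z)
    (H : Regime d K r σ ε (minDist c) (minProp ζ)) (N : GoodNoise ζ c σ ε w) (k : Fin K) :
    size ζ k * ‖meanOff ζ c w ∅ (cls z k) - c k - (size ζ k : ℝ)⁻¹ • ∑ i ∈ cls ζ k, w i‖ ^ 2
      ≤ minDist c * (∑ i ∈ cls z k, disp ζ c z i + ∑ i ∈ cls ζ k, disp ζ c z i) := by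
  have hz := hc.size_pos H k
  have hΔ := H.dist_pos
  have hσ := H.sigma_pos
  have h1 := hc.half_size_le hΔ k
  have h2 := H.sigma_sq_mul_le k
  have hn : 0 < (size ζ k : ℝ) := by linarith [H.thirteen_le_size k]
  have hM := (hc k).1
  have hM' := (hc k).2
  have ha := card_sdiff_mul_le (ζ := ζ) (c := c) z k
  have hb := card_sdiff_mul_le' (ζ := ζ) (c := c) z k
  have hab := size_add_card_sdiff (ζ := ζ) z k
  have hWa := N.norm_sum_le (cls z k \ cls ζ k)
  have hWb := N.norm_sum_le (cls ζ k \ cls z k)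
  have hWT := N.norm_sum_le (cls ζ k)
  rw [card_cls] at hWT
  have hM0 : 0 ≤ ∑ i ∈ cls z k, disp ζ c z i := Finset.sum_nonneg fun i _ => disp_nonneg z i
  have hS := norm_sum_mean_sub_le (ζ := ζ) (c := c) z k
  rw [meanOff_empty_sub_mean hz.ne']
  set S := cls z k
  set T := cls ζ k
  set M := ∑ i ∈ S, disp ζ c z i
  set M' := ∑ i ∈ T, disp ζ c z i
  set n := (size ζ k : ℝ)
  set n' := (size z k : ℝ)
  set a := ((S \ T).card : ℝ)
  set b := ((T \ S).card : ℝ)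
  set V := ∑ i ∈ S, (c (ζ i) - c k)
  have ha0 : 0 ≤ a := by positivity
  have hb0 : 0 ≤ b := by positivity
  have hae : a ≤ n / 400 := by
    refine le_of_mul_le_mul_right (ha.trans (hM.trans (le_of_eq ?_))) hΔ
    ring
  have hbe : b ≤ n / 400 := by
    refine le_of_mul_le_mul_right (hb.trans (hM'.trans (le_of_eq ?_))) hΔ
    ring
  -- Worst-case bound for the noise of `a + b` points, the number of points by which `S` and `T`
  -- differ.
  set A := σ * √(3 * (d + r) * (a + b)) with hA
  have hA0 : 0 ≤ A := by positivity
  have hsplit := sum_sub_smul_sum_eq w S T (n' / n)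
  have hWT' : ‖(1 - n' / n) • ∑ i ∈ T, w i‖ ≤ A := by
    rw [norm_smul, Real.norm_eq_abs]
    have e : |1 - n' / n| = |b - a| / n := by
      rw [← abs_of_pos hn, ← abs_div, abs_of_pos hn]
      congr 1
      field_simp
      linarith
    rw [e]
    have h3 : |b - a| ≤ a + b := abs_le.2 ⟨by linarith, by linarith⟩
    refine (mul_le_mul_of_nonneg_left hWT (by positivity)).trans ?_
    refine abs_le_of_sq_le_sq' ?_ hA0 |>.2
    rw [hA, mul_pow, mul_pow, mul_pow, Real.sq_sqrt (by positivity), Real.sq_sqrt (by positivity),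
      div_pow, sq_abs]
    have h4 : (b - a) ^ 2 ≤ (a + b) * n := by nlinarith
    calc (b - a) ^ 2 / n ^ 2 * (σ ^ 2 * (3 * (d + r) * n))
        = (b - a) ^ 2 * (3 * σ ^ 2 * (d + r) / n) := by field_simp
      _ ≤ ((a + b) * n) * (3 * σ ^ 2 * (d + r) / n) := by gcongr
      _ = _ := by field_simp
  have hnoise : ‖∑ i ∈ S, w i - (n' / n) • ∑ i ∈ T, w i‖ ≤ 3 * A := by
    rw [hsplit]
    have h3 : ‖∑ i ∈ S \ T, w i‖ ≤ A := hWa.trans (by rw [hA]; gcongr; linarith)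
    have h4 : ‖∑ i ∈ T \ S, w i‖ ≤ A := hWb.trans (by rw [hA]; gcongr; linarith)
    have h5 := norm_add_le (∑ i ∈ S \ T, w i - ∑ i ∈ T \ S, w i) ((1 - n' / n) • ∑ i ∈ T, w i)
    have h6 := norm_sub_le (∑ i ∈ S \ T, w i) (∑ i ∈ T \ S, w i)
    linarith
  have hR : n'⁻¹ • (V + ∑ i ∈ S, w i) - n⁻¹ • ∑ i ∈ T, w i
      = n'⁻¹ • (V + (∑ i ∈ S, w i - (n' / n) • ∑ i ∈ T, w i)) := by
    rw [smul_add, smul_add, smul_sub, smul_smul]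
    have : n'⁻¹ * (n' / n) = n⁻¹ := by field_simp
    rw [this]
    abel
  have hRn : ‖n'⁻¹ • (V + ∑ i ∈ S, w i) - n⁻¹ • ∑ i ∈ T, w i‖ ≤ 2 / n * (M + 3 * A) := by
    rw [hR, norm_smul, norm_inv, Real.norm_of_nonneg hz.le]
    refine mul_le_mul ?_ ((norm_add_le _ _).trans (add_le_add hS hnoise)) (norm_nonneg _)
      (by positivity)
    rw [inv_eq_one_div, div_le_div_iff₀ hz hn]
    linarith
  have hA2 : A ^ 2 ≤ 3 * 10⁻¹ ^ 12 * n * minDist c * (M + M') := by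
    rw [hA, mul_pow, Real.sq_sqrt (by positivity)]
    have h3 : σ ^ 2 * (d + r) ≤ 10⁻¹ ^ 12 * (n * minDist c ^ 2) := by
      norm_num at *
      linarith
    calc σ ^ 2 * (3 * (d + r) * (a + b)) = 3 * (a + b) * (σ ^ 2 * (d + r)) := by ring
      _ ≤ 3 * (a + b) * (10⁻¹ ^ 12 * (n * minDist c ^ 2)) := by gcongr
      _ = 3 * 10⁻¹ ^ 12 * n * minDist c * (a * minDist c + b * minDist c) := by ring
      _ ≤ _ := by gcongr
  have hM2 : M ^ 2 ≤ n * minDist c * (M + M') / 400 := by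
    have hM'0 : 0 ≤ M' := Finset.sum_nonneg fun i _ => disp_nonneg z i
    have : M * M ≤ M * (minDist c / 400 * n) := by gcongr
    have h4 : 0 ≤ n * minDist c * M' := by positivity
    nlinarith
  have hM'0 : 0 ≤ M' := Finset.sum_nonneg fun i _ => disp_nonneg z i
  exact mul_sq_le_of_le hn hΔ.le hM0 hM'0 (norm_nonneg _) hRn hA2 hM2

end Centers

/-! ### Contraction of the weighted number of misclassified points -/

section Contraction

variable {d K r : ℕ} {σ ε : ℝ} {ζ : Fin d → Fin K} {c : Fin K → EuclideanSpace ℝ (Fin r)}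
  {w x : Fin d → EuclideanSpace ℝ (Fin r)} {z₀ z : Fin d → Fin K}

/-- The part of the center of the cluster `k` of the labels `z` that depends on misclassified
points. -/
noncomputable def centerRest (ζ : Fin d → Fin K) (c : Fin K → EuclideanSpace ℝ (Fin r))
    (w : Fin d → EuclideanSpace ℝ (Fin r)) (z : Fin d → Fin K) (k : Fin K) :
    EuclideanSpace ℝ (Fin r) :=
  meanOff ζ c w ∅ (cls z k) - c k - (size ζ k : ℝ)⁻¹ • ∑ i ∈ cls ζ k, w i

/-- Why a point moves: its own noise is aligned with the line between the means, or it is large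
compared with `Δ² / ε`, or it is aligned with the data-dependent parts of the centers. -/
lemma aligned_or_large_or_rest (H : Regime d K r σ ε (minDist c) (minProp ζ))
    (hx : ∀ i, ‖x i - (c (ζ i) + w i)‖ ≤ ε)
    (hcen : ∀ k, ‖clusterMean x z₀ k - c k‖ ≤ 1 / 100 * minDist c) {i : Fin d} {h : Fin K}
    (hh : h ≠ ζ i) (hle : ‖x i - clusterMean x z₀ h‖ ≤ ‖x i - clusterMean x z₀ (ζ i)‖) :
    0.45 * ‖c h - c (ζ i)‖ ^ 2 ≤ inner ℝ (w i) ((c h - c (ζ i)) + noiseGap ζ w i h) ∨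
      0.005 * ‖c h - c (ζ i)‖ ^ 2 ≤ ε * ‖w i‖ ∨
      0.02 * ‖c h - c (ζ i)‖ ^ 2
        ≤ inner ℝ (w i) (centerRest ζ c w z₀ h - centerRest ζ c w z₀ (ζ i)) := by
  have hΔ := H.dist_pos
  have hε := H.eps_pos
  have hK := H.two_le_K
  have h1 := inner_ge_of_closer (minDist_le c hh) hΔ (by norm_num) (by norm_num) (hcen (ζ i))
    (hcen h) (hx i) hle
  set D := ‖c h - c (ζ i)‖
  have h2 : ε / minDist c ≤ 1 / 1000 := by
    rw [div_le_div_iff₀ hΔ (by norm_num)]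
    have := H.mul_eps_le
    nlinarith
  have h3 : 0.48 * D ^ 2
      ≤ inner ℝ (w i) (clusterMean x z₀ h - clusterMean x z₀ (ζ i)) := by
    refine le_trans ?_ h1
    gcongr
    norm_num at *
    linarith
  set ηh := clusterMean x z₀ h - meanOff ζ c w ∅ (cls z₀ h) with hηh
  set ηg := clusterMean x z₀ (ζ i) - meanOff ζ c w ∅ (cls z₀ (ζ i)) with hηg
  have e : clusterMean x z₀ h - clusterMean x z₀ (ζ i)
      = ((c h - c (ζ i)) + noiseGap ζ w i h) - (size ζ (ζ i) : ℝ)⁻¹ • w i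
        + (centerRest ζ c w z₀ h - centerRest ζ c w z₀ (ζ i)) + (ηh - ηg) := by
    rw [noiseGap, centerRest, centerRest, hηh, hηg,
      ← Finset.add_sum_erase (cls ζ (ζ i)) w (mem_cls.2 rfl), smul_add]
    abel
  have h4 : inner ℝ (w i) (ηh - ηg) ≤ 2 * (ε * ‖w i‖) := by
    have h5 : ‖ηh - ηg‖ ≤ 2 * ε := (norm_sub_le _ _).trans (by
      have := norm_clusterMean_sub_meanOff_le hε.le hx z₀ h
      have := norm_clusterMean_sub_meanOff_le hε.le hx z₀ (ζ i)
      linarith)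
    calc _ ≤ ‖w i‖ * ‖ηh - ηg‖ := real_inner_le_norm _ _
      _ ≤ ‖w i‖ * (2 * ε) := by gcongr
      _ = _ := by ring
  -- The contribution of a point to its own center attracts the point, so it can be dropped.
  have h6 : 0 ≤ inner ℝ (w i) ((size ζ (ζ i) : ℝ)⁻¹ • w i) := by
    rw [inner_smul_right]
    have := real_inner_self_nonneg (x := w i)
    positivity
  rw [e, inner_add_right, inner_add_right, inner_sub_right] at h3
  by_contra! hcon
  obtain ⟨a1, a2, a3⟩ := hcon
  norm_num at *
  linarith

lemma sum_eq_sum_sum_inter (z : Fin d → Fin K) (f : Fin d → ℝ) :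
    ∑ i, f i = ∑ g, ∑ h, ∑ i ∈ cls ζ g ∩ cls z h, f i := by
  rw [← sum_cls ζ]
  refine Finset.sum_congr rfl fun g _ => ?_
  rw [← Finset.sum_fiberwise (cls ζ g) z]
  refine Finset.sum_congr rfl fun h _ => Finset.sum_congr ?_ fun _ _ => rfl
  ext i
  simp [mem_cls]

/-- The weighted number of points moved because of the data-dependent parts of the centers. -/
lemma sum_disp_rest_le (H : Regime d K r σ ε (minDist c) (minProp ζ)) (N : GoodNoise ζ c σ ε w)
    (hc : Concentrated ζ c z₀) (z : Fin d → Fin K) :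
    ∑ i, (if 0.02 * ‖c (z i) - c (ζ i)‖ ^ 2
        ≤ inner ℝ (w i) (centerRest ζ c w z₀ (z i) - centerRest ζ c w z₀ (ζ i))
      then disp ζ c z i else 0) ≤ 1 / 4 * ∑ i, disp ζ c z₀ i := by
  have hΔ := H.dist_pos
  have hd := H.d_pos
  have hα := H.prop_pos
  have hσ := H.sigma_pos
  set R := centerRest ζ c w z₀ with hR
  set y : Fin K → ℝ := fun k => ∑ i ∈ cls z₀ k, disp ζ c z₀ i + ∑ i ∈ cls ζ k, disp ζ c z₀ i
    with hy
  have hy0 : ∀ k, 0 ≤ y k := fun k => add_nonneg (Finset.sum_nonneg fun i _ => disp_nonneg z₀ i)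
    (Finset.sum_nonneg fun i _ => disp_nonneg z₀ i)
  have hysum : ∑ k, y k = 2 * ∑ i, disp ζ c z₀ i := by
    rw [hy, Finset.sum_add_distrib, sum_cls, sum_cls]
    ring
  set n : Fin K → ℝ := fun k => (size ζ k : ℝ) with hn_def
  have hn : ∀ k, 0 < n k := fun k => by
    have := H.thirteen_le_size k
    simp only [hn_def]
    linarith
  have hRy : ∀ k, ‖R k‖ ^ 2 ≤ minDist c * (y k / n k) := by
    intro k
    rw [← mul_div_assoc, le_div_iff₀ (hn k), mul_comm]
    exact hc.size_mul_norm_sq_le H N k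
  -- For the points moved from `g` to `h`, the subset sum bound counts those aligned with the vector
  -- `R h - R g`, whose square norm is linear in the weighted number of misclassified points.
  have hpair : ∀ g h, ∑ i ∈ cls ζ g ∩ cls z h, (if 0.02 * ‖c (z i) - c (ζ i)‖ ^ 2
        ≤ inner ℝ (w i) (R (z i) - R (ζ i)) then disp ζ c z i else 0)
      ≤ 15000 * σ ^ 2 / minDist c ^ 2 * ((n g + r) * (y h / n h) + (n g + r) * (y g / n g)) := by
    intro g h
    have hyh := div_nonneg (hy0 h) (hn h).le
    have hyg := div_nonneg (hy0 g) (hn g).le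
    have hng := (hn g).le
    rcases eq_or_ne g h with rfl | hgh
    · refine (Finset.sum_nonpos fun i hi => ?_).trans (by positivity)
      rw [Finset.mem_inter, mem_cls, mem_cls] at hi
      rw [disp, hi.1, hi.2]
      simp
    set D := ‖c h - c g‖ with hD_def
    have hΔD : minDist c ≤ D := minDist_le c hgh.symm
    have hD : 0 < D := hΔ.trans_le hΔD
    rw [← Finset.sum_filter]
    set C := (cls ζ g ∩ cls z h).filter fun i => 0.02 * ‖c (z i) - c (ζ i)‖ ^ 2
        ≤ inner ℝ (w i) (R (z i) - R (ζ i)) with hC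
    have hmem : ∀ i ∈ C, ζ i = g ∧ z i = h ∧ 0.02 * D ^ 2 ≤ inner ℝ (w i) (R h - R g) := by
      intro i hi
      rw [hC, Finset.mem_filter, Finset.mem_inter, mem_cls, mem_cls] at hi
      obtain ⟨⟨h1, h2⟩, h3⟩ := hi
      rw [h1, h2] at h3
      exact ⟨h1, h2, h3⟩
    have e : ∑ i ∈ C, disp ζ c z i = C.card * D := by
      rw [← nsmul_eq_mul, ← Finset.sum_const]
      refine Finset.sum_congr rfl fun i hi => ?_
      rw [disp, (hmem i hi).1, (hmem i hi).2.1]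
    rw [e]
    have h1 := N.card_mul_sq_le (g := g) (S := C) (fun i hi => mem_cls.2 (hmem i hi).1)
      (v := R h - R g) (t := 0.02 * D ^ 2) (by positivity) (fun i hi => (hmem i hi).2.2)
    have h2 : ‖R h - R g‖ ^ 2 ≤ 2 * (minDist c * (y h / n h) + minDist c * (y g / n g)) := by
      have h3 := pow_le_pow_left₀ (norm_nonneg _) (norm_sub_le (R h) (R g)) 2
      have h4 := hRy h
      have h5 := hRy g
      nlinarith [sq_nonneg (‖R h‖ - ‖R g‖)]
    have h3 : (C.card : ℝ) * D * minDist c ^ 3 ≤ C.card * D ^ 4 := by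
      have : minDist c ^ 3 ≤ D ^ 3 := pow_le_pow_left₀ hΔ.le hΔD 3
      calc _ ≤ (C.card : ℝ) * D * D ^ 3 := by gcongr
        _ = _ := by ring
    have h4 : (C.card : ℝ) * D ^ 4 ≤ 15000 * (n g + r) * σ ^ 2
        * (minDist c * (y h / n h) + minDist c * (y g / n g)) := by
      have h5 : 3 * (n g + r) * σ ^ 2 * ‖R h - R g‖ ^ 2 ≤ 3 * (n g + r) * σ ^ 2 *
          (2 * (minDist c * (y h / n h) + minDist c * (y g / n g))) := by gcongr
      have h6 := h1.trans h5
      norm_num at h6 ⊢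
      nlinarith
    refine le_of_mul_le_mul_right ?_ (pow_pos hΔ 3)
    refine (h3.trans h4).trans (le_of_eq ?_)
    field_simp
  have hαd : 0 < minProp ζ * d := by positivity
  have hsum1 : ∑ g, ∑ h, (n g + r) * (y h / n h)
      ≤ (d + K * r) / (minProp ζ * d) * ∑ k, y k := by
    have e1 : ∑ g, ∑ h, (n g + r) * (y h / n h) = (d + K * r) * ∑ h, y h / n h := by
      simp_rw [← Finset.mul_sum]
      rw [← Finset.sum_mul, Finset.sum_add_distrib, sum_size]
      simp
    rw [e1, div_mul_eq_mul_div, mul_div_assoc, Finset.sum_div]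
    refine mul_le_mul_of_nonneg_left (Finset.sum_le_sum fun k _ => ?_) (by positivity)
    exact div_le_div_of_nonneg_left (hy0 k) hαd (H.mul_d_le_size k)
  have hsum2 : ∑ g, ∑ _h : Fin K, (n g + r) * (y g / n g)
      ≤ (d + K * r) / (minProp ζ * d) * ∑ k, y k := by
    rw [Finset.mul_sum]
    refine Finset.sum_le_sum fun g _ => ?_
    have h1 := H.mul_size_add_le g
    rw [Finset.sum_const, Finset.card_univ, Fintype.card_fin, nsmul_eq_mul, div_mul_eq_mul_div,
      ← mul_assoc, ← mul_div_assoc, div_le_div_iff₀ (hn g) hαd]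
    calc _ = (K * (n g + r) * (minProp ζ * d)) * y g := by ring
      _ ≤ (n g * (d + K * r)) * y g := mul_le_mul_of_nonneg_right h1 (hy0 g)
      _ = _ := by ring
  have hnoise : σ ^ 2 / minDist c ^ 2 * ((d + K * r) / (minProp ζ * d)) ≤ 10⁻¹ ^ 12 := by
    rw [div_mul_div_comm, div_le_iff₀ (by positivity)]
    have h1 := H.noise_le
    have hK := H.two_le_K
    have h2 : 10 ^ 12 * 1 * σ ^ 2 * (d + K * r) ≤ 10 ^ 12 * K * σ ^ 2 * (d + K * r) := by
      gcongr
      linarith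
    norm_num at *
    linarith
  have hΦ : 0 ≤ ∑ i, disp ζ c z₀ i := Finset.sum_nonneg fun i _ => disp_nonneg z₀ i
  rw [sum_eq_sum_sum_inter (ζ := ζ) z]
  calc _ ≤ ∑ g, ∑ h, 15000 * σ ^ 2 / minDist c ^ 2
        * ((n g + r) * (y h / n h) + (n g + r) * (y g / n g)) :=
        Finset.sum_le_sum fun g _ => Finset.sum_le_sum fun h _ => hpair g h
    _ = 15000 * σ ^ 2 / minDist c ^ 2 * (∑ g, ∑ h, (n g + r) * (y h / n h)
          + ∑ g, ∑ _h : Fin K, (n g + r) * (y g / n g)) := by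
        rw [← Finset.sum_add_distrib, Finset.mul_sum]
        refine Finset.sum_congr rfl fun g _ => ?_
        rw [← Finset.sum_add_distrib, Finset.mul_sum]
    _ ≤ 15000 * σ ^ 2 / minDist c ^ 2 * ((d + K * r) / (minProp ζ * d) * ∑ k, y k
          + (d + K * r) / (minProp ζ * d) * ∑ k, y k) := by gcongr
    _ = 60000 * (σ ^ 2 / minDist c ^ 2 * ((d + K * r) / (minProp ζ * d)))
          * ∑ i, disp ζ c z₀ i := by
        rw [hysum]; ring
    _ ≤ 60000 * 10⁻¹ ^ 12 * ∑ i, disp ζ c z₀ i := by gcongr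
    _ ≤ _ := by
        gcongr
        norm_num

/-- One iteration reduces the weighted number of misclassified points by a constant factor, up to
the points whose own noise is too large. -/
theorem sum_disp_le (H : Regime d K r σ ε (minDist c) (minProp ζ)) (N : GoodNoise ζ c σ ε w)
    (hx : ∀ i, ‖x i - (c (ζ i) + w i)‖ ≤ ε) (hc : Concentrated ζ c z₀)
    (hz : ∀ i k, ‖x i - clusterMean x z₀ (z i)‖ ≤ ‖x i - clusterMean x z₀ k‖) :
    ∑ i, disp ζ c z i ≤ minDist c * (d / 8 * (Real.exp (-(minDist c ^ 2 / (16 * σ ^ 2)))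
        + Real.exp (-(minDist c ^ 2 / (8 * ε * σ))))) + 1 / 4 * ∑ i, disp ζ c z₀ i := by
  have hΔ := H.dist_pos
  have hcen := hc.norm_clusterMean_sub_le H N hx
  set a : Fin d → Fin K → ℝ := fun i h => if 0.45 * ‖c h - c (ζ i)‖ ^ 2
      ≤ inner ℝ (w i) ((c h - c (ζ i)) + noiseGap ζ w i h)
      then ‖c h - c (ζ i)‖ / minDist c else 0 with ha
  set b : Fin d → Fin K → ℝ := fun i h => if 0.005 * ‖c h - c (ζ i)‖ ^ 2 ≤ ε * ‖w i‖
      then ‖c h - c (ζ i)‖ / minDist c else 0 with hb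
  set e : Fin d → ℝ := fun i => if 0.02 * ‖c (z i) - c (ζ i)‖ ^ 2
        ≤ inner ℝ (w i) (centerRest ζ c w z₀ (z i) - centerRest ζ c w z₀ (ζ i))
      then disp ζ c z i else 0 with he
  have ha0 : ∀ i h, 0 ≤ a i h := fun i h => by simp only [ha]; split_ifs <;> positivity
  have hb0 : ∀ i h, 0 ≤ b i h := fun i h => by simp only [hb]; split_ifs <;> positivity
  have he0 : ∀ i, 0 ≤ e i := fun i => by
    simp only [he]; split_ifs; exacts [disp_nonneg z i, le_rfl]
  have key : ∀ i, disp ζ c z i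
      ≤ minDist c * (∑ h, a i h) + minDist c * (∑ h, b i h) + e i := by
    intro i
    have h1 : a i (z i) ≤ ∑ h, a i h :=
      Finset.single_le_sum (fun h _ => ha0 i h) (Finset.mem_univ _)
    have h2 : b i (z i) ≤ ∑ h, b i h :=
      Finset.single_le_sum (fun h _ => hb0 i h) (Finset.mem_univ _)
    have h1' := mul_le_mul_of_nonneg_left h1 hΔ.le
    have h2' := mul_le_mul_of_nonneg_left h2 hΔ.le
    have h3 := mul_nonneg hΔ.le (ha0 i (z i))
    have h4 := mul_nonneg hΔ.le (hb0 i (z i))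
    have h5 := he0 i
    have hdiv : minDist c * (‖c (z i) - c (ζ i)‖ / minDist c) = disp ζ c z i := by
      rw [disp]
      field_simp
    by_cases hzi : z i = ζ i
    · have : disp ζ c z i = 0 := by rw [disp, hzi]; simp
      linarith
    rcases aligned_or_large_or_rest H hx hcen hzi (hz i (ζ i)) with h | h | h
    · have : a i (z i) = ‖c (z i) - c (ζ i)‖ / minDist c := by simp only [ha]; rw [if_pos h]
      rw [this, hdiv] at h1'
      linarith
    · have : b i (z i) = ‖c (z i) - c (ζ i)‖ / minDist c := by simp only [hb]; rw [if_pos h]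
      rw [this, hdiv] at h2'
      linarith
    · have : e i = disp ζ c z i := by simp only [he]; rw [if_pos h]
      linarith
  calc ∑ i, disp ζ c z i
      ≤ ∑ i, (minDist c * (∑ h, a i h) + minDist c * (∑ h, b i h) + e i) :=
        Finset.sum_le_sum fun i _ => key i
    _ = minDist c * (∑ i, ∑ h, a i h) + minDist c * (∑ i, ∑ h, b i h) + ∑ i, e i := by
        rw [Finset.sum_add_distrib, Finset.sum_add_distrib, Finset.mul_sum, Finset.mul_sum]
    _ ≤ minDist c * (d / 8 * Real.exp (-(minDist c ^ 2 / (16 * σ ^ 2))))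
        + minDist c * (d / 8 * Real.exp (-(minDist c ^ 2 / (8 * ε * σ))))
        + 1 / 4 * ∑ i, disp ζ c z₀ i := by
        have h1 := N.aligned_le
        have h2 := N.large_le
        have h3 := sum_disp_rest_le H N hc z
        gcongr
    _ = _ := by ring

end Contraction

/-! ### Good enough initializations -/

section Initialization

variable {d K r : ℕ} {σ ε : ℝ} {ζ : Fin d → Fin K} {c : Fin K → EuclideanSpace ℝ (Fin r)}
  {w x : Fin d → EuclideanSpace ℝ (Fin r)} {z z' : Fin d → Fin K}

lemma le_maxDist (c : Fin K → EuclideanSpace ℝ (Fin r)) {g h : Fin K} (hgh : g ≠ h) :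
    ‖c g - c h‖ ≤ maxDist c :=
  le_ciSup (Set.finite_range fun q : {q : Fin K × Fin K // q.1 ≠ q.2} =>
    ‖c q.1.1 - c q.1.2‖).bddAbove ⟨(g, h), hgh⟩

lemma sum_sizeBoth_left (ζ z : Fin d → Fin K) (k : Fin K) :
    ∑ l ∈ Finset.univ.filter (fun l => l ≠ k), (sizeBoth ζ z l k : ℝ)
      = ((cls z k).filter fun i => ζ i ≠ k).card := by
  rw [Finset.card_eq_sum_card_fiberwise (f := ζ) (t := Finset.univ.filter fun l => l ≠ k)]
  · push_cast
    refine Finset.sum_congr rfl fun l hl => ?_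
    rw [sizeBoth]
    congr 2
    ext i
    simp only [Finset.mem_filter, Finset.mem_univ, true_and, mem_cls] at hl ⊢
    constructor
    · rintro ⟨rfl, h⟩
      exact ⟨⟨h, hl⟩, rfl⟩
    · rintro ⟨⟨h, _⟩, rfl⟩
      exact ⟨rfl, h⟩
  · intro i hi
    simpa using (Finset.mem_filter.1 hi).2

lemma sum_sizeBoth_right (ζ z : Fin d → Fin K) (k : Fin K) :
    ∑ l ∈ Finset.univ.filter (fun l => l ≠ k), (sizeBoth ζ z k l : ℝ)
      = (cls ζ k \ cls z k).card := by
  rw [Finset.card_eq_sum_card_fiberwise (f := z) (t := Finset.univ.filter fun l => l ≠ k)]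
  · push_cast
    refine Finset.sum_congr rfl fun l hl => ?_
    rw [sizeBoth]
    congr 2
    ext i
    simp only [Finset.mem_filter, Finset.mem_univ, true_and, mem_cls, Finset.mem_sdiff] at hl ⊢
    constructor
    · rintro ⟨h, rfl⟩
      exact ⟨⟨h, hl⟩, rfl⟩
    · rintro ⟨⟨h, _⟩, rfl⟩
      exact ⟨h, rfl⟩
  · intro i hi
    have := (Finset.mem_sdiff.1 hi).2
    rw [mem_cls] at this
    simpa using this

lemma card_filter_le_clusterMisRate (ζ z : Fin d → Fin K) (k : Fin K) :
    (1 / (size z k : ℝ)) * ((cls z k).filter fun i => ζ i ≠ k).card ≤ clusterMisRate ζ z := by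
  rw [← sum_sizeBoth_left]
  exact (le_max_left _ _).trans (le_ciSup (f := fun k : Fin K => max
    ((1 / (size z k : ℝ)) * ∑ l ∈ Finset.univ.filter (fun l => l ≠ k), (sizeBoth ζ z l k : ℝ))
    ((1 / (size ζ k : ℝ)) * ∑ l ∈ Finset.univ.filter (fun l => l ≠ k), (sizeBoth ζ z k l : ℝ)))
    (Set.finite_range _).bddAbove k)

lemma card_sdiff_le_clusterMisRate (ζ z : Fin d → Fin K) (k : Fin K) :
    (1 / (size ζ k : ℝ)) * (cls ζ k \ cls z k).card ≤ clusterMisRate ζ z := by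
  rw [← sum_sizeBoth_right]
  exact (le_max_right _ _).trans (le_ciSup (f := fun k : Fin K => max
    ((1 / (size z k : ℝ)) * ∑ l ∈ Finset.univ.filter (fun l => l ≠ k), (sizeBoth ζ z l k : ℝ))
    ((1 / (size ζ k : ℝ)) * ∑ l ∈ Finset.univ.filter (fun l => l ≠ k), (sizeBoth ζ z k l : ℝ)))
    (Set.finite_range _).bddAbove k)

lemma sum_disp_le_maxDist_mul (z : Fin d → Fin K) (k : Fin K) :
    ∑ i ∈ cls z k, disp ζ c z i ≤ maxDist c * ((cls z k).filter fun i => ζ i ≠ k).card := by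
  have h : ∑ i ∈ cls z k, disp ζ c z i = ∑ i ∈ (cls z k).filter (fun i => ζ i ≠ k), disp ζ c z i := by
    rw [Finset.sum_filter]
    refine Finset.sum_congr rfl fun i hi => ?_
    rw [disp, mem_cls.1 hi]
    split_ifs with h
    · rfl
    · rw [not_not] at h; simp [h]
  rw [h, mul_comm, ← nsmul_eq_mul, ← Finset.sum_const]
  refine Finset.sum_le_sum fun i hi => ?_
  rw [Finset.mem_filter, mem_cls] at hi
  rw [disp, hi.1]
  exact le_maxDist c hi.2.symm

variable (H : Regime d K r σ ε (minDist c) (minProp ζ))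

include H

/-- The inverse signal-to-noise ratio `1 / ρ_σ` is the square root of `σ² (d + K r) / (α d Δ²)`. -/
lemma inv_snrNoise_sq_mul :
    (1 / snrNoise d K r (minDist c) σ (minProp ζ)) ^ 2 * (minProp ζ * d * minDist c ^ 2)
      = σ ^ 2 * (d + K * r) := by
  have hΔ := H.dist_pos
  have hσ := H.sigma_pos
  have hα := H.prop_pos
  have hd := H.d_pos
  rw [snrNoise, div_pow, one_pow, mul_pow, Real.sq_sqrt (by positivity)]
  field_simp

lemma snrNoise_pos : 0 < snrNoise d K r (minDist c) σ (minProp ζ) := by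
  have hΔ := H.dist_pos
  have hσ := H.sigma_pos
  have hα := H.prop_pos
  have hd := H.d_pos
  unfold snrNoise
  positivity

lemma sqrt_mul_inv_snrError :
    √(minProp ζ) * (1 / snrError (minDist c) ε (minProp ζ)) = ε / minDist c := by
  have hΔ := H.dist_pos
  have hα := H.prop_pos
  have hε := H.eps_pos
  have : 0 < √(minProp ζ) := Real.sqrt_pos.2 hα
  rw [snrError]
  generalize √(minProp ζ) = s at *
  field_simp

lemma tail_margin_sq :
    √(minProp ζ) * minDist c * (1 / minProp ζ ^ (1 / 4 : ℝ) * √(σ / minDist c)) ^ 2 = σ := by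
  have hΔ := H.dist_pos
  have hσ := H.sigma_pos
  have hα := H.prop_pos
  have e : (minProp ζ ^ (1 / 4 : ℝ)) ^ 2 = √(minProp ζ) := by
    rw [← Real.rpow_natCast, ← Real.rpow_mul hα.le, Real.sqrt_eq_rpow]
    norm_num
  have : 0 < √(minProp ζ) := Real.sqrt_pos.2 hα
  rw [mul_pow, Real.sq_sqrt (by positivity), div_pow, one_pow, e]
  generalize √(minProp ζ) = s at *
  field_simp

/-- The condition on the initial labels implies the condition on the initial centers. -/
lemma norm_center_sub_le_of_clusterMisRate_le (N : GoodNoise ζ c σ ε w)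
    (hx : ∀ i, ‖x i - (c (ζ i) + w i)‖ ≤ ε) {a b t : ℝ}
    (ha : a = 1 / snrNoise d K r (minDist c) σ (minProp ζ))
    (hb : b = 1 / snrError (minDist c) ε (minProp ζ)) (ht : 0 ≤ t)
    (hz : clusterMisRate ζ z ≤ (1 / 2 - (√6 + 1) * a - (2.1 * √(minProp ζ) + 1) * b - t)
      * (minDist c / maxDist c)) (k : Fin K) :
    ‖clusterMean x z k - c k‖ / minDist c
      ≤ 1 / 2 - a - (1.1 * √(minProp ζ) + 1) * b - t := by
  have hΔ := H.dist_pos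
  have hσ := H.sigma_pos
  have hα := H.prop_pos
  have hε := H.eps_pos
  have hd := H.d_pos
  have ha2 := inv_snrNoise_sq_mul H
  have hb2 := sqrt_mul_inv_snrError H
  have ha0 : 0 < a := by rw [ha]; exact one_div_pos.2 (snrNoise_pos H)
  have hb0 : 0 < b := by
    rw [hb]
    exact one_div_pos.2 (by unfold snrError; positivity)
  rw [← ha] at ha2
  rw [← hb] at hb2
  set F := 1 / 2 - (√6 + 1) * a - (2.1 * √(minProp ζ) + 1) * b - t with hF
  obtain ⟨l, hl⟩ : ∃ l : Fin K, l ≠ k := by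
    have : Nontrivial (Fin K) := Fin.nontrivial_iff_two_le.2 H.two_le
    exact exists_ne k
  have hM : minDist c ≤ maxDist c := (minDist_le c hl).trans (le_maxDist c hl)
  have hM0 : 0 < maxDist c := hΔ.trans_le hM
  have hn : 0 < (size ζ k : ℝ) := by linarith [H.thirteen_le_size k]
  have h1 := (card_sdiff_le_clusterMisRate ζ z k).trans hz
  have h2 := (card_filter_le_clusterMisRate ζ z k).trans hz
  have hF2 : F ≤ 1 / 2 := by
    have : 0 ≤ (√6 + 1) * a := by positivity
    have : 0 ≤ (2.1 * √(minProp ζ) + 1) * b := by positivity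
    rw [hF]
    linarith
  have hdiv0 : 0 < minDist c / maxDist c := by positivity
  have hdiv1 : minDist c / maxDist c ≤ 1 := (div_le_one hM0).2 hM
  -- The second part of the misclassification rate keeps the initial cluster from being small.
  have hhalf : (size ζ k : ℝ) / 2 ≤ size z k := by
    have h3 : (1 / (size ζ k : ℝ)) * (cls ζ k \ cls z k).card ≤ 1 / 2 := by
      refine h1.trans ?_
      calc F * (minDist c / maxDist c) ≤ 1 / 2 * (minDist c / maxDist c) := by gcongr
        _ ≤ 1 / 2 * 1 := by gcongr
        _ = 1 / 2 := mul_one _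
    rw [one_div_mul_eq_div, div_le_iff₀ hn] at h3
    have h4 := size_add_card_sdiff (ζ := ζ) z k
    have h5 : (0 : ℝ) ≤ (cls z k \ cls ζ k).card := by positivity
    linarith
  have hn' : 0 < (size z k : ℝ) := by linarith
  have hS : ∑ i ∈ cls z k, disp ζ c z i ≤ size z k * (F * minDist c) := by
    rw [one_div_mul_eq_div, div_le_iff₀ hn'] at h2
    calc _ ≤ maxDist c * ((cls z k).filter fun i => ζ i ≠ k).card := sum_disp_le_maxDist_mul z k
      _ ≤ maxDist c * (F * (minDist c / maxDist c) * size z k) := by gcongr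
      _ = _ := by field_simp
  -- This is where `√6` in the initialization condition comes from: `3` from the subset sum bound and
  -- `2` from `hhalf`.
  have hW : σ * √(3 * (d + r) * size z k) ≤ size z k * (√6 * a * minDist c) := by
    refine abs_le_of_sq_le_sq' ?_ (by positivity) |>.2
    rw [mul_pow, mul_pow, mul_pow, mul_pow, Real.sq_sqrt (by positivity),
      Real.sq_sqrt (by norm_num)]
    have h3 := H.mul_d_le_size k
    have h4 : σ ^ 2 * (d + r) ≤ a ^ 2 * minDist c ^ 2 * (2 * size z k) := by
      have hK := H.two_le_K
      have hr : (0 : ℝ) ≤ r := by positivity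
      calc σ ^ 2 * (d + r) ≤ σ ^ 2 * (d + K * r) := by gcongr; nlinarith
        _ = a ^ 2 * minDist c ^ 2 * (minProp ζ * d) := by rw [← ha2]; ring
        _ ≤ _ := mul_le_mul_of_nonneg_left (by linarith) (by positivity)
    calc σ ^ 2 * (3 * (d + r) * size z k) = 3 * size z k * (σ ^ 2 * (d + r)) := by ring
      _ ≤ 3 * size z k * (a ^ 2 * minDist c ^ 2 * (2 * size z k)) := by gcongr
      _ = _ := by ring
  have hmain := N.norm_clusterMean_sub_le hε.le hx hn'
  rw [div_le_iff₀ hΔ]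
  refine hmain.trans ?_
  have h5 : (size z k : ℝ)⁻¹ * (∑ i ∈ cls z k, disp ζ c z i + σ * √(3 * (d + r) * size z k))
      ≤ F * minDist c + √6 * a * minDist c := by
    rw [inv_mul_le_iff₀ hn', mul_add (size z k : ℝ)]
    exact add_le_add hS hW
  have h6 : ε = √(minProp ζ) * b * minDist c := by
    rw [hb2, div_mul_cancel₀ _ hΔ.ne']
  calc _ ≤ F * minDist c + √6 * a * minDist c + √(minProp ζ) * b * minDist c := by linarith
    _ = _ := by rw [hF]; ring

/-- A margin `a + t` below `1 / 2`, with `a = 1 / ρ_σ` and `t = α^{-1/4} √(σ / Δ)`, for the relative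
error of the initial centers makes the labels after one iteration concentrated. If `r ≤ d` this is
due to `t`, otherwise both terms are needed. -/
lemma concentrated_of_norm_center_sub_le (N : GoodNoise ζ c σ ε w)
    (hx : ∀ i, ‖x i - (c (ζ i) + w i)‖ ≤ ε) {a b t : ℝ}
    (ha : a = 1 / snrNoise d K r (minDist c) σ (minProp ζ))
    (hb : b = 1 / snrError (minDist c) ε (minProp ζ))
    (ht : t = 1 / minProp ζ ^ (1 / 4 : ℝ) * √(σ / minDist c))
    (hcen : ∀ k, ‖clusterMean x z k - c k‖ / minDist c
      ≤ 1 / 2 - a - (1.1 * √(minProp ζ) + 1) * b - t)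
    (hz' : ∀ i k, ‖x i - clusterMean x z (z' i)‖ ≤ ‖x i - clusterMean x z k‖) :
    Concentrated ζ c z' := by
  have hΔ := H.dist_pos
  have hσ := H.sigma_pos
  have hα := H.prop_pos
  have hε := H.eps_pos
  have hd := H.d_pos
  have hK := H.two_le_K
  have ha2 := inv_snrNoise_sq_mul H
  have hb2 := sqrt_mul_inv_snrError H
  have ht2 := tail_margin_sq H
  have ha0 : 0 < a := by rw [ha]; exact one_div_pos.2 (snrNoise_pos H)
  have hb0 : 0 < b := by
    rw [hb]
    exact one_div_pos.2 (by unfold snrError; positivity)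
  have ht0 : 0 < t := by rw [ht]; positivity
  rw [← ha] at ha2
  rw [← hb] at hb2
  rw [← ht] at ht2
  have hα1 : √(minProp ζ) ≤ 1 := by
    have := H.prop_le
    exact Real.sqrt_le_iff.2 ⟨zero_le_one, by nlinarith⟩
  have hs0 : 0 < √(minProp ζ) := Real.sqrt_pos.2 hα
  set Λ := 1 / 2 - a - (1.1 * √(minProp ζ) + 1) * b - t with hΛ_def
  have hcen' : ∀ k, ‖clusterMean x z k - c k‖ ≤ Λ * minDist c := fun k =>
    (div_le_iff₀ hΔ).1 (hcen k)
  have hΛ0 : 0 ≤ Λ := by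
    have k : Fin K := ⟨0, by have := H.two_le; omega⟩
    exact le_trans (by positivity) (hcen k)
  have hΛ : Λ ≤ 1 / 2 := by
    have : 0 ≤ (1.1 * √(minProp ζ) + 1) * b := by positivity
    rw [hΛ_def]
    linarith
  have hm : ∀ g h, g ≠ h →
      ‖clusterMean x z h - clusterMean x z g‖ ≤ 2 * ‖c h - c g‖ := fun g h hgh =>
    norm_center_sub_le (minDist_le c hgh.symm) hΔ hΛ (hcen' g) (hcen' h)
  have hinner : ∀ i, z' i ≠ ζ i → (a + t) * ‖c (z' i) - c (ζ i)‖ ^ 2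
      ≤ inner ℝ (w i) (clusterMean x z (z' i) - clusterMean x z (ζ i)) := by
    intro i hi
    refine le_trans ?_ (inner_ge_of_closer (minDist_le c hi) hΔ hΛ0 hΛ (hcen' _) (hcen' _) (hx i)
      (hz' i (ζ i)))
    gcongr
    rw [hΛ_def, ← hb2]
    nlinarith
  have hat : t ^ 2 ≤ (a + t) ^ 2 := by gcongr; linarith
  have haa : a ^ 2 ≤ (a + t) ^ 2 := by gcongr; linarith
  -- For `r ≤ d` the worst case over the initial labels costs `σ² (d + K r) / (α d Δ²)`, which is of
  -- smaller order than `t² = σ / (√α Δ)`. For `r ≥ d` it is of the order of `a²`, too large by a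
  -- constant, and the decoupled bound is used instead.
  rcases le_total r d with hrd | hdr
  · refine concentrated_of_inner_ge H N (by positivity) hm hinner ?_
    have hrd' : (r : ℝ) ≤ d := by exact_mod_cast hrd
    have h1 : 4800 * (σ * (d + K * r)) ≤ √(minProp ζ) * d * minDist c := by
      refine abs_le_of_sq_le_sq' ?_ (by positivity) |>.2
      have h2 : (d + K * r : ℝ) ≤ 2 * K * d := by nlinarith
      calc (4800 * (σ * (d + K * r))) ^ 2
          = 4800 ^ 2 * (σ ^ 2 * (d + K * r)) * (d + K * r) := by ring
        _ ≤ 4800 ^ 2 * (σ ^ 2 * (d + K * r)) * (2 * K * d) := by gcongr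
        _ = 2 * 4800 ^ 2 * 10⁻¹ ^ 12 * d * (10 ^ 12 * K * σ ^ 2 * (d + K * r)) := by ring
        _ ≤ 2 * 4800 ^ 2 * 10⁻¹ ^ 12 * d * (minProp ζ * d * minDist c ^ 2) :=
            mul_le_mul_of_nonneg_left H.noise_le (by positivity)
        _ ≤ 1 * d * (minProp ζ * d * minDist c ^ 2) := by
            gcongr
            norm_num
        _ = _ := by rw [mul_pow, mul_pow, Real.sq_sqrt hα.le]; ring
    calc 4800 * σ ^ 2 * (d + K * r) = σ * (4800 * (σ * (d + K * r))) := by ring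
      _ ≤ σ * (√(minProp ζ) * d * minDist c) := by gcongr
      _ = t ^ 2 * (√(minProp ζ) ^ 2 * d * minDist c ^ 2) := by
          nth_rewrite 1 [← ht2]
          ring
      _ = t ^ 2 * (minProp ζ * d * minDist c ^ 2) := by rw [Real.sq_sqrt hα.le]
      _ ≤ _ := by gcongr
  · refine concentrated_of_clusterMean H N hx (by positivity) hm hinner hdr ?_ ?_
    · calc σ = √(minProp ζ) * minDist c * t ^ 2 := ht2.symm
        _ ≤ _ := by gcongr
    · rw [← ha2]
      gcongr

/-- After one iteration from a good enough initialization the labels are concentrated. -/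
theorem concentrated_of_goodInit (N : GoodNoise ζ c σ ε w)
    (hx : ∀ i, ‖x i - (c (ζ i) + w i)‖ ≤ ε) (hinit : GoodInit ζ c σ ε z (clusterMean x z))
    (hz' : ∀ i k, ‖x i - clusterMean x z (z' i)‖ ≤ ‖x i - clusterMean x z k‖) :
    Concentrated ζ c z' := by
  have ht0 : 0 ≤ 1 / minProp ζ ^ (1 / 4 : ℝ) * √(σ / minDist c) := by
    have := H.prop_pos
    positivity
  refine concentrated_of_norm_center_sub_le H N hx rfl rfl rfl ?_ hz'
  rcases hinit.2 with h | h
  · refine norm_center_sub_le_of_clusterMisRate_le H N hx rfl rfl ht0 ?_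
    rw [div_eq_mul_one_div (√6 + 1), div_eq_mul_one_div (2.1 * √(minProp ζ) + 1)] at h
    exact h
  · intro k
    have := h k
    rw [div_eq_mul_one_div (1.1 * √(minProp ζ) + 1)] at this
    exact this

end Initialization

/-! ### All iterations -/

section Iterations

variable {d K r : ℕ} {σ ε : ℝ} {ζ : Fin d → Fin K} {c : Fin K → EuclideanSpace ℝ (Fin r)}
  {w x : Fin d → EuclideanSpace ℝ (Fin r)}
  (H : Regime d K r σ ε (minDist c) (minProp ζ))

include H

/-- Concentration of the labels is preserved by the iterations. -/
lemma Concentrated.step (N : GoodNoise ζ c σ ε w) (hx : ∀ i, ‖x i - (c (ζ i) + w i)‖ ≤ ε)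
    {z z' : Fin d → Fin K} (hc : Concentrated ζ c z)
    (hz' : ∀ i k, ‖x i - clusterMean x z (z' i)‖ ≤ ‖x i - clusterMean x z k‖) :
    Concentrated ζ c z' := by
  have hΔ := H.dist_pos
  have hK := H.two_le_K
  have hd := H.d_pos
  have hα := H.prop_pos
  have hcen := hc.norm_clusterMean_sub_le H N hx
  refine concentrated_of_inner_ge H N (τ := 0.48) (m := clusterMean x z) (by norm_num)
    (fun g h hgh => norm_center_sub_le (minDist_le c hgh.symm) hΔ (by norm_num) (hcen g) (hcen h))
    (fun i hi => ?_) ?_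
  · refine le_trans ?_ (inner_ge_of_closer (minDist_le c hi) hΔ (by norm_num) (by norm_num)
      (hcen _) (hcen _) (hx i) (hz' i (ζ i)))
    have h2 : ε / minDist c ≤ 1 / 1000 := by
      rw [div_le_div_iff₀ hΔ (by norm_num)]
      have := H.mul_eps_le
      have := H.eps_pos
      nlinarith
    gcongr
    norm_num at *
    linarith
  · have h1 := H.noise_le
    have h2 : 10 ^ 12 * 1 * σ ^ 2 * (d + K * r) ≤ 10 ^ 12 * K * σ ^ 2 * (d + K * r) := by
      gcongr
      linarith
    have h3 : 0 ≤ σ ^ 2 * (d + K * r) := by positivity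
    norm_num at *
    linarith

/-- On the good event every run of Lloyd's algorithm from a good enough initialization succeeds. -/
theorem lloydSucceeds_of_goodNoise (N : GoodNoise ζ c σ ε w)
    (hx : ∀ i, ‖x i - (c (ζ i) + w i)‖ ≤ ε) : LloydSucceeds ζ c σ ε x := by
  intro zs ms hrun hinit s hs
  have hΔ := H.dist_pos
  have hd := H.d_pos
  have hsize : ∀ z : Fin d → Fin K, (∀ k, ∃ i, z i = k) → ∀ s, zs s = z →
      ms s = clusterMean x z := by
    intro z hz s hzs
    funext k
    rw [← hzs]
    refine hrun.center s k ?_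
    rw [hzs]
    exact hz k
  -- Clusters of concentrated labels are nonempty, so the arbitrary center of an empty cluster never
  -- plays a role.
  have hne : ∀ z, Concentrated ζ c z → ∀ k, ∃ i, z i = k := by
    intro z hz k
    have h1 : 0 < size z k := by exact_mod_cast hz.size_pos H k
    rw [← card_cls, Finset.card_pos] at h1
    obtain ⟨i, hi⟩ := h1
    exact ⟨i, mem_cls.1 hi⟩
  set e₁ := Real.exp (-(minDist c ^ 2 / (16 * σ ^ 2))) with he₁
  set e₂ := Real.exp (-(minDist c ^ 2 / (8 * ε * σ))) with he₂
  have hiter : ∀ n, Concentrated ζ c (zs (n + 1)) ∧ ∑ i, disp ζ c (zs (n + 1)) i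
      ≤ (1 / 4) ^ n * (minDist c * d) + minDist c * d * ((e₁ + e₂) / 6) := by
    intro n
    induction n with
    | zero =>
      have hm0 := hsize (zs 0) hinit.1 0 rfl
      have hc : Concentrated ζ c (zs 1) := by
        rw [hm0] at hinit
        refine concentrated_of_goodInit H N hx hinit fun i k => ?_
        rw [← hm0]
        exact hrun.assign 0 i k
      refine ⟨hc, ?_⟩
      have h1 : ∑ i, disp ζ c (zs 1) i ≤ minDist c / 400 * d := by
        rw [← sum_cls ζ, ← sum_size ζ, Finset.mul_sum]
        exact Finset.sum_le_sum fun k _ => (hc k).2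
      have h2 : 0 ≤ minDist c * d * ((e₁ + e₂) / 6) := by positivity
      have h3 : 0 ≤ minDist c * d := by positivity
      simp only [zero_add, pow_zero, one_mul]
      linarith
    | succ n ih =>
      obtain ⟨hc, hΦ⟩ := ih
      have hm := hsize _ (hne _ hc) (n + 1) rfl
      have hz : ∀ i k, ‖x i - clusterMean x (zs (n + 1)) (zs (n + 1 + 1) i)‖
          ≤ ‖x i - clusterMean x (zs (n + 1)) k‖ := by
        intro i k
        rw [← hm]
        exact hrun.assign (n + 1) i k
      refine ⟨hc.step H N hx hz, ?_⟩
      have h1 := sum_disp_le H N hx hc hz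
      rw [pow_succ]
      linarith
  have hd13 : (13 : ℝ) ≤ d := by
    have h1 := H.thirteen_le
    have h2 := H.prop_le
    have h3 := H.two_le_K
    have h4 := H.prop_pos
    nlinarith
  have hlog : 1 ≤ Real.log d := by
    rw [Real.le_log_iff_exp_le hd]
    have := Real.exp_one_lt_d9
    linarith
  obtain ⟨n, rfl⟩ : ∃ n, s = n + 1 := by
    refine ⟨s - 1, ?_⟩
    have h1 : (0 : ℝ) < s := by linarith
    have h2 : 0 < s := by exact_mod_cast h1
    omega
  -- One of the `s = n + 1` iterations only reaches concentration; since `4 > e`, the other `n`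
  -- iterations still bring the contribution of the initial labels below one point.
  have hpow : (1 / 4 : ℝ) ^ n * d ≤ 1 / 4 := by
    have h1 : (d : ℝ) ^ 4 ≤ 4 ^ (n + 1) := by
      calc (d : ℝ) ^ 4 = Real.exp (4 * Real.log d) := by
            rw [show (4 : ℝ) * Real.log d = ((4 : ℕ) : ℝ) * Real.log d by norm_num,
              Real.exp_nat_mul, Real.exp_log hd]
        _ ≤ Real.exp ((n + 1 : ℕ) * 1) := by
            rw [Real.exp_le_exp, mul_one]
            exact hs
        _ = Real.exp 1 ^ (n + 1) := Real.exp_nat_mul _ _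
        _ ≤ 4 ^ (n + 1) := by
            gcongr
            have := Real.exp_one_lt_d9
            linarith
    have h2 : (16 : ℝ) * d ≤ d ^ 4 := by
      have : (13 : ℝ) ^ 3 ≤ d ^ 3 := pow_le_pow_left₀ (by norm_num) hd13 3
      nlinarith
    rw [one_div, inv_pow, inv_mul_le_iff₀ (by positivity)]
    rw [pow_succ (4 : ℝ) n] at h1
    linarith
  obtain ⟨-, hΦ⟩ := hiter n
  have hcard := card_filter_ne_mul_le (ζ := ζ) (c := c) (zs (n + 1)) Finset.univ
  rw [misRate]
  set m := (Finset.univ.filter fun i => zs (n + 1) i ≠ ζ i).card with hm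
  have h1 : (m : ℝ) ≤ 1 / 4 + d * ((e₁ + e₂) / 6) := by
    refine le_of_mul_le_mul_right ?_ hΔ
    calc (m : ℝ) * minDist c ≤ _ := hcard.trans hΦ
      _ = ((1 / 4) ^ n * d + d * ((e₁ + e₂) / 6)) * minDist c := by ring
      _ ≤ _ := by gcongr
  have h2 : e₁ + e₂ ≤ 2 * max e₁ e₂ := by
    have := le_max_left e₁ e₂
    have := le_max_right e₁ e₂
    linarith
  have h3 : 0 < max e₁ e₂ := lt_max_of_lt_left (Real.exp_pos _)
  rw [one_div_mul_eq_div, div_le_iff₀ hd]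
  -- a nonzero number of misclassified points is at least one, which absorbs the term `1 / 4`
  rcases Nat.eq_zero_or_pos m with h0 | h0
  · rw [h0]
    push_cast
    positivity
  · have h4 : (1 : ℝ) ≤ m := by exact_mod_cast h0
    have h5 : d * ((e₁ + e₂) / 6) ≤ d * (max e₁ e₂ / 3) :=
      mul_le_mul_of_nonneg_left (by linarith) hd.le
    have h6 : 0 < max e₁ e₂ * d := by positivity
    linarith

end Iterations

/-! ### The conditional law of the loadings and the main theorem -/

section Law

variable {d K r : ℕ}

lemma regime_of_snr {σ ε Δ α : ℝ} {ζ : Fin d → Fin K} {c : Fin K → EuclideanSpace ℝ (Fin r)}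
    (hK : 2 ≤ K) (hσ : 0 < σ) (hε : 0 < ε) (hΔ : Δ = minDist c) (hα : α = minProp ζ)
    (hlog : 10 * K * Real.log d ≤ d * α) (hnoise : 10 ^ 6 * √K ≤ snrNoise d K r Δ σ α)
    (herror : 10 ^ 6 * √K ≤ snrError Δ ε α) (hrank : r * Real.log 3 ≤ Δ ^ 2 / (ε * σ)) :
    Regime d K r σ ε Δ α := by
  have hK0 : (0 : ℝ) < K := by exact_mod_cast (by omega : 0 < K)
  have hΔ0 : 0 ≤ Δ := by
    rw [hΔ]
    exact Real.iInf_nonneg fun q => norm_nonneg _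
  have hpos : 0 < snrNoise d K r Δ σ α := lt_of_lt_of_le (by positivity) hnoise
  have hden : (0 : ℝ) < 1 + K * r / d := by positivity
  have hΔp : 0 < Δ := by
    rcases hΔ0.eq_or_lt with h | h
    · rw [snrNoise, ← h] at hpos
      simp at hpos
    · exact h
  have hαp : 0 < α := by
    by_contra hcon
    rw [not_lt] at hcon
    have : √(α / (1 + (K : ℝ) * r / d)) = 0 :=
      Real.sqrt_eq_zero_of_nonpos (div_nonpos_of_nonpos_of_nonneg hcon hden.le)
    rw [snrNoise, this] at hpos
    simp at hpos
  have hd0 : d ≠ 0 := by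
    rintro rfl
    have : α = 0 := by
      rw [hα, minProp]
      simp
    linarith
  have hd : (0 : ℝ) < d := by exact_mod_cast Nat.pos_of_ne_zero hd0
  have hsize : ∀ k, α * d ≤ size ζ k := fun k => by
    rw [hα]
    exact (le_div_iff₀ hd).1 (minProp_le ζ k)
  have hαd : 0 < α * d := by positivity
  have hKα : K * α ≤ 1 := by
    have h1 : ∑ _k : Fin K, α * d ≤ ∑ k, (size ζ k : ℝ) := Finset.sum_le_sum fun k _ => hsize k
    rw [sum_size] at h1
    simp only [Finset.sum_const, Finset.card_univ, Fintype.card_fin, nsmul_eq_mul] at h1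
    refine le_of_mul_le_mul_right ?_ hd
    linarith
  have hKd : K ≤ d := by
    have h1 : ∑ _k : Fin K, (1 : ℝ) ≤ ∑ k, (size ζ k : ℝ) := Finset.sum_le_sum fun k _ => by
      have : (0 : ℝ) < size ζ k := hαd.trans_le (hsize k)
      have : 0 < size ζ k := by exact_mod_cast this
      exact_mod_cast this
    rw [sum_size] at h1
    simp only [Finset.sum_const, Finset.card_univ, Fintype.card_fin, nsmul_eq_mul, mul_one] at h1
    exact_mod_cast h1
  refine ⟨hK, hKd, hσ, hε, hΔp, hαp, hKα, hlog, ?_, ?_, ?_⟩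
  · have h1 := pow_le_pow_left₀ (by positivity) hnoise 2
    rw [snrNoise, mul_pow, mul_pow, Real.sq_sqrt hK0.le, Real.sq_sqrt (by positivity)] at h1
    have h2 : (Δ / σ) ^ 2 * (α / (1 + (K : ℝ) * r / d))
        = α * d * Δ ^ 2 / (σ ^ 2 * (d + K * r)) := by
      field_simp
    rw [h2, le_div_iff₀ (by positivity)] at h1
    refine le_trans (le_of_eq ?_) h1
    ring
  · have h1 := pow_le_pow_left₀ (by positivity) herror 2
    rw [snrError, mul_pow, div_pow, mul_pow, Real.sq_sqrt hK0.le, Real.sq_sqrt hαp.le,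
      le_div_iff₀ (by positivity)] at h1
    refine le_trans (le_of_eq ?_) h1
    ring
  · refine le_trans ?_ hrank
    have h1 : 1 ≤ Real.log 3 := by
      rw [Real.le_log_iff_exp_le (by norm_num)]
      have := Real.exp_one_lt_d9
      linarith
    have h2 : (0 : ℝ) ≤ r := by positivity
    nlinarith

lemma IsSubGaussian.lintegral_le {G : Measure (EuclideanSpace ℝ (Fin r))} {σ : ℝ}
    (h : IsSubGaussian G σ) (a : EuclideanSpace ℝ (Fin r)) :
    ∫⁻ y, eexp (inner ℝ (y - mean G) a) ∂G ≤ eexp (σ ^ 2 * ‖a‖ ^ 2 / 2) := by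
  unfold eexp
  rw [← ofReal_integral_eq_lintegral_ofReal (h a).1
    (Filter.Eventually.of_forall fun y => (Real.exp_pos _).le)]
  exact ENNReal.ofReal_le_ofReal (h a).2

variable {Ω : Type*} [MeasurableSpace Ω] {P : Measure Ω} {p : PMF (Fin K)}
  {G : Fin K → Measure (EuclideanSpace ℝ (Fin r))}
  {z : Fin d → Ω → Fin K} {lam : Fin d → Ω → EuclideanSpace ℝ (Fin r)}

lemma IsMixtureSample.measure_inter (h : IsMixtureSample P p G z lam) (ζ : Fin d → Fin K)
    {s : Fin d → Set (EuclideanSpace ℝ (Fin r))} (hs : ∀ i, MeasurableSet (s i)) :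
    P ({ω | ∀ i, z i ω = ζ i} ∩ {ω | ∀ i, lam i ω ∈ s i})
      = (∏ i, p (ζ i)) * ∏ i, G (ζ i) (s i) := by
  have h1 := h.indep.measure_inter_preimage_eq_mul Finset.univ (sets := fun i => {ζ i} ×ˢ s i)
    (fun i _ => (measurableSet_singleton _).prod (hs i))
  have h2 : {ω | ∀ i, z i ω = ζ i} ∩ {ω | ∀ i, lam i ω ∈ s i}
      = ⋂ i ∈ Finset.univ, (fun ω => (z i ω, lam i ω)) ⁻¹' ({ζ i} ×ˢ s i) := by
    ext ω
    simp [forall_and]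
  rw [h2, h1, ← Finset.prod_mul_distrib]
  refine Finset.prod_congr rfl fun i _ => ?_
  rw [← h.law i (ζ i) (s i) (hs i)]
  congr 1

variable [IsProbabilityMeasure P] [∀ k, IsProbabilityMeasure (G k)]

/-- Given the membership function, the loadings are independent, and each of them has the law of
its component. -/
lemma IsMixtureSample.map_cond (h : IsMixtureSample P p G z lam) {ζ : Fin d → Fin K}
    (h0 : P {ω | ∀ i, z i ω = ζ i} ≠ 0) :
    (cond P {ω | ∀ i, z i ω = ζ i}).map (fun ω i => lam i ω) = Measure.pi fun i => G (ζ i) := by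
  have hA : MeasurableSet {ω | ∀ i, z i ω = ζ i} := by
    have : {ω | ∀ i, z i ω = ζ i} = ⋂ i, z i ⁻¹' {ζ i} := by ext ω; simp
    rw [this]
    exact MeasurableSet.iInter fun i => h.measurable_z i (measurableSet_singleton _)
  have hPA : P {ω | ∀ i, z i ω = ζ i} = ∏ i, p (ζ i) := by
    have := h.measure_inter ζ (s := fun _ => Set.univ) fun _ => MeasurableSet.univ
    simpa using this
  refine (Measure.pi_eq fun s hs => ?_).symm
  rw [Measure.map_apply (measurable_pi_lambda _ h.measurable_lam)
    (MeasurableSet.univ_pi hs), cond_apply hA]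
  have h1 : (fun ω i => lam i ω) ⁻¹' Set.univ.pi s = {ω | ∀ i, lam i ω ∈ s i} := by
    ext ω
    simp
  rw [h1, h.measure_inter ζ hs, ← mul_assoc, hPA, ENNReal.inv_mul_cancel, one_mul]
  · rw [← hPA]; exact h0
  · rw [← hPA]; exact measure_ne_top _ _

/-- Success of Lloyd's algorithm on arbitrary estimates of the rotated loadings. The failure event
is contained in the event that the noise is not well behaved, which does not involve the
estimates or the rotation. -/
theorem cond_lloyd_fails_lt (h : IsMixtureSample P p G z lam) {σ ε : ℝ}
    (hG : ∀ k, IsSubGaussian (G k) σ) {ζ : Fin d → Fin K} {μ : Fin K → EuclideanSpace ℝ (Fin r)}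
    (hμ : ∀ k, μ k = mean (G k)) (H : Regime d K r σ ε (minDist μ) (minProp ζ))
    (lamHat : Fin d → Ω → EuclideanSpace ℝ (Fin r))
    (U : Ω → EuclideanSpace ℝ (Fin r) ≃ₗᵢ[ℝ] EuclideanSpace ℝ (Fin r)) :
    (cond P {ω | ∀ i, z i ω = ζ i}) {ω | (∀ i, ‖lamHat i ω - U ω (lam i ω)‖ ≤ ε) ∧
        ¬ LloydSucceeds ζ (fun k => U ω (μ k)) σ ε (fun i => lamHat i ω)}
      < ENNReal.ofReal (failProb d σ (minDist μ) ε) := by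
  have hG' : ∀ k a, ∫⁻ y, eexp (inner ℝ (y - μ k) a) ∂(G k) ≤ eexp (σ ^ 2 * ‖a‖ ^ 2 / 2) := by
    intro k a
    rw [hμ k]
    exact (hG k).lintegral_le a
  have hgood := measure_not_goodNoise_lt H hG'
  by_cases h0 : P {ω | ∀ i, z i ω = ζ i} = 0
  · rw [cond_eq_zero_of_meas_eq_zero h0]
    simpa using pos_of_gt hgood
  rw [← h.map_cond h0] at hgood
  refine lt_of_le_of_lt ?_ hgood
  refine le_trans (measure_mono ?_) (Measure.le_map_apply
    (measurable_pi_lambda _ h.measurable_lam).aemeasurable _)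
  rintro ω ⟨hle, hfail⟩ hN
  refine hfail ?_
  have hN' := hN.map (U ω)
  rw [← minDist_map (U ω) μ] at H
  refine lloydSucceeds_of_goodNoise H hN' fun i => ?_
  simp only [map_sub, add_sub_cancel]
  exact hle i

end Law

end CDFM

theorem theorem1 :
    ∃ C₁ C₂ C₃ : ℝ, 0 < C₁ ∧ 0 < C₂ ∧ 0 < C₃ ∧
      ∀ (d K r : ℕ), 2 ≤ K →
      ∀ (Ω : Type*) [MeasurableSpace Ω] (P : Measure Ω) [IsProbabilityMeasure P]
        (p : PMF (Fin K)) (G : Fin K → Measure (EuclideanSpace ℝ (Fin r)))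
        [∀ k, IsProbabilityMeasure (G k)]
        (z : Fin d → Ω → Fin K) (lam : Fin d → Ω → EuclideanSpace ℝ (Fin r)) (σ ε : ℝ),
        0 < σ → 0 < ε → (∀ k, CDFM.IsSubGaussian (G k) σ) →
        CDFM.IsMixtureSample P p G z lam →
      ∀ (ζ : Fin d → Fin K) (μ : Fin K → EuclideanSpace ℝ (Fin r)) (Δ α : ℝ),
        (∀ k, μ k = CDFM.mean (G k)) → Δ = CDFM.minDist μ → α = CDFM.minProp ζ →
        C₁ * K * Real.log d ≤ d * α →
        C₂ * √K ≤ CDFM.snrNoise d K r Δ σ α →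
        C₃ * √K ≤ CDFM.snrError Δ ε α →
        r * Real.log 3 ≤ Δ ^ 2 / (ε * σ) →
        -- arbitrary estimates of the (possibly rotated) loadings
        (∀ (lamHat : Fin d → Ω → EuclideanSpace ℝ (Fin r))
            (U : Ω → EuclideanSpace ℝ (Fin r) ≃ₗᵢ[ℝ] EuclideanSpace ℝ (Fin r)),
          (ProbabilityTheory.cond P {ω | ∀ i, z i ω = ζ i})
              {ω | (∀ i, ‖lamHat i ω - U ω (lam i ω)‖ ≤ ε) ∧
                ¬ CDFM.LloydSucceeds ζ (fun k => U ω (μ k)) σ ε (fun i => lamHat i ω)}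
            < ENNReal.ofReal (CDFM.failProb d σ Δ ε)) ∧
        -- in particular, the PCA estimates in the factor model
        (∀ (T : ℕ) (f : ℤ → Ω → EuclideanSpace ℝ (Fin r))
            (e X : ℤ → Ω → EuclideanSpace ℝ (Fin d))
            (lamHat : Fin d → Ω → EuclideanSpace ℝ (Fin r))
            (U : Ω → EuclideanSpace ℝ (Fin r) ≃ₗᵢ[ℝ] EuclideanSpace ℝ (Fin r)),
          1 ≤ T → CDFM.IsFactorModel lam f e X →
          (∀ ω, CDFM.IsPCALoadings (CDFM.sampleCov T (fun t => X t ω)) (fun i => lamHat i ω)) →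
          (∀ ω, CDFM.DiagonalizesGram (fun i => lam i ω) (U ω)) →
          (ProbabilityTheory.cond P {ω | ∀ i, z i ω = ζ i})
              {ω | (∀ i, ‖lamHat i ω - U ω (lam i ω)‖ ≤ ε) ∧
                ¬ CDFM.LloydSucceeds ζ (fun k => U ω (μ k)) σ ε (fun i => lamHat i ω)}
            < ENNReal.ofReal (CDFM.failProb d σ Δ ε)) := by
  refine ⟨10, 10 ^ 6, 10 ^ 6, by norm_num, by norm_num, by norm_num, ?_⟩
  intro d K r hK Ω _ P _ p G _ z lam σ ε hσ hε hG hsample ζ μ Δ α hμ hΔ hα hlog hnoise herror hrank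
  have H := CDFM.regime_of_snr hK hσ hε hΔ hα hlog hnoise herror hrank
  subst hΔ hα
  have hmain := CDFM.cond_lloyd_fails_lt hsample hG hμ H
  exact ⟨hmain, fun _ _ _ _ lamHat U _ _ _ _ => hmain lamHat U⟩
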